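/- Let $k\ge 1$ and $m\ge k$ be integers. Let $E\subset\mathbb R^2$ be a bounded open set, star-shaped with respect to a ball, whose boundary is the union of $N_E$ edges $e_1,\dots,e_{N_E}$ with pairwise distinct vertices $V_1,\dots,V_{N_E}$, where $e_i$ joins $V_i$ to $V_{i+1}$ (indices modulo $N_E$) and two distinct edges meet at most in common endpoints. The edges $e_2,\dots,e_{N_E}$ are straight segments, and the (possibly) curved edge is $e_1=\gamma(I_{e_1})$, where $I_{e_1}=[a,b]$, $a<b$, and $\gamma:I_{e_1}\to\mathbb R^2$ is injective and of class $C^{m+1}$ with $\gamma'\neq 0$ on $I_{e_1}$, $\gamma(a)=V_1$ and $\gamma(b)=V_2$. Let $\mathbb P_n$ denote the polynomials of degree at most $n$ (with $\mathbb P_{-1}=\{0\}$), let $\widetilde{\mathbb P}_k(e_1)=\{\hat q\circ\gamma^{-1}:\hat q\in\mathbb P_k(I_{e_1})\}$, and let $$V_h^E=\{v\in H^1(E)\cap C^0(\overline E):\ -\Delta v\in\mathbb P_{k-2}(E),\ v_{|e_1}\in\widetilde{\mathbb P}_k(e_1),\ v_{|e_i}\in\mathbb P_k(e_i)\ \text{for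 } i=2,\dots,N_E\},$$ where $\Delta$ is taken in the sense of distributions. Let $\{m_j\}_{j=1}^{k(k-1)/2}$ be any basis of $\mathbb P_{k-2}(E)$ with $\|m_j\|_{L^\infty(E)}=1$ for all $j$. The $(k+1)$-point Gauss–Lobatto rule on an interval consists of the two endpoints and of the zeros of the derivative of the Legendre polynomial of degree $k$ transported to that interval. These zeros are exactly $k-1$ distinct points in the interior of the interval, and the following linear functionals form a unisolvent set of degrees of freedom for $V_h^E$: - the values $v(V_i)$, $i=1,\dots,N_E$; - the values of $v$ at the $k-1$ internal Gauss–Lobatto points of each straight edge $e_2,\dots,e_{N_E}$; - the values of $v$ at the images under $\gamma$ of the $k-1$ internal Gauss–Lobatto points of $I_{e_1}$; - the moments $\frac1{|E|}\int_E v\,m_j\,dE$, $j=1,\dots,k(k-1)/2$. That is, the linear map sending $v\in V_h^E$ to the family of these $kN_E+\frac{k(k-1)}2$ values is a bijection from $V_h^E$ onto $\mathbb R^{kN_E+k(k-1)/2}$. -/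

import Mathlib

open MeasureTheory Set
open scoped ContDiff

noncomputable section

/-- The Euclidean plane. -/
abbrev Plane : Type := EuclideanSpace ℝ (Fin 2)

/-! ### Elements with one curved edge -/

/-- An element `E` (an open set) with `N` vertices and `N` edges. The edge `0` is the curved one: it
is parametrized on `[a, b]` by the regular injective `C^{m+1}` curve `γ`, from the vertex `0` to the
vertex `1`; for `i ≠ 0` the edge `i` is the straight segment from the vertex `i` to the vertex
`i + 1` (indices modulo `N`). Star-shapedness with respect to a ball and the nondegeneracy of the
edges are the shape regularity requirements, for a single element.
Since `γ` is injective, `N ≥ 2`; the case of one curved edge and one chord is allowed. -/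
structure CurvedElement (N : ℕ) [NeZero N] (m : ℕ) where
  /-- the (open) element -/
  E : Set Plane
  /-- the vertices, in cyclic order -/
  vertex : Fin N → Plane
  /-- left end of the parameter interval of the curved edge -/
  a : ℝ
  /-- right end of the parameter interval of the curved edge -/
  b : ℝ
  /-- the parametrization of the curved edge (only its values on `[a, b]` matter) -/
  γ : ℝ → Plane
  isOpen : IsOpen E
  isBounded : Bornology.IsBounded E
  starShaped : ∃ (c : Plane) (r : ℝ), 0 < r ∧ Metric.ball c r ⊆ E ∧
    ∀ y ∈ Metric.ball c r, StarConvex ℝ y E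
  a_lt_b : a < b
  γ_contDiffOn : ContDiffOn ℝ ((m + 1 : ℕ) : WithTop ℕ∞) γ (Icc a b)
  γ_regular : ∀ t ∈ Icc a b, derivWithin γ (Icc a b) t ≠ 0
  γ_injOn : InjOn γ (Icc a b)
  γ_left : γ a = vertex 0
  γ_right : γ b = vertex 1
  vertex_injective : Function.Injective vertex
  /-- distinct edges meet at most at common endpoints -/
  edge_inter : ∀ i j : Fin N, i ≠ j →
    (if i = 0 then γ '' Icc a b else segment ℝ (vertex i) (vertex (i + 1))) ∩
      (if j = 0 then γ '' Icc a b else segment ℝ (vertex j) (vertex (j + 1))) ⊆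
    {vertex i, vertex (i + 1)} ∩ {vertex j, vertex (j + 1)}
  /-- the boundary of the element is the union of its edges -/
  frontier_eq : frontier E =
    ⋃ i : Fin N, if i = 0 then γ '' Icc a b else segment ℝ (vertex i) (vertex (i + 1))

/-! ### Polynomials and Gauss-Lobatto nodes -/

/-- Real polynomials in two variables of total degree at most `n`; zero if `n < 0`. -/
def polyLE (n : ℤ) : Submodule ℝ (MvPolynomial (Fin 2) ℝ) :=
  MvPolynomial.restrictSupport ℝ {s : Fin 2 →₀ ℕ | ((s 0 : ℤ) + (s 1 : ℤ)) ≤ n}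

/-- The value of a polynomial in two variables at a point of the plane. -/
def polyVal (p : MvPolynomial (Fin 2) ℝ) (x : Plane) : ℝ :=
  MvPolynomial.eval (fun j => x j) p

/-- The internal nodes of the `(k+1)`-point Gauss-Lobatto quadrature rule on `[0, 1]`: the zeros of
the derivative of the Legendre polynomial of degree `k` (shifted to `[0, 1]`). The two other nodes
of the rule are `0` and `1`. -/
def lobattoInternal (k : ℕ) : Finset ℝ :=
  ((Polynomial.derivative (Polynomial.shiftedLegendre k)).map
    (Int.castRingHom ℝ)).roots.toFinset

/-- The point of the interval `[a, b]` that corresponds to `t ∈ [0, 1]`. -/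
def onInterval (a b t : ℝ) : ℝ := a + t * (b - a)

/-! ### Weak derivatives -/

/-- `φ` is a test function on the open set `E`, that is `φ ∈ C_c^∞(E)`. -/
structure IsTest (E : Set Plane) (φ : Plane → ℝ) : Prop where
  smooth : ContDiff ℝ ∞ φ
  compact : HasCompactSupport φ
  supp : tsupport φ ⊆ E

/-- `g` is a weak gradient of `u` on `E`. -/
def HasWeakGradient (E : Set Plane) (u : Plane → ℝ) (g : Plane → Plane) : Prop :=
  ∀ φ : Plane → ℝ, IsTest E φ →
    ∫ x in E, u x • gradient φ x = - ∫ x in E, φ x • g x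

/-- `u ∈ H¹(E)`: `u` is square integrable and has a square integrable weak gradient. -/
def MemH1 (E : Set Plane) (u : Plane → ℝ) : Prop :=
  MemLp u 2 (volume.restrict E) ∧
    ∃ g : Plane → Plane, MemLp g 2 (volume.restrict E) ∧ HasWeakGradient E u g

/-- `-Δ u = f` on `E` in the sense of distributions. -/
def HasWeakNegLaplacian (E : Set Plane) (u f : Plane → ℝ) : Prop :=
  ∀ φ : Plane → ℝ, IsTest E φ →
    - ∫ x in E, u x * Laplacian.laplacian φ x = ∫ x in E, f x * φ x

/-! Facts needed to see that the virtual space is a vector space. -/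

theorem IsTest.memLp_gradient {E : Set Plane} {φ : Plane → ℝ} (h : IsTest E φ) :
    MemLp (gradient φ) 2 (volume.restrict E) := by
  have hc : Continuous (gradient φ) :=
    (InnerProductSpace.toDual ℝ Plane).symm.continuous.comp
      (h.smooth.continuous_fderiv (by simp))
  have hs : HasCompactSupport (gradient φ) :=
    (h.compact.fderiv (𝕜 := ℝ)).comp_left
      (g := fun l => (InnerProductSpace.toDual ℝ Plane).symm l) (by simp)
  exact (hc.memLp_of_hasCompactSupport hs).restrict E

theorem IsTest.memLp {E : Set Plane} {φ : Plane → ℝ} (h : IsTest E φ) :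
    MemLp φ 2 (volume.restrict E) :=
  (h.smooth.continuous.memLp_of_hasCompactSupport h.compact).restrict E

theorem IsTest.memLp_laplacian {E : Set Plane} {φ : Plane → ℝ} (h : IsTest E φ) :
    MemLp (Laplacian.laplacian φ) 2 (volume.restrict E) := by
  have hc : Continuous (Laplacian.laplacian φ) := by
    rw [InnerProductSpace.laplacian_eq_iteratedFDeriv_stdOrthonormalBasis]
    refine continuous_finsetSum _ fun i _ => ?_
    have := h.smooth.continuous_iteratedFDeriv (m := 2) (by norm_cast)
    fun_prop
  have hs : HasCompactSupport (Laplacian.laplacian φ) := by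
    refine HasCompactSupport.of_support_subset_isCompact h.compact fun x hx => ?_
    by_contra hn
    apply hx
    have h0 : φ =ᶠ[nhds x] fun _ => (0 : ℝ) := notMem_tsupport_iff_eventuallyEq.mp hn
    rw [(InnerProductSpace.laplacian_congr_nhds h0).eq_of_nhds]
    simp
  exact (hc.memLp_of_hasCompactSupport hs).restrict E

theorem memLp_polyVal {E : Set Plane} (hE : Bornology.IsBounded E)
    (p : MvPolynomial (Fin 2) ℝ) : MemLp (polyVal p) 2 (volume.restrict E) := by
  have hc : Continuous (polyVal p) := by
    unfold polyVal
    exact (MvPolynomial.continuous_eval p).comp (by fun_prop)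
  obtain ⟨C, hC⟩ := hE.isCompact_closure.exists_bound_of_continuousOn hc.continuousOn
  have : IsFiniteMeasure ((volume : Measure Plane).restrict (closure E)) :=
    isFiniteMeasure_restrict.mpr hE.isCompact_closure.measure_lt_top.ne
  refine (MemLp.of_bound hc.aestronglyMeasurable C ?_).mono_measure
    (Measure.restrict_mono subset_closure le_rfl)
  filter_upwards [ae_restrict_mem isClosed_closure.measurableSet] with x hx using hC x hx

theorem integrable_smul_of_memLp {μ : Measure Plane} {u : Plane → ℝ} {g : Plane → Plane}
    (hg : MemLp g 2 μ) (hu : MemLp u 2 μ) : Integrable (fun x => u x • g x) μ :=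
  memLp_one_iff_integrable.mp (hg.smul hu)

theorem MemH1.zero (E : Set Plane) : MemH1 E 0 :=
  ⟨MemLp.zero, 0, MemLp.zero, fun φ _ => by simp⟩

theorem MemH1.add {E : Set Plane} {u v : Plane → ℝ} (hu : MemH1 E u) (hv : MemH1 E v) :
    MemH1 E (u + v) := by
  obtain ⟨hu, g, hg, hug⟩ := hu
  obtain ⟨hv, g', hg', hvg⟩ := hv
  refine ⟨hu.add hv, g + g', hg.add hg', fun φ hφ => ?_⟩
  have e1 : Integrable (fun x => u x • gradient φ x) (volume.restrict E) :=
    integrable_smul_of_memLp hφ.memLp_gradient hu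
  have e2 : Integrable (fun x => v x • gradient φ x) (volume.restrict E) :=
    integrable_smul_of_memLp hφ.memLp_gradient hv
  have e3 : Integrable (fun x => φ x • g x) (volume.restrict E) :=
    integrable_smul_of_memLp hg hφ.memLp
  have e4 : Integrable (fun x => φ x • g' x) (volume.restrict E) :=
    integrable_smul_of_memLp hg' hφ.memLp
  simp only [Pi.add_apply, add_smul, smul_add]
  rw [integral_add e1 e2, integral_add e3 e4, hug φ hφ, hvg φ hφ]
  abel

theorem MemH1.smul {E : Set Plane} {u : Plane → ℝ} (c : ℝ) (hu : MemH1 E u) :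
    MemH1 E (c • u) := by
  obtain ⟨hu, g, hg, hug⟩ := hu
  refine ⟨hu.const_smul c, c • g, hg.const_smul c, fun φ hφ => ?_⟩
  simp only [Pi.smul_apply, smul_assoc, smul_comm (φ _) c]
  rw [integral_smul, integral_smul, hug φ hφ, smul_neg]

theorem HasWeakNegLaplacian.zero (E : Set Plane) : HasWeakNegLaplacian E 0 0 :=
  fun φ _ => by simp

theorem HasWeakNegLaplacian.add {E : Set Plane} {u v f g : Plane → ℝ}
    (hu : MemLp u 2 (volume.restrict E)) (hv : MemLp v 2 (volume.restrict E))
    (hf : MemLp f 2 (volume.restrict E)) (hg : MemLp g 2 (volume.restrict E))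
    (h : HasWeakNegLaplacian E u f) (h' : HasWeakNegLaplacian E v g) :
    HasWeakNegLaplacian E (u + v) (f + g) := by
  intro φ hφ
  have e1 : Integrable (fun x => u x * Laplacian.laplacian φ x) (volume.restrict E) :=
    hu.integrable_mul hφ.memLp_laplacian
  have e2 : Integrable (fun x => v x * Laplacian.laplacian φ x) (volume.restrict E) :=
    hv.integrable_mul hφ.memLp_laplacian
  have e3 : Integrable (fun x => f x * φ x) (volume.restrict E) := hf.integrable_mul hφ.memLp
  have e4 : Integrable (fun x => g x * φ x) (volume.restrict E) := hg.integrable_mul hφ.memLp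
  simp only [Pi.add_apply, add_mul]
  rw [integral_add e1 e2, integral_add e3 e4, ← h φ hφ, ← h' φ hφ]
  ring

theorem HasWeakNegLaplacian.smul {E : Set Plane} {u f : Plane → ℝ} (c : ℝ)
    (h : HasWeakNegLaplacian E u f) : HasWeakNegLaplacian E (c • u) (c • f) := by
  intro φ hφ
  simp only [Pi.smul_apply, smul_eq_mul, mul_assoc]
  rw [integral_const_mul, integral_const_mul, ← h φ hφ]
  ring

/-! ### The local virtual space and its degrees of freedom -/

/-- Extension by zero to the plane of a continuous function on the closure of `E`. -/
def extendZero (E : Set Plane) : C(closure E, ℝ) →ₗ[ℝ] (Plane → ℝ) where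
  toFun v x := open scoped Classical in if hx : x ∈ closure E then v ⟨x, hx⟩ else 0
  map_add' u v := by
    ext x
    by_cases hx : x ∈ closure E <;> simp [hx]
  map_smul' c v := by
    ext x
    by_cases hx : x ∈ closure E <;> simp [hx]

/-- `u`, read along the curve `σ` with parameter interval `[a, b]`, is a polynomial of degree at
most `k` in the parameter. For an injective `σ` this says that the restriction of `u` to the curve
is `q ∘ σ⁻¹` with such a polynomial `q`; for the affine parametrization of a segment, that this
restriction is a polynomial of degree at most `k`. -/
def IsPolyAlong (k : ℕ) (σ : ℝ → Plane) (a b : ℝ) (u : Plane → ℝ) : Prop :=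
  ∃ q : Polynomial ℝ, q.natDegree ≤ k ∧ ∀ t ∈ Icc a b, u (σ t) = q.eval t

theorem IsPolyAlong.add {k : ℕ} {σ : ℝ → Plane} {a b : ℝ} {u v : Plane → ℝ}
    (hu : IsPolyAlong k σ a b u) (hv : IsPolyAlong k σ a b v) : IsPolyAlong k σ a b (u + v) := by
  obtain ⟨p, hp, hup⟩ := hu
  obtain ⟨q, hq, hvq⟩ := hv
  exact ⟨p + q, (Polynomial.natDegree_add_le _ _).trans (max_le hp hq), fun t ht => by
    simp [hup t ht, hvq t ht]⟩

theorem IsPolyAlong.smul {k : ℕ} {σ : ℝ → Plane} {a b : ℝ} {u : Plane → ℝ} (c : ℝ)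
    (hu : IsPolyAlong k σ a b u) : IsPolyAlong k σ a b (c • u) := by
  obtain ⟨p, hp, hup⟩ := hu
  exact ⟨c • p, (Polynomial.natDegree_smul_le _ _).trans hp, fun t ht => by simp [hup t ht]⟩

theorem IsPolyAlong.zero (k : ℕ) (σ : ℝ → Plane) (a b : ℝ) : IsPolyAlong k σ a b 0 :=
  ⟨0, by simp, fun t _ => by simp⟩

namespace CurvedElement

variable {N : ℕ} [NeZero N] {m : ℕ}

/-- The local virtual space of order `k`: the functions in `H¹(E)`, continuous up to the boundary,
whose (distributional) Laplacian is a polynomial of degree at most `k - 2`, and whose restriction to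
the boundary is a polynomial of degree at most `k` with respect to `γ` on the curved edge, and a
polynomial of degree at most `k` on each straight edge. -/
def virtualSpace (K : CurvedElement N m) (k : ℕ) : Submodule ℝ C(closure K.E, ℝ) where
  carrier := {v | MemH1 K.E (extendZero K.E v) ∧
    (∃ p ∈ polyLE ((k : ℤ) - 2), HasWeakNegLaplacian K.E (extendZero K.E v) (polyVal p)) ∧
    IsPolyAlong k K.γ K.a K.b (extendZero K.E v) ∧
    ∀ i : Fin N, i ≠ 0 →
      IsPolyAlong k (AffineMap.lineMap (K.vertex i) (K.vertex (i + 1))) 0 1 (extendZero K.E v)}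
  zero_mem' := by
    simp only [mem_ofPred_eq, map_zero]
    refine ⟨MemH1.zero _, ⟨0, Submodule.zero_mem _, ?_⟩, IsPolyAlong.zero _ _ _ _,
      fun i _ => IsPolyAlong.zero _ _ _ _⟩
    have : polyVal 0 = 0 := by ext; simp [polyVal]
    rw [this]
    exact HasWeakNegLaplacian.zero _
  add_mem' := by
    rintro u v ⟨hu, ⟨p, hp, hup⟩, huc, hus⟩ ⟨hv, ⟨q, hq, hvq⟩, hvc, hvs⟩
    simp only [mem_ofPred_eq, map_add]
    refine ⟨hu.add hv, ⟨p + q, Submodule.add_mem _ hp hq, ?_⟩, huc.add hvc,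
      fun i hi => (hus i hi).add (hvs i hi)⟩
    have : polyVal (p + q) = polyVal p + polyVal q := by ext; simp [polyVal]
    rw [this]
    exact HasWeakNegLaplacian.add hu.1 hv.1 (memLp_polyVal K.isBounded p)
      (memLp_polyVal K.isBounded q) hup hvq
  smul_mem' := by
    rintro c u ⟨hu, ⟨p, hp, hup⟩, huc, hus⟩
    simp only [mem_ofPred_eq, map_smul]
    refine ⟨hu.smul c, ⟨c • p, Submodule.smul_mem _ c hp, ?_⟩, huc.smul c,
      fun i hi => (hus i hi).smul c⟩
    have : polyVal (c • p) = c • polyVal p := by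
      ext; simp [polyVal, MvPolynomial.smul_eval]
    rw [this]
    exact hup.smul c

/-- The index set of the degrees of freedom: the vertices; the internal Gauss-Lobatto nodes of the
straight edges; the internal Gauss-Lobatto nodes of the curved edge; the interior moments. -/
abbrev DofIndex (N : ℕ) [NeZero N] (k : ℕ) : Type :=
  Fin N ⊕ ({i : Fin N // i ≠ 0} × lobattoInternal k) ⊕ lobattoInternal k ⊕ Fin (k * (k - 1) / 2)

/-- The degrees of freedom of `v`, with the interior moments taken against the family `μ`. -/
def dofs (K : CurvedElement N m) (k : ℕ)
    (μ : Fin (k * (k - 1) / 2) → MvPolynomial (Fin 2) ℝ) :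
    K.virtualSpace k →ₗ[ℝ] (DofIndex N k → ℝ) where
  toFun v
    | .inl i => extendZero K.E v (K.vertex i)
    | .inr (.inl (i, t)) =>
        extendZero K.E v (AffineMap.lineMap (K.vertex i) (K.vertex (i + 1)) (t : ℝ))
    | .inr (.inr (.inl t)) => extendZero K.E v (K.γ (onInterval K.a K.b t))
    | .inr (.inr (.inr j)) =>
        (volume.real K.E)⁻¹ * ∫ x in K.E, extendZero K.E v x * polyVal (μ j) x
  map_add' u v := by
    funext d
    rcases d with i | ⟨i, t⟩ | t | j
    · simp
    · simp
    · simp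
    · have e1 : Integrable (fun x => extendZero K.E u x * polyVal (μ j) x)
          (volume.restrict K.E) := u.2.1.1.integrable_mul (memLp_polyVal K.isBounded _)
      have e2 : Integrable (fun x => extendZero K.E v x * polyVal (μ j) x)
          (volume.restrict K.E) := v.2.1.1.integrable_mul (memLp_polyVal K.isBounded _)
      simp only [Submodule.coe_add, map_add, Pi.add_apply, add_mul]
      rw [integral_add e1 e2, mul_add]
  map_smul' c v := by
    funext d
    rcases d with i | ⟨i, t⟩ | t | j
    · simp
    · simp
    · simp
    · simp only [Submodule.coe_smul, map_smul, Pi.smul_apply, smul_eq_mul, mul_assoc,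
        RingHom.id_apply]
      rw [integral_const_mul]
      ring

end CurvedElement

end

noncomputable section

/-! ### Gauss-Lobatto nodes -/

/-! Unisolvence splits into a statement about polynomials on the edges and one about the Poisson
equation.

On an edge, a function of the space is a polynomial of degree at most `k` in the parameter, and the
`k + 1` Gauss–Lobatto nodes determine it. That there are exactly `k - 1` internal nodes
(`roots_lobatto`) follows from Rodrigues' formula by counting zeros with Rolle's theorem.

Injectivity: if all degrees of freedom vanish, then `v` vanishes on the boundary, and `p = -Δv` is
orthogonal to `v` because `p` lies in the span of the polynomials used for the moments. Formally `∫
|∇v|² = ∫ p v = 0`. Weyl's lemma (`weyl`) makes `v` smooth inside, and the integration by parts is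
done on truncations of `v`, which have compact support in `E` (`truncation`,
`eq_zero_of_laplacian_orthogonal`). Boundary values are thus used pointwise, with no trace theorem
and no normal derivative.

Surjectivity: one function carries the boundary data and is harmonic; for each basis polynomial `μ
j` another vanishes on the boundary and has `-Δ w = μ j`. The moments of the latter functions form a
square matrix, which is injective by the uniqueness just proved, hence invertible.

The analytic burden is therefore existence: the Poisson problem with polynomial right-hand side and
edgewise polynomial boundary data must have a solution that is continuous up to the boundary and
lies in `H¹(E)`. A polynomial is the Laplacian of a smooth function, so harmonic functions suffice.
The boundary data are globally Lipschitz: the regular injective `γ` has a Lipschitz inverse, and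
star-shapedness makes the radial projection onto the boundary Lipschitz, which glues the edges
(`exists_boundary_function`, `exists_lipschitz_of_closed_cover`). The Dirichlet problem is solved by
a countable Perron iteration (`exists_perron`) with barriers `Re √w`, available because
star-shapedness with respect to a ball gives a uniform exterior cone (`inner_sub_le_of_starConvex`,
`exists_harmonic_of_lipschitz`). Finite energy comes from testing with truncations of `u - G`, where
`G` is a Lipschitz extension of the data (`memLp_gradient_of_lipschitz`). -/

open Polynomial in
/-- The roots of a real polynomial in the open unit interval. -/
def unitRoots (p : Polynomial ℝ) : Finset ℝ := p.roots.toFinset.filter fun t => 0 < t ∧ t < 1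

theorem mem_unitRoots {p : Polynomial ℝ} (hp : p ≠ 0) {t : ℝ} :
    t ∈ unitRoots p ↔ p.eval t = 0 ∧ 0 < t ∧ t < 1 := by
  simp [unitRoots, hp]

/-- Rolle's theorem, counting roots. -/
theorem card_le_card_unitRoots_derivative {p : Polynomial ℝ} (hp' : Polynomial.derivative p ≠ 0)
    (s : Finset ℝ) (hs : ∀ t ∈ s, p.eval t = 0 ∧ 0 ≤ t ∧ t ≤ 1) :
    s.card ≤ (unitRoots (Polynomial.derivative p)).card + 1 := by
  refine Finset.card_le_of_interleaved fun x hx y hy hxy _ => ?_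
  obtain ⟨z, hz, hz'⟩ := exists_deriv_eq_zero (f := fun t => p.eval t) hxy
    p.continuous.continuousOn ((hs x hx).1.trans (hs y hy).1.symm)
  refine ⟨z, (mem_unitRoots hp').2 ⟨?_, (hs x hx).2.1.trans_lt hz.1, hz.2.trans_le (hs y hy).2.2⟩,
    hz.1, hz.2⟩
  rwa [Polynomial.deriv] at hz'

/-- The two endpoints count as additional zeros, so Rolle's theorem gains one zero instead of losing
one. -/
theorem le_card_unitRoots_derivative {p : Polynomial ℝ} (hp : p ≠ 0)
    (hp' : Polynomial.derivative p ≠ 0) (h0 : p.eval 0 = 0) (h1 : p.eval 1 = 0) :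
    (unitRoots p).card + 1 ≤ (unitRoots (Polynomial.derivative p)).card := by
  have h := card_le_card_unitRoots_derivative hp' (insert 0 (insert 1 (unitRoots p))) (by
    intro t ht
    simp only [Finset.mem_insert, mem_unitRoots hp] at ht
    rcases ht with rfl | rfl | ⟨h, h', h''⟩
    · simp [h0]
    · simp [h1]
    · exact ⟨h, h'.le, h''.le⟩)
  rw [Finset.card_insert_of_notMem, Finset.card_insert_of_notMem] at h
  · omega
  · simp [mem_unitRoots hp]
  · simp [mem_unitRoots hp]

/-! ### Rodrigues' formula and the zeros of the derivative of a Legendre polynomial. -/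

section legendre

open Polynomial

/-- The polynomial whose `n`-th derivative is a multiple of the shifted Legendre polynomial. -/
def rodrigues (n : ℕ) : ℝ[X] := X ^ n * (1 - X) ^ n

theorem natDegree_rodrigues (n : ℕ) : (rodrigues n).natDegree = 2 * n := by
  have h1 : (1 - X : ℝ[X]).natDegree = 1 := by
    rw [show (1 - X : ℝ[X]) = -(X - C 1) by simp, natDegree_neg, natDegree_X_sub_C]
  have h2 : (1 - X : ℝ[X]) ≠ 0 := fun h => by simp [h] at h1
  rw [rodrigues, natDegree_mul (by simp) (pow_ne_zero _ h2), natDegree_pow, natDegree_pow, h1]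
  simp; ring

/-- The leading coefficient, in degree `2 * n`, is only multiplied by a nonzero falling factorial.
-/
theorem iterate_derivative_rodrigues_ne_zero {n j : ℕ} (hj : j ≤ 2 * n) :
    derivative^[j] (rodrigues n) ≠ 0 := by
  intro h
  have h0 : rodrigues n ≠ 0 := by
    have : (1 - X : ℝ[X]) ≠ 0 := fun h => by simpa using congrArg (eval 0) h
    exact mul_ne_zero (by simp) (pow_ne_zero _ this)
  have hc := coeff_iterate_derivative (p := rodrigues n) (k := j) (2 * n - j)
  rw [h, coeff_zero, Nat.sub_add_cancel hj, ← natDegree_rodrigues n, coeff_natDegree] at hc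
  have := (leadingCoeff_ne_zero.2 h0)
  have h3 : ((rodrigues n).natDegree).descFactorial j ≠ 0 := by
    rw [natDegree_rodrigues]; exact (Nat.descFactorial_eq_zero_iff_lt.not).2 (by omega)
  simp [this, h3] at hc

/-- Both endpoints are zeros of order `n`, and each derivative lowers the order by one. -/
theorem eval_iterate_derivative_rodrigues {n j : ℕ} (hj : j < n) :
    (derivative^[j] (rodrigues n)).eval 0 = 0 ∧ (derivative^[j] (rodrigues n)).eval 1 = 0 := by
  have h0 : rodrigues n ≠ 0 := iterate_derivative_rodrigues_ne_zero (j := 0) (by omega)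
  constructor
  · refine isRoot_iterate_derivative_of_lt_rootMultiplicity (hj.trans_le ?_)
    rw [le_rootMultiplicity_iff h0]
    simp [rodrigues]
  · refine isRoot_iterate_derivative_of_lt_rootMultiplicity (hj.trans_le ?_)
    rw [le_rootMultiplicity_iff h0, rodrigues, show (1 - X : ℝ[X]) = -(X - C 1) by simp, neg_pow]
    exact ⟨X ^ n * (-1) ^ n, by ring⟩

/-- As long as fewer than `n` derivatives have been taken, the endpoints are still zeros, so each
further derivative produces one more interior zero. -/
theorem le_card_unitRoots_iterate_derivative {n j : ℕ} (hj : j ≤ n) :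
    j ≤ (unitRoots (derivative^[j] (rodrigues n))).card := by
  induction j with
  | zero => simp
  | succ j ih =>
    have h := eval_iterate_derivative_rodrigues (n := n) (j := j) (by omega)
    have := le_card_unitRoots_derivative
      (iterate_derivative_rodrigues_ne_zero (n := n) (j := j) (by omega))
      (by rw [← Function.iterate_succ_apply' derivative]
          exact iterate_derivative_rodrigues_ne_zero (by omega)) h.1 h.2
    rw [Function.iterate_succ_apply']
    have := ih (by omega)
    omega

theorem map_derivative_shiftedLegendre (n : ℕ) :
    C ((n.factorial : ℕ) : ℝ) * (derivative (shiftedLegendre n)).map (Int.castRingHom ℝ) =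
      derivative^[n + 1] (rodrigues n) := by
  have h := congrArg (fun p => (derivative p).map (Int.castRingHom ℝ))
    (factorial_mul_shiftedLegendre_eq n)
  have h' : derivative ((n.factorial : ℤ[X]) * shiftedLegendre n) =
      (n.factorial : ℤ[X]) * derivative (shiftedLegendre n) := by simp
  simp only [h'] at h
  rw [Polynomial.map_mul, ← Function.iterate_succ_apply' derivative, ← iterate_derivative_map] at h
  simpa [rodrigues] using h

/-- The `k`-th derivative in Rodrigues' formula has `k` zeros inside the interval. Its endpoint
values are not used for the last derivative, so one zero is lost and `k - 1` remain; the degree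
allows no more. -/
theorem roots_lobatto (k : ℕ) (hk : 1 ≤ k) :
    (lobattoInternal k).card = k - 1 ∧ ∀ t ∈ lobattoInternal k, 0 < t ∧ t < 1 := by
  set p : ℝ[X] := (derivative (shiftedLegendre k)).map (Int.castRingHom ℝ) with hp
  have hr : p.roots = (derivative^[k + 1] (rodrigues k)).roots := by
    rw [← map_derivative_shiftedLegendre, roots_C_mul _ (by positivity)]
  have hne := iterate_derivative_rodrigues_ne_zero (n := k) (j := k + 1) (by omega)
  have hsub : unitRoots (derivative^[k + 1] (rodrigues k)) ⊆ lobattoInternal k := by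
    unfold unitRoots lobattoInternal
    rw [← hp, hr]; exact Finset.filter_subset _ _
  have hlow : k - 1 ≤ (unitRoots (derivative^[k + 1] (rodrigues k))).card := by
    have h1 := le_card_unitRoots_iterate_derivative (le_refl k)
    have h2 := card_le_card_unitRoots_derivative (p := derivative^[k] (rodrigues k))
      (by rwa [← Function.iterate_succ_apply' derivative])
      (unitRoots (derivative^[k] (rodrigues k)))
      (fun t ht => by
        have := (mem_unitRoots (iterate_derivative_rodrigues_ne_zero (by omega))).1 ht
        exact ⟨this.1, this.2.1.le, this.2.2.le⟩)
    rw [← Function.iterate_succ_apply' derivative, Nat.succ_eq_add_one] at h2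
    omega
  have hup : (lobattoInternal k).card ≤ k - 1 := by
    calc (lobattoInternal k).card ≤ Multiset.card p.roots := Multiset.toFinset_card_le _
      _ ≤ p.natDegree := card_roots' _
      _ ≤ (derivative (shiftedLegendre k)).natDegree := natDegree_map_le
      _ ≤ (shiftedLegendre k).natDegree - 1 := natDegree_derivative_le _
      _ = k - 1 := by simp
  -- The lower bound inside the open interval meets the upper bound on all real zeros, so there are
  -- no zeros elsewhere.
  have heq := Finset.eq_of_subset_of_card_le hsub (hup.trans hlow)
  refine ⟨le_antisymm hup (heq ▸ hlow), fun t ht => ?_⟩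
  rw [← heq] at ht
  exact ((mem_unitRoots hne).1 ht).2

end legendre

/-- All the nodes of the Gauss-Lobatto rule on the unit interval. -/
def lobattoNodes (k : ℕ) : Finset ℝ := insert 0 (insert 1 (lobattoInternal k))

theorem card_lobattoNodes {k : ℕ} (hk : 1 ≤ k) : (lobattoNodes k).card = k + 1 := by
  obtain ⟨h1, h2⟩ := roots_lobatto k hk
  rw [lobattoNodes, Finset.card_insert_of_notMem, Finset.card_insert_of_notMem, h1]
  · omega
  · exact fun h => (h2 _ h).2.false
  · simp only [Finset.mem_insert, zero_ne_one, false_or]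
    exact fun h => (h2 _ h).1.false

/-- Interpolation at the Gauss-Lobatto nodes. -/
theorem exists_poly_eval_lobattoNodes {k : ℕ} (hk : 1 ≤ k) (r : ℝ → ℝ) :
    ∃ q : Polynomial ℝ, q.natDegree ≤ k ∧ ∀ t ∈ lobattoNodes k, q.eval t = r t := by
  refine ⟨Lagrange.interpolate (lobattoNodes k) id r, ?_, fun t ht => ?_⟩
  · have := Lagrange.degree_interpolate_le (s := lobattoNodes k) r (v := id)
      (Function.injective_id.injOn)
    rw [card_lobattoNodes hk] at this
    exact Polynomial.natDegree_le_of_degree_le (by simpa using this)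
  · exact Lagrange.eval_interpolate_at_node r (v := id) Function.injective_id.injOn ht

theorem poly_eq_zero_of_lobattoNodes {k : ℕ} (hk : 1 ≤ k) {q : Polynomial ℝ}
    (hq : q.natDegree ≤ k) (h : ∀ t ∈ lobattoNodes k, q.eval t = 0) : q = 0 := by
  refine Polynomial.eq_zero_of_natDegree_lt_card_of_eval_eq_zero' q (lobattoNodes k) h ?_
  rw [card_lobattoNodes hk]; omega

/-! ### Poisson integrals -/

section PoissonIntegral

open Metric Filter Topology InnerProductSpace

/-- The Poisson integral over the circle with center `c` and radius `R`. -/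
def poissonIntegral (v : ℂ → ℝ) (c : ℂ) (R : ℝ) (w : ℂ) : ℝ :=
  Real.circleAverage (poissonKernel c w • v) c R

theorem continuousOn_poissonKernel {c w : ℂ} {R : ℝ} (hw : w ∈ ball c R) :
    ContinuousOn (poissonKernel c w) (sphere c |R|) := by
  rw [poissonKernel_eq_re_herglotzRieszKernel]
  exact Complex.continuous_re.comp_continuousOn (continuousOn_herglotzRieszKernel_sphere hw)

theorem poissonKernel_nonneg {c w z : ℂ} {R : ℝ} (hw : w ∈ ball c R) (hz : z ∈ sphere c |R|) :
    0 ≤ poissonKernel c w z := by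
  have hR := pos_of_mem_ball hw
  rw [mem_sphere_iff_norm, abs_of_pos hR] at hz
  rw [mem_ball_iff_norm] at hw
  rw [poissonKernel_def, hz]
  exact div_nonneg (by nlinarith [norm_nonneg (w - c)]) (by positivity)

theorem circleIntegrable_poissonKernel_smul {v : ℂ → ℝ} {c w : ℂ} {R : ℝ} (hw : w ∈ ball c R)
    (hv : CircleIntegrable v c R) : CircleIntegrable (poissonKernel c w • v) c R :=
  hv.continuousOn_smul (continuousOn_poissonKernel hw)

theorem poissonIntegral_eq_of_harmonic {v : ℂ → ℝ} {c w : ℂ} {R : ℝ}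
    (hv : HarmonicContOnCl v (ball c R)) (hw : w ∈ ball c R) : poissonIntegral v c R w = v w :=
  hv.circleAverage_poissonKernel_smul hw

theorem circleAverage_poissonKernel {c w : ℂ} {R : ℝ} (hw : w ∈ ball c R) :
    Real.circleAverage (poissonKernel c w) c R = 1 := by
  have := poissonIntegral_eq_of_harmonic (v := fun _ => (1 : ℝ)) harmonicContOnCl_const hw
  rw [poissonIntegral] at this
  convert this using 2
  ext z; simp

/-- The Poisson kernel is the real part of the Herglotz–Riesz kernel, so the integral is the real
part of an analytic function of `w`. The data are first translated to a circle centered at the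
origin. Only integrability of `v` is needed, which matters for the limits of iterations below. -/
theorem poissonIntegral_harmonic {v : ℂ → ℝ} {c : ℂ} {R : ℝ} (hv : CircleIntegrable v c R) :
    HarmonicOnNhd (poissonIntegral v c R) (ball c R) := by
  intro w hw
  set g : ℂ → ℝ := fun z => v (z + c)
  have hg : CircleIntegrable g 0 R := by
    unfold CircleIntegrable at hv ⊢
    convert hv using 2 with θ
    simp [g, circleMap, add_comm]
  have hgc : CircleIntegrable (fun ζ ↦ (g ζ : ℂ)) 0 R := by
    simp only [CircleIntegrable, intervalIntegrable_iff] at hg ⊢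
    exact Complex.ofRealCLM.integrable_comp hg
  have hA := analyticOnNhd_circleAverage_herglotzRieszKernel_smul hgc
  have hw0 : w - c ∈ ball (0 : ℂ) R := by simpa [dist_eq_norm] using hw
  have h1 : AnalyticAt ℂ (fun w ↦ Real.circleAverage
      (fun ζ ↦ herglotzRieszKernel 0 (w - c) ζ • (g ζ : ℂ)) 0 R) w :=
    (hA (w - c) hw0).comp_of_eq (f := fun w => w - c) (by fun_prop) rfl
  refine (harmonicAt_congr_nhds ?_).1 h1.harmonicAt_re
  filter_upwards [isOpen_ball.mem_nhds hw] with x hx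
  have hx0 : x - c ∈ ball (0 : ℂ) R := by simpa [dist_eq_norm] using hx
  rw [re_circleAverage_herglotzRieszKernel_smul hg hx0, poissonIntegral,
    ← Real.circleAverage_map_add_const (c := c)]
  congr 1
  ext z
  simp only [Pi.smul_apply', Function.comp_apply, poissonKernel_eq_re_herglotzRieszKernel,
    herglotzRieszKernel_add_const]
  rfl

theorem poissonIntegral_sub_const {v : ℂ → ℝ} {c w : ℂ} {R : ℝ} (hw : w ∈ ball c R)
    (hv : CircleIntegrable v c R) (a : ℝ) :
    poissonIntegral v c R w - a = poissonIntegral (fun z => v z - a) c R w := by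
  have h1 := circleIntegrable_poissonKernel_smul hw hv
  have h2 := circleIntegrable_poissonKernel_smul hw (circleIntegrable_const a c R)
  have h3 : poissonIntegral (fun _ => a) c R w = a :=
    poissonIntegral_eq_of_harmonic harmonicContOnCl_const hw
  conv_lhs => rw [← h3]
  rw [poissonIntegral, poissonIntegral, ← Real.circleAverage_sub h1 h2, poissonIntegral]
  congr 1
  ext z
  simp [mul_sub]

/-- Approximate identity argument: the kernel is nonnegative with average one, and it tends to zero
uniformly away from `z₀` as `w` approaches `z₀`. -/
theorem poissonIntegral_near_boundary {v : ℂ → ℝ} {c z₀ : ℂ} {R : ℝ} (hv : Continuous v)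
    (hz₀ : z₀ ∈ sphere c R) {ε : ℝ} (hε : 0 < ε) :
    ∃ δ > 0, ∀ w ∈ ball c R, dist w z₀ < δ → |poissonIntegral v c R w - v z₀| ≤ ε := by
  obtain ⟨M, hM⟩ := (isCompact_sphere c R).exists_bound_of_continuousOn hv.continuousOn
  have hM0 : 0 ≤ M := (norm_nonneg _).trans (hM z₀ hz₀)
  obtain ⟨ρ, hρ, hvρ⟩ := Metric.continuous_iff.1 hv z₀ (ε / 2) (by positivity)
  have hR0 : 0 ≤ R := by rw [mem_sphere_iff_norm] at hz₀; rw [← hz₀]; positivity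
  -- The first bound keeps `w` at distance at least `ρ / 2` from the far part of the circle. The
  -- second makes the far contribution `κ`, which is at most `16 * M * R * dist w z₀ / ρ ^ 2`, no
  -- larger than `ε / 2`; the summand `1` covers the case `M = 0`.
  refine ⟨min (ρ / 2) (ε * ρ ^ 2 / (32 * M * R + 1)), by positivity, fun w hw hwz => ?_⟩
  have hR := pos_of_mem_ball hw
  have hci : CircleIntegrable v c R := hv.continuousOn.circleIntegrable hR0
  have hci' : CircleIntegrable (fun z => v z - v z₀) c R :=
    (hv.sub continuous_const).continuousOn.circleIntegrable hR0
  rw [poissonIntegral_sub_const hw hci, poissonIntegral]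
  set κ : ℝ := 2 * M * ((R ^ 2 - ‖w - c‖ ^ 2) * 4 / ρ ^ 2) with hκ
  have hK : CircleIntegrable (poissonKernel c w) c R :=
    (continuousOn_poissonKernel hw).circleIntegrable'
  have hb : CircleIntegrable (fun z => (ε / 2) • poissonKernel c w z + κ) c R :=
    (hK.const_smul (a := ε / 2)).add (circleIntegrable_const κ c R)
  have hw' := mem_ball_iff_norm.1 hw
  have hpt : ∀ z ∈ sphere c |R|, |(poissonKernel c w • fun z => v z - v z₀) z| ≤
      (ε / 2) • poissonKernel c w z + κ := by
    intro z hz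
    have hP := poissonKernel_nonneg hw hz
    rw [abs_of_pos hR] at hz
    rw [Pi.smul_apply', smul_eq_mul, smul_eq_mul, abs_mul, abs_of_nonneg hP]
    have hκ0 : 0 ≤ κ := by
      have : 0 ≤ R ^ 2 - ‖w - c‖ ^ 2 := by nlinarith [norm_nonneg (w - c)]
      positivity
    rcases lt_or_ge (dist z z₀) ρ with h | h
    · have h1 := (hvρ z h).le
      rw [Real.dist_eq] at h1
      nlinarith
    · have h1 : |v z - v z₀| ≤ 2 * M := by
        have := abs_sub (v z) (v z₀)
        have := hM z hz
        have := hM z₀ hz₀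
        simp only [Real.norm_eq_abs] at *
        linarith
      have h2 : poissonKernel c w z ≤ (R ^ 2 - ‖w - c‖ ^ 2) * 4 / ρ ^ 2 := by
        rw [poissonKernel_def, mem_sphere_iff_norm.1 hz, sub_sub_sub_cancel_right]
        have h3 : ρ / 2 ≤ ‖z - w‖ := by
          rw [← dist_eq_norm]
          have := dist_triangle z w z₀
          have := hwz.trans_le (min_le_left _ _)
          linarith
        have h4 : ρ ^ 2 / 4 ≤ ‖z - w‖ ^ 2 := by nlinarith
        rw [div_le_div_iff₀ (by nlinarith [sq_nonneg ρ, sq_pos_of_pos hρ]) (by positivity)]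
        have : 0 ≤ R ^ 2 - ‖w - c‖ ^ 2 := by nlinarith [norm_nonneg (w - c)]
        nlinarith
      calc poissonKernel c w z * |v z - v z₀| ≤ (R ^ 2 - ‖w - c‖ ^ 2) * 4 / ρ ^ 2 * (2 * M) := by
            gcongr
            exact hP.trans h2
        _ = κ := by rw [hκ]; ring
        _ ≤ _ := by
          have : 0 ≤ ε / 2 * poissonKernel c w z := by positivity
          linarith
  have hav : Real.circleAverage (fun z => (ε / 2) • poissonKernel c w z + κ) c R = ε / 2 + κ := by
    refine (Real.circleAverage_fun_add (hK.const_smul (a := ε / 2))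
      (circleIntegrable_const κ c R)).trans ?_
    rw [Real.circleAverage_smul, circleAverage_poissonKernel hw, Real.circleAverage_const]
    simp
  have hfi := circleIntegrable_poissonKernel_smul hw hci'
  have h5 : |Real.circleAverage (poissonKernel c w • fun z => v z - v z₀) c R| ≤ ε / 2 + κ := by
    refine Real.abs_circleAverage_le_circleAverage_abs.trans ?_
    rw [← hav]
    exact Real.circleAverage_mono hfi.abs hb hpt
  refine h5.trans ?_
  have h6 : κ ≤ ε / 2 := by
    have h7 : R - ‖w - c‖ ≤ dist w z₀ := by
      rw [mem_sphere_iff_norm] at hz₀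
      rw [dist_eq_norm, norm_sub_rev w z₀, ← hz₀]
      have := norm_sub_norm_le (z₀ - c) (w - c)
      rwa [sub_sub_sub_cancel_right] at this
    have h8 := hwz.trans_le (min_le_right _ _)
    have h9 : R ^ 2 - ‖w - c‖ ^ 2 ≤ 2 * R * dist w z₀ := by nlinarith [norm_nonneg (w - c)]
    have h10 : dist w z₀ * (32 * M * R + 1) ≤ ε * ρ ^ 2 := by
      rw [lt_div_iff₀ (by positivity)] at h8
      exact h8.le
    rw [hκ, mul_div_assoc', div_le_iff₀ (by positivity)]
    have h11 : 0 ≤ dist w z₀ := dist_nonneg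
    nlinarith [mul_le_mul_of_nonneg_left h9 hM0]
  linarith

open scoped Classical in
/-- Replace a function inside a disc by its Poisson integral. -/
def poissonLift (v : ℂ → ℝ) (c : ℂ) (R : ℝ) (w : ℂ) : ℝ :=
  if w ∈ ball c R then poissonIntegral v c R w else v w

theorem poissonLift_of_mem {v : ℂ → ℝ} {c w : ℂ} {R : ℝ} (hw : w ∈ ball c R) :
    poissonLift v c R w = poissonIntegral v c R w := if_pos hw

theorem poissonLift_of_notMem {v : ℂ → ℝ} {c w : ℂ} {R : ℝ} (hw : w ∉ ball c R) :
    poissonLift v c R w = v w := if_neg hw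

theorem poissonLift_harmonic {v : ℂ → ℝ} (hv : Continuous v) (c : ℂ) {R : ℝ} (hR : 0 ≤ R) :
    HarmonicOnNhd (poissonLift v c R) (ball c R) := by
  intro w hw
  refine (harmonicAt_congr_nhds ?_).1
    (poissonIntegral_harmonic (hv.continuousOn.circleIntegrable hR) w hw)
  filter_upwards [isOpen_ball.mem_nhds hw] with x hx using (poissonLift_of_mem hx).symm

theorem continuous_poissonLift {v : ℂ → ℝ} (hv : Continuous v) (c : ℂ) {R : ℝ} (hR : 0 < R) :
    Continuous (poissonLift v c R) := by
  rw [continuous_iff_continuousAt]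
  intro w
  rcases lt_trichotomy (dist w c) R with h | h | h
  · exact (poissonLift_harmonic hv c hR.le w h).1.continuousAt
  · have hw : w ∉ ball c R := by simp [h]
    rw [Metric.continuousAt_iff]
    intro ε hε
    obtain ⟨δ, hδ, h1⟩ := poissonIntegral_near_boundary hv (z₀ := w) h (half_pos hε)
    obtain ⟨ρ, hρ, h2⟩ := Metric.continuous_iff.1 hv w ε hε
    refine ⟨min δ ρ, lt_min hδ hρ, fun x hx => ?_⟩
    rw [poissonLift_of_notMem hw]
    by_cases hxb : x ∈ ball c R
    · rw [poissonLift_of_mem hxb, Real.dist_eq]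
      exact (h1 x hxb (hx.trans_le (min_le_left _ _))).trans_lt (half_lt_self hε)
    · rw [poissonLift_of_notMem hxb]
      exact h2 x (hx.trans_le (min_le_right _ _))
  · refine hv.continuousAt.congr ?_
    have : (closedBall c R)ᶜ ∈ 𝓝 w := isClosed_closedBall.isOpen_compl.mem_nhds (by simpa using h)
    filter_upwards [this] with x hx
    exact (poissonLift_of_notMem fun hxb => hx (ball_subset_closedBall hxb)).symm

end PoissonIntegral

/-! ### The Perron method -/

section Perron

open Metric Filter Topology InnerProductSpace

/-- The local sub-mean value property. -/
def SubMean (v : ℂ → ℝ) (U : Set ℂ) : Prop :=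
  ∀ x ∈ U, ∀ᶠ r in 𝓝[>] (0 : ℝ), v x ≤ Real.circleAverage v x r

/-- On the circle, `‖x‖ ^ 2` agrees with the real part of the affine function `F`, which is harmonic
and so averages to its value at the center. -/
theorem circleAverage_normSq (y : ℂ) (r : ℝ) :
    Real.circleAverage (fun x : ℂ => ‖x‖ ^ 2) y r = ‖y‖ ^ 2 + r ^ 2 := by
  obtain ⟨A, hA⟩ : ∃ A : ℝ, A = ‖y‖ ^ 2 + r ^ 2 := ⟨_, rfl⟩
  set F : ℂ → ℂ := fun x => (A : ℂ) + 2 * (starRingEnd ℂ) y * (x - y) with hF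
  have hh : HarmonicOnNhd (fun x => (F x).re) (closedBall y |r|) := fun x _ =>
    AnalyticAt.harmonicAt_re (by fun_prop)
  have h1 := hh.circleAverage_eq
  have h2 : (F y).re = A := by simp only [hF, sub_self, mul_zero, add_zero, Complex.ofReal_re]
  rw [← hA, ← h2, ← h1]
  refine Real.circleAverage_congr_sphere fun x hx => ?_
  have hx' : ‖x - y‖ ^ 2 = r ^ 2 := by
    rw [mem_sphere_iff_norm.1 hx, sq_abs]
  rw [← Complex.normSq_eq_norm_sq, Complex.normSq_apply] at hx'
  rw [← Complex.normSq_eq_norm_sq, Complex.normSq_apply] at hA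
  simp only [hF, ← Complex.normSq_eq_norm_sq, Complex.normSq_apply]
  simp at hx' ⊢
  nlinarith

theorem eventually_sphere_subset {U : Set ℂ} (hU : IsOpen U) {x : ℂ} (hx : x ∈ U) :
    ∀ᶠ r in 𝓝[>] (0 : ℝ), 0 < r ∧ closedBall x r ⊆ U := by
  obtain ⟨ε, hε, h⟩ := Metric.nhds_basis_closedBall.mem_iff.1 (hU.mem_nhds hx)
  filter_upwards [Ioc_mem_nhdsGT hε] with r hr
  exact ⟨hr.1, (closedBall_subset_closedBall hr.2).trans h⟩

/-- The maximum principle. -/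
theorem SubMean.le_zero {v : ℂ → ℝ} {U : Set ℂ} (hU : IsOpen U) (hb : Bornology.IsBounded U)
    (hv : ContinuousOn v (closure U)) (hs : SubMean v U) (h0 : ∀ x ∈ frontier U, v x ≤ 0) :
    ∀ x ∈ U, v x ≤ 0 := by
  intro x₀ hx₀
  by_contra! hpos
  obtain ⟨D, hD⟩ := hb.isCompact_closure.isBounded.exists_norm_le
  -- Adding `ε * ‖x‖ ^ 2` makes the mean value inequality strict, with gain `ε * r ^ 2`; this `ε` is
  -- small enough that a positive maximum of the sum cannot move to the boundary.
  set ε : ℝ := v x₀ / (2 * (D ^ 2 + 1)) with hε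
  have hε0 : 0 < ε := by positivity
  obtain ⟨y, hy, hmax⟩ := hb.isCompact_closure.exists_isMaxOn ⟨x₀, subset_closure hx₀⟩
    (f := fun x => v x + ε * ‖x‖ ^ 2) (hv.add (by fun_prop))
  have hge : v x₀ ≤ v y + ε * ‖y‖ ^ 2 := by
    refine le_trans ?_ (hmax (subset_closure hx₀))
    have : 0 ≤ ε * ‖x₀‖ ^ 2 := by positivity
    linarith
  have hyU : y ∈ U := by
    by_contra hyU
    have h1 := h0 y (by rw [hU.frontier_eq]; exact ⟨hy, hyU⟩)
    have h2 : ε * ‖y‖ ^ 2 ≤ ε * D ^ 2 := by gcongr; exact hD y hy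
    have h3 : ε * (2 * (D ^ 2 + 1)) = v x₀ := div_mul_cancel₀ _ (by positivity)
    nlinarith
  obtain ⟨r, ⟨hr, hrU⟩, hr'⟩ := ((eventually_sphere_subset hU hyU).and (hs y hyU)).exists
  have hsph : sphere y |r| ⊆ closure U := by
    rw [abs_of_pos hr]
    exact (sphere_subset_closedBall.trans hrU).trans subset_closure
  have i1 : CircleIntegrable v y r := (hv.mono hsph).circleIntegrable'
  have i2 : CircleIntegrable (fun x : ℂ => ε • ‖x‖ ^ 2) y r :=
    (by fun_prop : Continuous fun x : ℂ => ε • ‖x‖ ^ 2).continuousOn.circleIntegrable'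
  have h1 : Real.circleAverage (v + fun x : ℂ => ε • ‖x‖ ^ 2) y r ≤ v y + ε * ‖y‖ ^ 2 :=
    Real.circleAverage_mono_on_of_le_circle (i1.add i2) fun x hx => hmax (hsph hx)
  rw [Real.circleAverage_add i1 i2, Real.circleAverage_fun_smul, circleAverage_normSq,
    smul_eq_mul] at h1
  nlinarith [mul_pos hε0 (pow_pos hr 2)]

theorem eventually_circleAverage_eq {h : ℂ → ℝ} {U : Set ℂ} (hU : IsOpen U)
    (hh : HarmonicOnNhd h U) {x : ℂ} (hx : x ∈ U) :
    ∀ᶠ r in 𝓝[>] (0 : ℝ), Real.circleAverage h x r = h x := by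
  filter_upwards [eventually_sphere_subset hU hx] with r hr
  exact InnerProductSpace.HarmonicOnNhd.circleAverage_eq
    (hh.mono (by rw [abs_of_pos hr.1]; exact hr.2))

theorem SubMean.sub_harmonic {v h : ℂ → ℝ} {U : Set ℂ} (hU : IsOpen U)
    (hv : ContinuousOn v U) (hs : SubMean v U) (hh : HarmonicOnNhd h U) :
    SubMean (fun x => v x - h x) U := by
  intro x hx
  filter_upwards [hs x hx, eventually_circleAverage_eq hU hh hx,
    eventually_sphere_subset hU hx] with r h1 h2 h3
  have hsph : sphere x |r| ⊆ U := by
    rw [abs_of_pos h3.1]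
    exact sphere_subset_closedBall.trans h3.2
  rw [Real.circleAverage_fun_sub (hv.mono hsph).circleIntegrable'
    (hh.continuousOn.mono hsph).circleIntegrable', h2]
  linarith

theorem SubMean.le_harmonic {v h : ℂ → ℝ} {U : Set ℂ} (hU : IsOpen U)
    (hb : Bornology.IsBounded U) (hv : ContinuousOn v (closure U)) (hs : SubMean v U)
    (hh : HarmonicContOnCl h U) (h0 : ∀ x ∈ frontier U, v x ≤ h x) : ∀ x ∈ U, v x ≤ h x := by
  intro x hx
  have := SubMean.le_zero hU hb (hv.sub hh.2)
    (hs.sub_harmonic hU (hv.mono subset_closure) hh.1) (fun y hy => sub_nonpos.2 (h0 y hy)) x hx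
  simpa using this

theorem SubMean.mono {v : ℂ → ℝ} {U V : Set ℂ} (h : SubMean v U) (hVU : V ⊆ U) : SubMean v V :=
  fun x hx => h x (hVU hx)

theorem SubMean.le_poissonLift {v : ℂ → ℝ} {U : Set ℂ} (hv : Continuous v) (hs : SubMean v U)
    {c : ℂ} {R : ℝ} (hR : 0 < R) (hc : closedBall c R ⊆ U) (x : ℂ) : v x ≤ poissonLift v c R x := by
  by_cases hx : x ∈ ball c R
  · refine SubMean.le_harmonic isOpen_ball isBounded_ball hv.continuousOn
      (hs.mono (ball_subset_closedBall.trans hc)) ⟨poissonLift_harmonic hv c hR.le,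
        (continuous_poissonLift hv c hR).continuousOn⟩ (fun y hy => ?_) x hx
    rw [frontier_ball c hR.ne'] at hy
    exact (poissonLift_of_notMem (by simp [mem_sphere.1 hy])).ge
  · exact (poissonLift_of_notMem hx).ge

/-- Inside the disc the lift is harmonic. At the other points its value is that of `v`, while its
circle averages can only be larger, since the lift dominates `v`. -/
theorem SubMean.poissonLift {v : ℂ → ℝ} {U : Set ℂ} (hv : Continuous v) (hs : SubMean v U)
    {c : ℂ} {R : ℝ} (hR : 0 < R) (hc : closedBall c R ⊆ U) : SubMean (poissonLift v c R) U := by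
  intro x hx
  have hl := continuous_poissonLift hv c hR
  by_cases hxb : x ∈ ball c R
  · filter_upwards [eventually_circleAverage_eq isOpen_ball
      (poissonLift_harmonic hv c hR.le) hxb] with r hr using hr.ge
  · filter_upwards [hs x hx] with r hr
    rw [poissonLift_of_notMem hxb]
    exact hr.trans (Real.circleAverage_mono hv.continuousOn.circleIntegrable'
      hl.continuousOn.circleIntegrable' fun y _ => hs.le_poissonLift hv hR hc y)

/-! ### The Perron iteration along a countable family of discs. -/

open scoped Classical in
/-- One step of the Perron iteration: a Poisson lift in the `i`-th disc of a countable family. -/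
def perronStep (U : Set ℂ) (i : ℕ) (v : ℂ → ℝ) : ℂ → ℝ :=
  if closedBall (TopologicalSpace.denseSeq ℂ i.unpair.1) (1 / (i.unpair.2 + 1)) ⊆ U then
    poissonLift v (TopologicalSpace.denseSeq ℂ i.unpair.1) (1 / (i.unpair.2 + 1)) else v

theorem perronStep_pair {U : Set ℂ} {n m : ℕ} (v : ℂ → ℝ)
    (h : closedBall (TopologicalSpace.denseSeq ℂ n) (1 / ((m : ℝ) + 1)) ⊆ U) :
    perronStep U (Nat.pair n m) v =
      poissonLift v (TopologicalSpace.denseSeq ℂ n) (1 / ((m : ℝ) + 1)) := by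
  unfold perronStep
  rw [Nat.unpair_pair]
  exact if_pos h

/-- The Perron iteration, in which every disc is visited infinitely often. -/
def perronSeq (U : Set ℂ) (s : ℂ → ℝ) : ℕ → ℂ → ℝ
  | 0 => s
  | k + 1 => perronStep U k.unpair.1 (perronSeq U s k)

variable {U : Set ℂ} {s : ℂ → ℝ}

theorem perronSeq_continuous_subMean (hs : Continuous s) (hsub : SubMean s U) (k : ℕ) :
    Continuous (perronSeq U s k) ∧ SubMean (perronSeq U s k) U := by
  induction k with
  | zero => exact ⟨hs, hsub⟩
  | succ k ih =>
    simp only [perronSeq, perronStep]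
    split_ifs with h
    · exact ⟨continuous_poissonLift ih.1 _ (by positivity),
        ih.2.poissonLift ih.1 (by positivity) h⟩
    · exact ih

theorem perronSeq_monotone (hs : Continuous s) (hsub : SubMean s U) (x : ℂ) :
    Monotone fun k => perronSeq U s k x := by
  refine monotone_nat_of_le_succ fun k => ?_
  obtain ⟨h1, h2⟩ := perronSeq_continuous_subMean hs hsub k
  simp only [perronSeq, perronStep]
  split_ifs with h
  · exact h2.le_poissonLift h1 (by positivity) h x
  · exact le_rfl

theorem perronSeq_of_notMem (k : ℕ) {x : ℂ} (hx : x ∉ U) : perronSeq U s k x = s x := by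
  induction k with
  | zero => rfl
  | succ k ih =>
    simp only [perronSeq, perronStep]
    split_ifs with h
    · rw [poissonLift_of_notMem fun hxb => hx (h (ball_subset_closedBall hxb)), ih]
    · exact ih

/-- Lifting never changes values outside `U`, so every iterate is a subsolution with the same
boundary values and the maximum principle applies to it. -/
theorem perronSeq_le_harmonic (hU : IsOpen U) (hb : Bornology.IsBounded U) (hs : Continuous s)
    (hsub : SubMean s U) {h : ℂ → ℝ} (hh : HarmonicContOnCl h U)
    (h0 : ∀ x ∈ frontier U, s x ≤ h x) (k : ℕ) : ∀ x ∈ U, perronSeq U s k x ≤ h x := by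
  obtain ⟨h1, h2⟩ := perronSeq_continuous_subMean hs hsub k
  refine h2.le_harmonic hU hb h1.continuousOn hh fun x hx => ?_
  rw [perronSeq_of_notMem k (fun hx' => by rw [hU.frontier_eq] at hx; exact hx.2 hx')]
  exact h0 x hx

/-- Dominated convergence on the circle. The limit `u` need not be continuous; as a bounded
pointwise limit of continuous functions it is integrable on the circle. -/
theorem poissonIntegral_tendsto {v : ℕ → ℂ → ℝ} {u : ℂ → ℝ} {c : ℂ} {R M : ℝ}
    (hR : 0 ≤ R) (hv : ∀ k, Continuous (v k)) (hM : ∀ k, ∀ x ∈ sphere c R, |v k x| ≤ M)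
    (hu : ∀ x ∈ sphere c R, Tendsto (fun k => v k x) atTop (𝓝 (u x))) {w : ℂ} (hw : w ∈ ball c R) :
    CircleIntegrable u c R ∧ 
    Tendsto (fun k => poissonIntegral (v k) c R w) atTop (𝓝 (poissonIntegral u c R w)) := by
  have hmem : ∀ θ, circleMap c R θ ∈ sphere c R := circleMap_mem_sphere c hR
  constructor
  · have hm : Measurable fun θ => u (circleMap c R θ) :=
      measurable_of_tendsto_metrizable (f := fun k θ => v k (circleMap c R θ))
        (fun k => ((hv k).comp (continuous_circleMap c R)).measurable)
        (tendsto_pi_nhds.2 fun θ => hu _ (hmem θ))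
    refine (intervalIntegrable_const (c := M)).mono_fun' hm.aestronglyMeasurable ?_
    filter_upwards with θ
    exact le_of_tendsto (hu _ (hmem θ)).abs (Eventually.of_forall fun k => hM k _ (hmem θ))
  · simp only [poissonIntegral, Real.circleAverage_def]
    have hPc := continuousOn_poissonKernel hw
    rw [abs_of_nonneg hR] at hPc
    obtain ⟨A, hA⟩ := (isCompact_sphere c R).exists_bound_of_continuousOn hPc
    simp only [smul_eq_mul]
    refine Tendsto.const_mul _ ?_
    refine intervalIntegral.tendsto_integral_filter_of_dominated_convergence (fun _ => A * M)
      (Eventually.of_forall fun k => ?_) (Eventually.of_forall fun k => ?_)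
      intervalIntegrable_const ?_
    · have hc : Continuous fun θ => (poissonKernel c w • v k) (circleMap c R θ) :=
        (hPc.comp_continuous (continuous_circleMap c R) hmem).smul
          ((hv k).comp (continuous_circleMap c R))
      exact hc.aestronglyMeasurable
    · filter_upwards with θ _
      rw [Pi.mul_apply, norm_mul]
      exact mul_le_mul (hA _ (hmem θ)) (hM k _ (hmem θ)) (norm_nonneg _)
        ((norm_nonneg _).trans (hA _ (hmem θ)))
    · filter_upwards with θ _
      exact (hu _ (hmem θ)).const_mul _

/-- The limit of the Perron iteration. -/
theorem exists_perron (hU : IsOpen U) (hb : Bornology.IsBounded U) (hs : Continuous s)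
    (hsub : SubMean s U) :
    ∃ u : ℂ → ℝ, HarmonicOnNhd u U ∧ (∀ x, s x ≤ u x) ∧ (∀ x, x ∉ U → u x = s x) ∧
      ∀ h : ℂ → ℝ, HarmonicContOnCl h U → (∀ x ∈ frontier U, s x ≤ h x) →
        ∀ x ∈ U, u x ≤ h x := by
  obtain ⟨M, hM⟩ := hb.isCompact_closure.exists_bound_of_continuousOn hs.continuousOn
  have hup : ∀ k, ∀ x ∈ U, perronSeq U s k x ≤ M := fun k =>
    perronSeq_le_harmonic hU hb hs hsub (h := fun _ => M) harmonicContOnCl_const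
      (fun x hx => (le_abs_self _).trans (hM x (frontier_subset_closure hx))) k
  have hlow : ∀ k x, s x ≤ perronSeq U s k x := fun k x =>
    perronSeq_monotone hs hsub x (Nat.zero_le k)
  have hbdd : ∀ x, BddAbove (range fun k => perronSeq U s k x) := by
    intro x
    by_cases hx : x ∈ U
    · exact ⟨M, by rintro _ ⟨k, rfl⟩; exact hup k x hx⟩
    · exact ⟨s x, by rintro _ ⟨k, rfl⟩; exact (perronSeq_of_notMem k hx).le⟩
  set u : ℂ → ℝ := fun x => ⨆ k, perronSeq U s k x with hu
  have hlim : ∀ x, Tendsto (fun k => perronSeq U s k x) atTop (𝓝 (u x)) := fun x =>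
    tendsto_atTop_ciSup (perronSeq_monotone hs hsub x) (hbdd x)
  refine ⟨u, fun x hx => ?_, fun x => (le_ciSup (hbdd x) 0), fun x hx => ?_, fun h hh h0 x hx => ?_⟩
  · obtain ⟨ε, hε, hεU⟩ := Metric.nhds_basis_closedBall.mem_iff.1 (hU.mem_nhds hx)
    -- A disc of the countable family that contains `x` and has its closure in `U`: radius below `ε
    -- / 2`, center from the dense sequence at distance less than the radius from `x`.
    obtain ⟨m, hm⟩ := exists_nat_one_div_lt (half_pos hε)
    set R : ℝ := 1 / ((m : ℝ) + 1) with hR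
    have hR0 : 0 < R := by positivity
    obtain ⟨n, hn⟩ := (TopologicalSpace.denseRange_denseSeq ℂ).exists_dist_lt x hR0
    set c := TopologicalSpace.denseSeq ℂ n with hc
    have hcU : closedBall c R ⊆ U := by
      refine Subset.trans (fun y hy => ?_) hεU
      rw [mem_closedBall] at hy ⊢
      have := dist_triangle y c x
      rw [dist_comm c x] at this
      linarith
    have hxb : x ∈ ball c R := hn
    have hmk : ∀ k, ∀ y ∈ sphere c R, |perronSeq U s k y| ≤ M := fun k y hy => by
      have hyU := hcU (sphere_subset_closedBall hy)
      have := hM y (subset_closure hyU)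
      rw [Real.norm_eq_abs, abs_le] at this
      exact abs_le.2 ⟨this.1.trans (hlow k y), hup k y hyU⟩
    have hintg := (poissonIntegral_tendsto hR0.le
      (fun k => (perronSeq_continuous_subMean hs hsub k).1) hmk (fun y _ => hlim y) hxb).1
    refine (harmonicAt_congr_nhds ?_).1 (poissonIntegral_harmonic hintg x hxb)
    filter_upwards [isOpen_ball.mem_nhds hxb] with w hw
    have h1 := (poissonIntegral_tendsto hR0.le
      (fun k => (perronSeq_continuous_subMean hs hsub k).1) hmk (fun y _ => hlim y) hw).2
    -- These are infinitely many times at which this disc is lifted. Just after them the iterates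
    -- are Poisson integrals of their predecessors, so the limit `u` is the Poisson integral of
    -- itself. This takes the place of Harnack's theorem.
    have hsub' : Tendsto (fun l => Nat.pair (Nat.pair n m) l) atTop atTop :=
      tendsto_atTop_mono (fun l => Nat.right_le_pair _ l) tendsto_id
    have h2 := (hlim w).comp ((tendsto_add_atTop_nat 1).comp hsub')
    have h3 := h1.comp hsub'
    refine tendsto_nhds_unique (h3.congr fun l => ?_) h2
    simp only [Function.comp_apply, perronSeq, Nat.unpair_pair]
    rw [perronStep_pair _ hcU, poissonLift_of_mem hw]
  · simp only [hu, perronSeq_of_notMem _ hx, ciSup_const]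
  · exact ciSup_le fun k => perronSeq_le_harmonic hU hb hs hsub hh h0 k x hx

/-- The Dirichlet problem on an open set with a uniform family of barriers. -/
theorem exists_dirichlet {g : ℂ → ℝ} {b : ℂ → ℂ → ℝ} {ρ : ℝ → ℝ} {C : ℝ} (hU : IsOpen U)
    (hb : Bornology.IsBounded U) (hC : 0 ≤ C) (hg : ∃ M, ∀ z ∈ frontier U, |g z| ≤ M)
    (hρ : Tendsto ρ (𝓝[≥] 0) (𝓝 0))
    (hbρ : ∀ z ∈ frontier U, ∀ x y, |b z x - b z y| ≤ ρ (dist x y))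
    (hb0 : ∀ z ∈ frontier U, b z z = 0) (hbn : ∀ z ∈ frontier U, ∀ x, 0 ≤ b z x)
    (hbh : ∀ z ∈ frontier U, HarmonicOnNhd (b z) U)
    (hgb : ∀ z ∈ frontier U, ∀ x ∈ frontier U, |g x - g z| ≤ C * b z x) :
    ∃ u : ℂ → ℝ, HarmonicContOnCl u U ∧ ∀ x ∈ frontier U, u x = g x := by
  rcases (frontier U).eq_empty_or_nonempty with he | hne
  · exact ⟨0, harmonicContOnCl_const, by simp [he]⟩
  have : Nonempty (frontier U) := hne.to_subtype
  obtain ⟨M, hM⟩ := hg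
  have hρd : ∀ x : ℂ, Tendsto (fun y => ρ (dist y x)) (𝓝 x) (𝓝 0) := fun x => by
    refine hρ.comp (tendsto_nhdsWithin_iff.2 ⟨?_, Eventually.of_forall fun y => dist_nonneg⟩)
    have : Continuous fun y => dist y x := by fun_prop
    simpa using this.tendsto x
  have hbc : ∀ z ∈ frontier U, Continuous (b z) := fun z hz => continuous_iff_continuousAt.2
    fun x => by
      rw [ContinuousAt, tendsto_iff_norm_sub_tendsto_zero]
      exact squeeze_zero (fun _ => norm_nonneg _) (fun y => hbρ z hz y x) (hρd x)
  -- A McShane-type extension of `g` with the barriers in place of the distance. As a supremum of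
  -- functions harmonic in `U` it is a subsolution, the common modulus `ρ` makes it continuous, and
  -- `hgb` makes it equal to `g` on the frontier.
  set s : ℂ → ℝ := fun x => ⨆ z : frontier U, (g z - C * b z x) with hs
  have hbdd : ∀ x, BddAbove (range fun z : frontier U => g z - C * b z x) := fun x =>
    ⟨M, by
      rintro _ ⟨z, rfl⟩
      have h1 := (le_abs_self _).trans (hM z z.2)
      have h2 := mul_nonneg hC (hbn z z.2 x)
      simp only
      linarith⟩
  have hle : ∀ x (z : frontier U), g z - C * b z x ≤ s x := fun x z => le_ciSup (hbdd x) z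
  have hsρ : ∀ x y, s x ≤ s y + C * ρ (dist x y) := fun x y => ciSup_le fun z => by
    have h1 := hle y z
    have h2 := mul_le_mul_of_nonneg_left (hbρ z z.2 x y) hC
    have h3 := mul_le_mul_of_nonneg_left (neg_abs_le (b z x - b z y)) hC
    nlinarith
  have hsc : Continuous s := continuous_iff_continuousAt.2 fun x => by
    rw [ContinuousAt, tendsto_iff_norm_sub_tendsto_zero]
    refine squeeze_zero (fun _ => norm_nonneg _) (fun y => ?_)
      (by simpa using (hρd x).const_mul C)
    rw [Real.norm_eq_abs, abs_le]
    have h1 := hsρ x y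
    rw [dist_comm] at h1
    exact ⟨by linarith, by linarith [hsρ y x]⟩
  have hsub : SubMean s U := by
    intro x hx
    filter_upwards [eventually_sphere_subset hU hx] with r hr
    refine ciSup_le fun z => ?_
    have hh : HarmonicOnNhd (fun y => g z - C * b z y) U := fun y hy =>
      (harmonicAt_const (g z)).sub ((hbh z z.2 y hy).const_smul (c := C))
    have h1 : Real.circleAverage (fun y => g z - C * b z y) x r = g z - C * b z x :=
      InnerProductSpace.HarmonicOnNhd.circleAverage_eq
        (hh.mono (by rw [abs_of_pos hr.1]; exact hr.2))
    rw [← h1]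
    have hc : Continuous fun y => g z - C * b z y :=
      continuous_const.sub (continuous_const.mul (hbc z z.2))
    exact Real.circleAverage_mono hc.continuousOn.circleIntegrable'
      hsc.continuousOn.circleIntegrable' fun y _ => hle y z
  have hsg : ∀ x ∈ frontier U, s x = g x := fun x hx => by
    refine le_antisymm (ciSup_le fun z => ?_) ?_
    · have h1 := (abs_le.1 (hgb z z.2 x hx)).1
      linarith
    · have := hle x ⟨x, hx⟩
      simpa [hb0 x hx] using this
  obtain ⟨u, huh, hus, huU, huh'⟩ := exists_perron hU hb hsc hsub
  have hug : ∀ x ∈ frontier U, u x = g x := fun x hx => by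
    rw [huU x (by rw [hU.frontier_eq] at hx; exact hx.2), hsg x hx]
  refine ⟨u, ⟨huh, fun x hx => ?_⟩, hug⟩
  by_cases hxU : x ∈ U
  · exact (huh x hxU).1.continuousAt.continuousWithinAt
  have hxf : x ∈ frontier U := by rw [hU.frontier_eq]; exact ⟨hx, hxU⟩
  -- The barrier at `x` bounds `u` from above and `s` bounds it from below; both bounds tend to `g
  -- x` at `x`.
  have hupb : ∀ y ∈ closure U, u y ≤ g x + C * b x y := by
    intro y hy
    by_cases hyU : y ∈ U
    · refine huh' (fun y => g x + C * b x y) ⟨fun w hw =>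
        (harmonicAt_const (g x)).add ((hbh x hxf w hw).const_smul (c := C)),
        (continuous_const.add (continuous_const.mul (hbc x hxf))).continuousOn⟩ (fun w hw => ?_)
        y hyU
      rw [hsg w hw]
      linarith [(abs_le.1 (hgb x hxf w hw)).2]
    · have hyf : y ∈ frontier U := by rw [hU.frontier_eq]; exact ⟨hy, hyU⟩
      rw [hug y hyf]
      linarith [(abs_le.1 (hgb x hxf y hyf)).2]
  rw [ContinuousWithinAt, hug x hxf]
  refine tendsto_of_tendsto_of_tendsto_of_le_of_le' (g := s) (h := fun y => g x + C * b x y)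
    ?_ ?_ (Eventually.of_forall hus) (eventually_mem_nhdsWithin.mono hupb)
  · rw [← hsg x hxf]; exact hsc.continuousWithinAt
  · have hc : Continuous fun y => g x + C * b x y :=
      continuous_const.add (continuous_const.mul (hbc x hxf))
    have := hc.tendsto x
    simp only [hb0 x hxf, mul_zero, add_zero] at this
    exact this.mono_left nhdsWithin_le_nhds

end Perron

/-! ### Laplacians in the plane -/

section PlaneLaplacian

open Metric Filter Topology InnerProductSpace

/-- The derivative in the direction of the `i`-th coordinate. -/
def pd (i : Fin 2) (f : Plane → ℝ) (x : Plane) : ℝ :=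
  fderiv ℝ f x (EuclideanSpace.basisFun (Fin 2) ℝ i)

theorem ContDiffAt.pd {f : Plane → ℝ} {x : Plane} {n : ℕ∞} (hf : ContDiffAt ℝ (n + 1) f x)
    (i : Fin 2) : ContDiffAt ℝ n (pd i f) x :=
  (hf.fderiv_right le_rfl).clm_apply contDiffAt_const

theorem laplacian_eq_pd {f : Plane → ℝ} {x : Plane} (hf : ContDiffAt ℝ 2 f x) :
    Laplacian.laplacian f x = ∑ i, pd i (pd i f) x := by
  rw [laplacian_eq_iteratedFDeriv_orthonormalBasis f (EuclideanSpace.basisFun (Fin 2) ℝ)]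
  refine Finset.sum_congr rfl fun i _ => ?_
  rw [iteratedFDeriv_two_apply]
  simp only [Matrix.cons_val_zero, Matrix.cons_val_one]
  have hd : DifferentiableAt ℝ (fderiv ℝ f) x :=
    (hf.fderiv_right (m := 1) (by norm_num)).differentiableAt one_ne_zero
  have h2 := (hd.hasFDerivAt.clm_apply
    (hasFDerivAt_const (EuclideanSpace.basisFun (Fin 2) ℝ i) x)).fderiv
  rw [pd]
  change _ = fderiv ℝ (fun y => fderiv ℝ f y (EuclideanSpace.basisFun (Fin 2) ℝ i)) x _
  rw [h2]
  simp

theorem pd_comp_const_sub {f : Plane → ℝ} {a x : Plane} (hf : DifferentiableAt ℝ f (a - x))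
    (i : Fin 2) : pd i (fun y => f (a - y)) x = - pd i f (a - x) := by
  have h := hf.hasFDerivAt.comp x ((hasFDerivAt_id x).const_sub a)
  have h2 : fderiv ℝ (fun y => f (a - y)) x = _ := h.fderiv
  rw [pd, h2]
  simp [pd]

theorem laplacian_comp_const_sub {f : Plane → ℝ} (hf : ContDiff ℝ 2 f) (a x : Plane) :
    Laplacian.laplacian (fun y => f (a - y)) x = Laplacian.laplacian f (a - x) := by
  have hc : ContDiff ℝ 2 fun y => f (a - y) := hf.comp (contDiff_const.sub contDiff_id)
  rw [laplacian_eq_pd hc.contDiffAt, laplacian_eq_pd hf.contDiffAt]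
  refine Finset.sum_congr rfl fun i _ => ?_
  have h1 : pd i (fun y => f (a - y)) = fun y => (fun z => - pd i f z) (a - y) := by
    ext y; exact pd_comp_const_sub (hf.differentiable two_ne_zero _) i
  have hd : DifferentiableAt ℝ (pd i f) (a - x) :=
    (ContDiffAt.pd (n := 1) hf.contDiffAt i).differentiableAt one_ne_zero
  rw [h1, pd_comp_const_sub (f := fun z => - pd i f z) hd.neg]
  have h2 : fderiv ℝ (fun z => - pd i f z) (a - x) = - fderiv ℝ (pd i f) (a - x) := fderiv_fun_neg
  rw [pd, h2, neg_apply, neg_neg, pd]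

/-- The identification of the plane with `ℂ`. -/
def toC : Plane ≃ₗᵢ[ℝ] ℂ := Complex.orthonormalBasisOneI.repr.symm

theorem laplacian_comp_toC {f : ℂ → ℝ} (x : Plane) :
    Laplacian.laplacian (f ∘ toC) x = Laplacian.laplacian f (toC x) := by
  rw [laplacian_eq_iteratedFDeriv_orthonormalBasis (f ∘ toC) (EuclideanSpace.basisFun (Fin 2) ℝ),
    laplacian_eq_iteratedFDeriv_orthonormalBasis f Complex.orthonormalBasisOneI]
  refine Finset.sum_congr rfl fun i _ => ?_
  have h := ContinuousLinearEquiv.iteratedFDerivWithin_comp_right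
    (toC.toContinuousLinearEquiv) f uniqueDiffOn_univ (x := x) (mem_univ _) 2
  simp only [preimage_univ, iteratedFDerivWithin_univ] at h
  have h' := congrArg (fun L => L ![EuclideanSpace.basisFun (Fin 2) ℝ i,
    EuclideanSpace.basisFun (Fin 2) ℝ i]) h
  refine h'.trans ?_
  simp only [ContinuousMultilinearMap.compContinuousLinearMap_apply]
  congr 1
  ext j
  fin_cases j <;> simp [toC]

theorem harmonicAt_comp_toC {f : ℂ → ℝ} {x : Plane} (hf : HarmonicAt f (toC x)) :
    HarmonicAt (f ∘ toC) x := by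
  refine ⟨hf.1.comp x toC.contDiff.contDiffAt, ?_⟩
  have h := toC.continuous.continuousAt.eventually hf.2
  filter_upwards [h] with y hy
  rw [laplacian_comp_toC]
  exact hy

theorem harmonicAt_comp_toC_symm {f : Plane → ℝ} {z : ℂ} (hf : HarmonicAt f (toC.symm z)) :
    HarmonicAt (f ∘ toC.symm) z := by
  refine ⟨hf.1.comp z toC.symm.contDiff.contDiffAt, ?_⟩
  have h := toC.symm.continuous.continuousAt.eventually hf.2
  filter_upwards [h] with y hy
  have h2 := laplacian_comp_toC (f := f ∘ toC.symm) (toC.symm y)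
  have h3 : (f ∘ toC.symm) ∘ toC = f := by ext; simp
  rw [h3, LinearIsometryEquiv.apply_symm_apply] at h2
  rw [← h2]
  exact hy

/-! ### The Weyl lemma -/

theorem fderiv_convolution_eq {w ρ : Plane → ℝ} (hw : LocallyIntegrable w volume)
    (hρ : ContDiff ℝ 1 ρ) (hc : HasCompactSupport ρ) (i : Fin 2) :
    pd i (convolution w ρ (ContinuousLinearMap.lsmul ℝ ℝ) volume) =
      convolution w (pd i ρ) (ContinuousLinearMap.lsmul ℝ ℝ) volume := by
  ext x
  rw [pd, (hc.hasFDerivAt_convolution_right _ hw hρ x).fderiv,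
    convolution_precompR_apply _ hw (hc.fderiv ℝ) (hρ.continuous_fderiv one_ne_zero)]
  rfl

theorem hasCompactSupport_pd {ρ : Plane → ℝ} (hc : HasCompactSupport ρ) (i : Fin 2) :
    HasCompactSupport (pd i ρ) :=
  hc.fderiv_apply ℝ _

/-- All derivatives fall on the kernel, and the reflection `y ↦ x - y` does not affect a
second-order operator. The integrand on the right then has the form tested in the weak equation. -/
theorem laplacian_convolution {w ρ : Plane → ℝ} (hw : LocallyIntegrable w volume)
    (hρ : ContDiff ℝ ∞ ρ) (hc : HasCompactSupport ρ) (x : Plane) :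
    Laplacian.laplacian (convolution w ρ (ContinuousLinearMap.lsmul ℝ ℝ) volume) x =
      ∫ t, w t * Laplacian.laplacian (fun y => ρ (x - y)) t := by
  have hρ2 : ContDiff ℝ 2 ρ := hρ.of_le (by norm_cast)
  have hW : ContDiff ℝ 2 (convolution w ρ (ContinuousLinearMap.lsmul ℝ ℝ) volume) :=
    hc.contDiff_convolution_right _ hw hρ2
  have hpd : ∀ i, ContDiff ℝ 1 (pd i ρ) := fun i => contDiff_iff_contDiffAt.2 fun y =>
    ContDiffAt.pd (n := 1) (hρ2.contDiffAt) i
  rw [laplacian_eq_pd hW.contDiffAt]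
  have h1 : ∀ i, pd i (pd i (convolution w ρ (ContinuousLinearMap.lsmul ℝ ℝ) volume)) x =
      ∫ t, w t * pd i (pd i ρ) (x - t) := fun i => by
    rw [fderiv_convolution_eq hw (hρ2.of_le one_le_two) hc,
      fderiv_convolution_eq hw (hpd i) (hasCompactSupport_pd hc i)]
    rfl
  simp only [h1]
  rw [← integral_finsetSum]
  · refine integral_congr_ae (Eventually.of_forall fun t => ?_)
    simp only
    rw [laplacian_comp_const_sub hρ2, laplacian_eq_pd hρ2.contDiffAt, Finset.mul_sum]
  · intro i _
    have := (hasCompactSupport_pd (hasCompactSupport_pd hc i) i).convolutionExists_right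
      (ContinuousLinearMap.lsmul ℝ ℝ) hw
      (((contDiff_iff_contDiffAt.2 fun y => ContDiffAt.pd (n := 0) (by simpa using (hpd i).contDiffAt) i :
        ContDiff ℝ 0 (pd i (pd i ρ)))).continuous) x
    exact this

/-- A continuous function which is weakly harmonic is harmonic. -/
theorem weyl {E : Set Plane} (hE : IsOpen E) {w : Plane → ℝ} (hw : ContinuousOn w E)
    (h : ∀ φ, IsTest E φ → ∫ x in E, w x * Laplacian.laplacian φ x = 0) :
    HarmonicOnNhd w E := by
  intro x₀ hx₀
  obtain ⟨r', hr', hr'E⟩ := Metric.nhds_basis_closedBall.mem_iff.1 (hE.mem_nhds hx₀)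
  -- Room for three nested discs: the Poisson formula is used on radius `r`, the mollified functions
  -- are harmonic on radius `2 * r`, and mollification of width at most `r` stays within radius `4 *
  -- r`.
  set r := r' / 4 with hr
  have hr0 : 0 < r := by positivity
  have hball : closedBall x₀ (4 * r) ⊆ E := by rwa [hr, mul_div_cancel₀ _ (by norm_num)]
  set w' : Plane → ℝ := indicator (closedBall x₀ (4 * r)) w with hw'
  have hwb : ContinuousOn w (closedBall x₀ (4 * r)) := hw.mono hball
  have hw'i : Integrable w' volume :=
    (hwb.integrableOn_compact (isCompact_closedBall _ _)).integrable_indicator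
      isClosed_closedBall.measurableSet
  obtain ⟨M, hM⟩ := (isCompact_closedBall x₀ (4 * r)).exists_bound_of_continuousOn hwb
  have heq : ∀ x ∈ closedBall x₀ (4 * r), w' x = w x := fun x hx => indicator_of_mem hx w
  -- the mollifiers
  let β : ℕ → ContDiffBump (0 : Plane) := fun k =>
    ⟨r / (k + 2), r / (k + 1), by positivity, by gcongr; norm_num⟩
  have hβr : ∀ k, (β k).rOut ≤ r := fun k => div_le_self hr0.le (by simp)
  set W : ℕ → Plane → ℝ := fun k =>
    convolution w' ((β k).normed volume) (ContinuousLinearMap.lsmul ℝ ℝ) volume with hW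
  have hW' : ∀ k, W k =
      convolution ((β k).normed volume) w' (ContinuousLinearMap.lsmul ℝ ℝ) volume := fun k => by
    ext x
    rw [convolution_eq_swap]
    simp only [hW, convolution, ContinuousLinearMap.lsmul_apply, smul_eq_mul]
    exact integral_congr_ae (Eventually.of_forall fun t => mul_comm _ _)
  have hWc : ∀ k, ContDiff ℝ ∞ (W k) := fun k =>
    (β k).hasCompactSupport_normed.contDiff_convolution_right _ hw'i.locallyIntegrable
      (β k).contDiff_normed
  have hWlap : ∀ k, ∀ x ∈ ball x₀ (2 * r), Laplacian.laplacian (W k) x = 0 := by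
    intro k x hx
    rw [hW, laplacian_convolution hw'i.locallyIntegrable (β k).contDiff_normed
      (β k).hasCompactSupport_normed]
    -- The reflected, translated mollifier is an admissible test function, so the Laplacian of the
    -- convolution at `x` is one instance of the weak equation.
    set φ : Plane → ℝ := fun y => (β k).normed volume (x - y) with hφ
    have hsupp : tsupport φ ⊆ closedBall x r := by
      refine closure_minimal (fun y hy => ?_) isClosed_closedBall
      have h1 : x - y ∈ Function.support ((β k).normed volume) := hy
      rw [(β k).support_normed_eq, mem_ball_zero_iff] at h1
      rw [mem_closedBall, dist_comm, dist_eq_norm]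
      exact h1.le.trans (hβr k)
    have hx4 : closedBall x r ⊆ closedBall x₀ (4 * r) := by
      refine closedBall_subset_closedBall' ?_
      rw [mem_ball] at hx
      linarith
    have hφt : IsTest E φ := by
      refine ⟨(β k).contDiff_normed.comp (contDiff_const.sub contDiff_id), ?_,
        hsupp.trans (hx4.trans hball)⟩
      exact (isCompact_closedBall x r).of_isClosed_subset (isClosed_tsupport _) hsupp
    have hz : ∀ t, t ∉ closedBall x₀ (4 * r) → Laplacian.laplacian φ t = 0 := by
      intro t ht
      have h0 : φ =ᶠ[nhds t] fun _ => (0 : ℝ) :=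
        notMem_tsupport_iff_eventuallyEq.mp fun htt => ht (hx4 (hsupp htt))
      rw [(laplacian_congr_nhds h0).eq_of_nhds]
      simp
    rw [← h φ hφt, ← setIntegral_eq_integral_of_forall_compl_eq_zero (s := E)]
    · refine integral_congr_ae (Eventually.of_forall fun t => ?_)
      by_cases ht : t ∈ closedBall x₀ (4 * r)
      · simp only [heq t ht]
      · simp only [hz t ht, mul_zero]
    · intro t ht
      rw [hz t (fun h => ht (hball h)), mul_zero]
  have hWharm : ∀ k, ∀ x ∈ ball x₀ (2 * r), HarmonicAt (W k) x := fun k x hx =>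
    ⟨((hWc k).of_le (by norm_cast)).contDiffAt, by
      filter_upwards [isOpen_ball.mem_nhds hx] with y hy using hWlap k y hy⟩
  have hβ0 : Tendsto (fun k => (β k).rOut) atTop (𝓝 0) := by
    have := (tendsto_one_div_add_atTop_nhds_zero_nat (𝕜 := ℝ)).const_mul r
    simp only [mul_zero] at this
    exact this.congr fun k => by simp [β, div_eq_mul_inv]
  have hsmall : ∀ k, ∀ x ∈ closedBall x₀ r, ball x (β k).rOut ⊆ closedBall x₀ (4 * r) := by
    intro k x hx
    refine ball_subset_closedBall.trans (closedBall_subset_closedBall' ?_)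
    have := hβr k
    rw [mem_closedBall] at hx
    linarith
  have hWb : ∀ k, ∀ x ∈ closedBall x₀ r, |W k x| ≤ 3 * M := by
    intro k x hx
    have hx4 : x ∈ closedBall x₀ (4 * r) := closedBall_subset_closedBall (by linarith) hx
    have h1 : dist (W k x) (w' x) ≤ 2 * M := by
      rw [hW' k]
      refine (β k).dist_normed_convolution_le hw'i.aestronglyMeasurable fun y hy => ?_
      rw [heq x hx4, heq y (hsmall k x hx hy)]
      have h2 := hM x hx4
      have h3 := hM y (hsmall k x hx hy)
      have := norm_sub_le (w y) (w x)
      rw [dist_eq_norm]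
      linarith
    have h2 := hM x hx4
    rw [heq x hx4, Real.dist_eq] at h1
    rw [Real.norm_eq_abs] at h2
    have := abs_add_le (W k x - w x) (w x)
    rw [sub_add_cancel] at this
    linarith
  have hWlim : ∀ x ∈ closedBall x₀ r, Tendsto (fun k => W k x) atTop (𝓝 (w x)) := by
    intro x hx
    have hx4 : x ∈ ball x₀ (4 * r) := by rw [mem_closedBall] at hx; rw [mem_ball]; linarith
    have hcx : ContinuousAt w x :=
      hw.continuousAt (hE.mem_nhds (hball (ball_subset_closedBall hx4)))
    rw [Metric.tendsto_atTop]
    intro ε hε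
    obtain ⟨δ, hδ, hδ'⟩ := Metric.continuousAt_iff.1 hcx (ε / 2) (half_pos hε)
    obtain ⟨k₀, hk₀⟩ := (hβ0.eventually_lt_const hδ).exists_forall_of_atTop
    refine ⟨k₀, fun k hk => ?_⟩
    rw [← heq x (ball_subset_closedBall hx4), hW' k]
    refine lt_of_le_of_lt ((β k).dist_normed_convolution_le hw'i.aestronglyMeasurable
      (ε := ε / 2) fun y hy => ?_) (half_lt_self hε)
    rw [heq x (ball_subset_closedBall hx4), heq y (hsmall k x hx hy)]
    exact (hδ' ((mem_ball.1 hy).trans (hk₀ k hk))).le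
  -- transfer to the complex plane and pass to the limit in the Poisson formula
  set c := toC x₀ with hc
  have hmem : ∀ z : ℂ, ∀ R : ℝ, dist z c ≤ R → dist (toC.symm z) x₀ ≤ R := fun z R hz => by
    rwa [← toC.dist_map, toC.apply_symm_apply]
  have hcc : c ∈ ball c r := mem_ball_self hr0
  -- Each harmonic `W k` reproduces itself by the Poisson formula. With the uniform bound `3 * M`
  -- this passes to the limit, and a Poisson integral is harmonic.
  have hP := fun z (hz : z ∈ ball c r) => poissonIntegral_tendsto (v := fun k => W k ∘ toC.symm)
    (u := w ∘ toC.symm) (M := 3 * M) hr0.le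
    (fun k => (hWc k).continuous.comp toC.symm.continuous)
    (fun k z hz => hWb k _ (hmem z r (mem_sphere.1 hz).le))
    (fun z hz => hWlim _ (hmem z r (mem_sphere.1 hz).le)) hz
  have hharm : HarmonicAt (w ∘ toC.symm) c := by
    refine (harmonicAt_congr_nhds ?_).1 (poissonIntegral_harmonic (hP c hcc).1 c hcc)
    filter_upwards [isOpen_ball.mem_nhds hcc] with z hz
    refine tendsto_nhds_unique ((hP z hz).2.congr fun k => ?_)
      (hWlim _ (hmem z r (mem_ball.1 hz).le))
    refine poissonIntegral_eq_of_harmonic (HarmonicOnNhd.harmonicContOnCl fun y hy => ?_) hz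
    rw [closure_ball _ hr0.ne'] at hy
    refine harmonicAt_comp_toC_symm (hWharm k _ ?_)
    have := hmem y r hy
    rw [mem_ball]
    linarith
  have := harmonicAt_comp_toC hharm
  convert this using 1
  ext; simp

end PlaneLaplacian

/-! ### Integration by parts and truncation -/

section Truncation

open Metric Filter Topology InnerProductSpace

variable {E : Set Plane}

/-- Nothing is required of `f` outside `E`: near every point there the factor `ψ` is identically
zero. This allows integrals over `E` to be treated as integrals over the plane. -/
theorem continuous_mul_of_tsupport_subset (hE : IsOpen E) {f ψ : Plane → ℝ}
    (hf : ContinuousOn f E) (hψ : Continuous ψ) (hs : tsupport ψ ⊆ E) :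
    Continuous fun x => f x * ψ x := by
  rw [continuous_iff_continuousAt]
  intro x
  by_cases hx : x ∈ E
  · exact (hf.continuousAt (hE.mem_nhds hx)).mul hψ.continuousAt
  · have h0 := notMem_tsupport_iff_eventuallyEq.1 fun h => hx (hs h)
    refine ContinuousAt.congr (f := fun _ => (0 : ℝ)) continuousAt_const ?_
    filter_upwards [h0] with y hy
    simp [hy]

theorem integrable_mul_of_tsupport_subset (hE : IsOpen E) {f ψ : Plane → ℝ}
    (hf : ContinuousOn f E) (hψ : Continuous ψ) (hc : HasCompactSupport ψ) (hs : tsupport ψ ⊆ E) :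
    Integrable fun x => f x * ψ x :=
  (continuous_mul_of_tsupport_subset hE hf hψ hs).integrable_of_hasCompactSupport hc.mul_left

theorem continuous_pd {φ : Plane → ℝ} (hφ : ContDiff ℝ 1 φ) (i : Fin 2) : Continuous (pd i φ) :=
  (hφ.continuous_fderiv one_ne_zero).clm_apply continuous_const

theorem contDiffOn_pd {f : Plane → ℝ} {n : ℕ∞} (hE : IsOpen E) (hf : ContDiffOn ℝ (n + 1) f E)
    (i : Fin 2) : ContDiffOn ℝ n (pd i f) E := fun _ hx =>
  (ContDiffAt.pd (hf.contDiffAt (hE.mem_nhds hx)) i).contDiffWithinAt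

theorem continuousOn_pd {f : Plane → ℝ} (hE : IsOpen E) (hf : ContDiffOn ℝ 1 f E)
    (i : Fin 2) : ContinuousOn (pd i f) E :=
  (contDiffOn_pd (n := 0) hE (by simpa using hf) i).continuousOn

theorem tsupport_pd_subset (φ : Plane → ℝ) (i : Fin 2) : tsupport (pd i φ) ⊆ tsupport φ :=
  tsupport_fderiv_apply_subset ℝ _

theorem setIntegral_eq_of_tsupport_subset {f ψ : Plane → ℝ} (hs : tsupport ψ ⊆ E) :
    ∫ x in E, f x * ψ x = ∫ x, f x * ψ x := by
  refine setIntegral_eq_integral_of_forall_compl_eq_zero fun x hx => ?_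
  rw [image_eq_zero_of_notMem_tsupport fun h => hx (hs h), mul_zero]

theorem integral_mul_pd (hE : IsOpen E) {f φ : Plane → ℝ} (hf : ContDiffOn ℝ 1 f E)
    (hφ : ContDiff ℝ 1 φ) (hc : HasCompactSupport φ) (hs : tsupport φ ⊆ E) (i : Fin 2) :
    ∫ x in E, f x * pd i φ x = - ∫ x in E, pd i f x * φ x := by
  rw [setIntegral_eq_of_tsupport_subset ((tsupport_pd_subset φ i).trans hs),
    setIntegral_eq_of_tsupport_subset hs]
  refine integral_mul_fderiv_eq_neg_fderiv_mul_of_integrable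
    (integrable_mul_of_tsupport_subset hE (continuousOn_pd hE hf i) hφ.continuous hc hs)
    (integrable_mul_of_tsupport_subset hE hf.continuousOn (continuous_pd hφ i)
      (hasCompactSupport_pd hc i) ((tsupport_pd_subset φ i).trans hs))
    (integrable_mul_of_tsupport_subset hE hf.continuousOn hφ.continuous hc hs)
    (fun x hx => (hf.differentiableOn one_ne_zero).differentiableAt (hE.mem_nhds (hs hx)))
    (fun x _ => hφ.differentiable one_ne_zero x)

/-- Green's formula. -/
theorem integral_pd_mul_pd (hE : IsOpen E) {v φ : Plane → ℝ} (hv : ContDiffOn ℝ 2 v E)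
    (hφ : ContDiff ℝ 1 φ) (hc : HasCompactSupport φ) (hs : tsupport φ ⊆ E) :
    ∫ x in E, ∑ i, pd i v x * pd i φ x = - ∫ x in E, Laplacian.laplacian v x * φ x := by
  have h1 : ∀ i, ContDiffOn ℝ 1 (pd i v) E := fun i => contDiffOn_pd (n := 1) hE hv i
  rw [integral_finsetSum]
  · have h2 : ∫ x in E, Laplacian.laplacian v x * φ x =
        ∫ x in E, ∑ i, pd i (pd i v) x * φ x := by
      refine setIntegral_congr_fun hE.measurableSet fun x hx => ?_
      beta_reduce
      rw [laplacian_eq_pd (hv.contDiffAt (hE.mem_nhds hx)), Finset.sum_mul]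
    rw [h2, integral_finsetSum, ← Finset.sum_neg_distrib]
    · exact Finset.sum_congr rfl fun i _ => integral_mul_pd hE (h1 i) hφ hc hs i
    · exact fun i _ => (integrable_mul_of_tsupport_subset hE (continuousOn_pd hE (h1 i) i)
        hφ.continuous hc hs).integrableOn
  · exact fun i _ => (integrable_mul_of_tsupport_subset hE (h1 i).continuousOn (continuous_pd hφ i)
      (hasCompactSupport_pd hc i) ((tsupport_pd_subset φ i).trans hs)).integrableOn

theorem gradient_apply (f : Plane → ℝ) (x : Plane) (i : Fin 2) : gradient f x i = pd i f x := by
  rw [pd, ← inner_gradient_left, real_inner_comm, EuclideanSpace.basisFun_apply,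
    EuclideanSpace.inner_single_left]
  simp

theorem norm_gradient_sq (f : Plane → ℝ) (x : Plane) : ‖gradient f x‖ ^ 2 = ∑ i, pd i f x ^ 2 := by
  rw [EuclideanSpace.norm_sq_eq]
  simp [gradient_apply]

theorem continuousOn_gradient (hE : IsOpen E) {f : Plane → ℝ} (hf : ContDiffOn ℝ 1 f E) :
    ContinuousOn (gradient f) E :=
  (InnerProductSpace.toDual ℝ Plane).symm.continuous.comp_continuousOn
    (hf.continuousOn_fderiv_of_isOpen hE le_rfl)

/-- The classical gradient is a weak gradient, by integration by parts against compactly supported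
test functions; no regularity of the boundary enters. -/
theorem memH1_of_contDiffOn (hE : IsOpen E) {u : Plane → ℝ} (hu : ContDiffOn ℝ 1 u E)
    (hu2 : MemLp u 2 (volume.restrict E)) (hg : MemLp (gradient u) 2 (volume.restrict E)) :
    MemH1 E u := by
  refine ⟨hu2, gradient u, hg, fun φ hφ => ?_⟩
  have hφ1 : ContDiff ℝ 1 φ := hφ.smooth.of_le (by norm_cast)
  have e1 := integrable_smul_of_memLp hφ.memLp_gradient hu2
  have e2 := integrable_smul_of_memLp hg hφ.memLp
  ext i
  have p1 := (EuclideanSpace.proj i : Plane →L[ℝ] ℝ).integral_comp_comm e1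
  have p2 := (EuclideanSpace.proj i : Plane →L[ℝ] ℝ).integral_comp_comm e2
  simp only [PiLp.proj_apply, PiLp.smul_apply, smul_eq_mul, gradient_apply] at p1 p2
  rw [PiLp.neg_apply, ← p1, ← p2, integral_mul_pd hE hu hφ1 hφ.compact hφ.supp i]
  simp_rw [mul_comm]

/-! ### Soft thresholds and the test functions obtained from them. -/

/-- The derivative of the soft threshold. -/
def thresholdDeriv (ε s : ℝ) : ℝ := min 1 (max 0 (|s| / ε - 2))

/-- A `C¹` soft threshold. -/
def threshold (ε s : ℝ) : ℝ := ∫ t in (0 : ℝ)..s, thresholdDeriv ε t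

theorem continuous_thresholdDeriv (ε : ℝ) : Continuous (thresholdDeriv ε) := by
  unfold thresholdDeriv
  fun_prop

theorem thresholdDeriv_nonneg (ε s : ℝ) : 0 ≤ thresholdDeriv ε s :=
  le_min zero_le_one (le_max_left _ _)

theorem thresholdDeriv_le_one (ε s : ℝ) : thresholdDeriv ε s ≤ 1 := min_le_left _ _

theorem thresholdDeriv_eq_zero {ε s : ℝ} (hε : 0 < ε) (h : |s| ≤ 2 * ε) :
    thresholdDeriv ε s = 0 := by
  have : |s| / ε ≤ 2 := (div_le_iff₀ hε).2 h
  rw [thresholdDeriv, max_eq_left (by linarith), min_eq_right zero_le_one]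

theorem thresholdDeriv_eq_one {ε s : ℝ} (hε : 0 < ε) (h : 3 * ε ≤ |s|) :
    thresholdDeriv ε s = 1 := by
  have : 3 ≤ |s| / ε := (le_div_iff₀ hε).2 h
  rw [thresholdDeriv, max_eq_right (by linarith), min_eq_left (by linarith)]

/-- Truncated energies increase as the threshold decreases, so an estimate for small `δ` controls
the energy at a fixed `ε`. -/
theorem thresholdDeriv_anti {δ ε : ℝ} (hδ : 0 < δ) (h : δ ≤ ε) (s : ℝ) :
    thresholdDeriv ε s ≤ thresholdDeriv δ s := by
  unfold thresholdDeriv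
  gcongr

theorem hasDerivAt_threshold (ε s : ℝ) : HasDerivAt (threshold ε) (thresholdDeriv ε s) s :=
  intervalIntegral.integral_hasDerivAt_right
    ((continuous_thresholdDeriv ε).intervalIntegrable _ _)
    ((continuous_thresholdDeriv ε).stronglyMeasurableAtFilter _ _)
    (continuous_thresholdDeriv ε).continuousAt

theorem contDiff_threshold (ε : ℝ) : ContDiff ℝ 1 (threshold ε) := by
  rw [contDiff_one_iff_deriv]
  refine ⟨fun s => (hasDerivAt_threshold ε s).differentiableAt, ?_⟩
  have : deriv (threshold ε) = thresholdDeriv ε := funext fun s => (hasDerivAt_threshold ε s).deriv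
  rw [this]
  exact continuous_thresholdDeriv ε

theorem threshold_eq_zero {ε s : ℝ} (hε : 0 < ε) (h : |s| ≤ 2 * ε) : threshold ε s = 0 := by
  unfold threshold
  rw [intervalIntegral.integral_congr (g := fun _ => (0 : ℝ)), intervalIntegral.integral_zero]
  intro t ht
  refine thresholdDeriv_eq_zero hε (le_trans ?_ h)
  have := abs_sub_left_of_mem_uIcc ht
  simpa using this

/-- The derivative of the difference is at most one in absolute value and vanishes outside an
interval of length `6 * ε`. -/
theorem abs_threshold_sub_le {ε : ℝ} (hε : 0 < ε) (s : ℝ) : |threshold ε s - s| ≤ 6 * ε := by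
  have hi := (continuous_thresholdDeriv ε).intervalIntegrable (μ := volume) 0 s
  have h1 : threshold ε s - s = ∫ t in (0 : ℝ)..s, (thresholdDeriv ε t - 1) := by
    rw [intervalIntegral.integral_sub hi intervalIntegrable_const]
    simp [threshold]
  have hind : IntegrableOn (indicator (Icc (-(3 * ε)) (3 * ε)) fun _ => (1 : ℝ)) univ := by
    rw [integrableOn_univ, integrable_indicator_iff measurableSet_Icc]
    exact integrableOn_const (by simp) (by simp)
  have hle : ∀ t, ‖thresholdDeriv ε t - 1‖ ≤
      indicator (Icc (-(3 * ε)) (3 * ε)) (fun _ => (1 : ℝ)) t := by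
    intro t
    by_cases ht : t ∈ Icc (-(3 * ε)) (3 * ε)
    · rw [indicator_of_mem ht, Real.norm_eq_abs, abs_le]
      exact ⟨by linarith [thresholdDeriv_nonneg ε t], by linarith [thresholdDeriv_le_one ε t]⟩
    · rw [indicator_of_notMem ht, thresholdDeriv_eq_one hε]
      · simp
      · by_contra! h
        exact ht (abs_le.1 h.le)
  rw [h1, ← Real.norm_eq_abs]
  calc _ ≤ ∫ t in uIoc 0 s, ‖thresholdDeriv ε t - 1‖ :=
        intervalIntegral.norm_integral_le_integral_norm_uIoc
    _ ≤ ∫ t in uIoc 0 s, indicator (Icc (-(3 * ε)) (3 * ε)) (fun _ => (1 : ℝ)) t :=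
        setIntegral_mono (hi.sub intervalIntegrable_const).def'.norm
          (hind.mono_set (subset_univ _)) hle
    _ ≤ ∫ t in univ, indicator (Icc (-(3 * ε)) (3 * ε)) (fun _ => (1 : ℝ)) t := by
        refine setIntegral_mono_set hind (Eventually.of_forall fun t => ?_)
          (subset_univ _).eventuallyLE
        exact indicator_nonneg (fun _ _ => zero_le_one) t
    _ = 6 * ε := by
        rw [setIntegral_univ, integral_indicator measurableSet_Icc, setIntegral_const]
        simp only [smul_eq_mul, mul_one, Real.volume_real_Icc]
        rw [max_eq_left (by linarith)]
        ring

/-- Truncation of a function which is small on the boundary. -/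
theorem truncation (hE : IsOpen E) (hb : Bornology.IsBounded E) {w : Plane → ℝ}
    (hw : ContinuousOn w (closure E)) (hw1 : ContDiffOn ℝ 1 w E) {ε : ℝ} (hε : 0 < ε)
    (hf : ∀ x ∈ frontier E, |w x| ≤ ε) :
    ∃ φ χ : Plane → ℝ, ContDiff ℝ 1 φ ∧ HasCompactSupport φ ∧ tsupport φ ⊆ E ∧
      Continuous χ ∧ HasCompactSupport χ ∧ tsupport χ ⊆ E ∧
      (∀ x ∈ E, φ x = threshold ε (w x)) ∧ (∀ x ∈ E, χ x = thresholdDeriv ε (w x)) ∧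
      ∀ i, ∀ x ∈ E, pd i φ x = χ x * pd i w x := by
  -- The threshold vanishes up to `2 * ε` whereas `|w|` is at most `ε` on the boundary. This gap
  -- makes `K` a compact subset of `E` that contains both supports.
  set K : Set Plane := {x ∈ closure E | 2 * ε ≤ |w x|} with hK
  have hKc : IsClosed K := (hw.abs).preimage_isClosed_of_isClosed isClosed_closure isClosed_Ici
  have hKcomp : IsCompact K := hb.isCompact_closure.of_isClosed_subset hKc fun _ hx => hx.1
  have hKE : K ⊆ E := by
    intro x hx
    by_contra h
    have := hf x (by rw [hE.frontier_eq]; exact ⟨hx.1, h⟩)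
    linarith [hx.2]
  have key : ∀ g : ℝ → ℝ, (∀ s, |s| ≤ 2 * ε → g s = 0) →
      tsupport (indicator E (g ∘ w)) ⊆ K := by
    intro g hg
    refine closure_minimal (fun x hx => ?_) hKc
    by_contra hxK
    apply hx
    by_cases hxE : x ∈ E
    · rw [indicator_of_mem hxE]
      refine hg _ (le_of_not_ge fun h => hxK ⟨subset_closure hxE, h⟩)
    · exact indicator_of_notMem hxE _
  have k1 := key _ fun s hs => threshold_eq_zero hε hs
  have k2 := key _ fun s hs => thresholdDeriv_eq_zero hε hs
  have hnear : ∀ (g : ℝ → ℝ), ∀ x ∈ E, indicator E (g ∘ w) =ᶠ[𝓝 x] g ∘ w := fun g x hx => by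
    filter_upwards [hE.mem_nhds hx] with y hy using indicator_of_mem hy _
  refine ⟨indicator E (threshold ε ∘ w), indicator E (thresholdDeriv ε ∘ w), ?_,
    hKcomp.of_isClosed_subset (isClosed_tsupport _) k1, k1.trans hKE, ?_,
    hKcomp.of_isClosed_subset (isClosed_tsupport _) k2, k2.trans hKE,
    fun x hx => indicator_of_mem hx _, fun x hx => indicator_of_mem hx _, fun i x hx => ?_⟩
  · rw [contDiff_iff_contDiffAt]
    intro x
    by_cases hx : x ∈ E
    · exact ((contDiff_threshold ε).contDiffAt.comp x
        (hw1.contDiffAt (hE.mem_nhds hx))).congr_of_eventuallyEq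
        (hnear _ x hx)
    · have h0 := notMem_tsupport_iff_eventuallyEq.1 fun h => hx (hKE (k1 h))
      exact contDiffAt_const.congr_of_eventuallyEq (f := fun _ => (0 : ℝ)) h0
  · rw [continuous_iff_continuousAt]
    intro x
    by_cases hx : x ∈ E
    · exact ((continuous_thresholdDeriv ε).continuousAt.comp
        (hw1.continuousOn.continuousAt (hE.mem_nhds hx))).congr (hnear _ x hx).symm
    · have h0 := notMem_tsupport_iff_eventuallyEq.1 fun h => hx (hKE (k2 h))
      exact ContinuousAt.congr (f := fun _ => (0 : ℝ)) continuousAt_const h0.symm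
  · have hd := (hw1.differentiableOn one_ne_zero).differentiableAt (hE.mem_nhds hx)
    rw [pd, (hnear _ x hx).fderiv_eq,
      ((hasDerivAt_threshold ε (w x)).comp_hasFDerivAt x hd.hasFDerivAt).fderiv,
      indicator_of_mem hx]
    simp [pd]

/-- A function with zero boundary values, whose Laplacian is orthogonal to it, vanishes. -/
theorem eq_zero_of_laplacian_orthogonal (hE : IsOpen E) (hb : Bornology.IsBounded E)
    {v p : Plane → ℝ} (hv : ContinuousOn v (closure E)) (hv2 : ContDiffOn ℝ 2 v E)
    (h0 : ∀ x ∈ frontier E, v x = 0) (hp : Continuous p)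
    (hlap : ∀ x ∈ E, Laplacian.laplacian v x = - p x) (horth : ∫ x in E, p x * v x = 0) :
    ∀ x ∈ E, v x = 0 := by
  have hv1 : ContDiffOn ℝ 1 v E := hv2.of_le one_le_two
  have hpint : IntegrableOn p E :=
    (hp.continuousOn.integrableOn_compact hb.isCompact_closure).mono_set subset_closure
  have hpvint : IntegrableOn (fun x => p x * v x) E :=
    ((hp.continuousOn.mul hv).integrableOn_compact hb.isCompact_closure).mono_set subset_closure
  have hSc : ContinuousOn (fun x => ∑ i, pd i v x ^ 2) E :=
    continuousOn_finsetSum _ fun i _ => (continuousOn_pd hE hv1 i).pow 2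
  have T := fun (ε : ℝ) (hε : 0 < ε) =>
    truncation hE hb hv hv1 hε (fun x hx => by rw [h0 x hx, abs_zero]; exact hε.le)
  -- the energy identity
  have energy : ∀ ε (hε : 0 < ε) (χ : Plane → ℝ), Continuous χ → HasCompactSupport χ →
      tsupport χ ⊆ E → (∀ x ∈ E, χ x = thresholdDeriv ε (v x)) →
      ∫ x in E, (∑ i, pd i v x ^ 2) * χ x ≤ 6 * ε * ∫ x in E, |p x| := by
    intro ε hε χ' hχc' hχs' hχE' hχ'
    obtain ⟨φ, χ, hφ1, hφc, hφs, hχ1, hχc, hχs, hφ, hχ, hpd⟩ := T ε hε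
    -- Green's formula for the truncated test function. Subtracting `∫ p v = 0` afterwards leaves
    -- only `threshold ε (v x) - v x`, which is of size `ε`.
    have e1 : ∫ x in E, (∑ i, pd i v x ^ 2) * χ' x = ∫ x in E, p x * φ x := by
      have h1 := integral_pd_mul_pd hE hv2 hφ1 hφc hφs
      have h2 : ∫ x in E, (∑ i, pd i v x ^ 2) * χ' x = ∫ x in E, ∑ i, pd i v x * pd i φ x := by
        refine setIntegral_congr_fun hE.measurableSet fun x hx => ?_
        rw [Finset.sum_mul, hχ' x hx, ← hχ x hx]
        refine Finset.sum_congr rfl fun i _ => ?_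
        rw [hpd i x hx]; ring
      rw [h2, h1, ← integral_neg]
      refine setIntegral_congr_fun hE.measurableSet fun x hx => ?_
      beta_reduce
      rw [hlap x hx]; ring
    have hpφ : IntegrableOn (fun x => p x * φ x) E :=
      (integrable_mul_of_tsupport_subset hE hp.continuousOn hφ1.continuous hφc hφs).integrableOn
    rw [e1, ← sub_zero (∫ x in E, p x * φ x), ← horth, ← integral_sub hpφ hpvint,
      ← integral_const_mul]
    refine setIntegral_mono_on (hpφ.sub hpvint) (hpint.norm.const_mul _) hE.measurableSet
      fun x hx => ?_
    rw [← mul_sub, hφ x hx]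
    calc p x * (threshold ε (v x) - v x) ≤ |p x| * |threshold ε (v x) - v x| := by
          rw [← abs_mul]; exact le_abs_self _
      _ ≤ |p x| * (6 * ε) := by gcongr; exact abs_threshold_sub_le hε _
      _ = 6 * ε * ‖p x‖ := by rw [Real.norm_eq_abs]; ring
  have hvanish : ∀ ε, 0 < ε → ∀ x ∈ E, threshold ε (v x) = 0 := by
    intro ε hε
    obtain ⟨φ, χ, hφ1, hφc, hφs, hχ1, hχc, hχs, hφ, hχ, hpd⟩ := T ε hε
    set I := ∫ x in E, (∑ i, pd i v x ^ 2) * χ x with hI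
    -- The energy at level `ε` is dominated by that at level `δ`; letting `δ` tend to zero shows
    -- that it vanishes.
    have hIle : ∀ δ, 0 < δ → δ ≤ ε → I ≤ 6 * δ * ∫ x in E, |p x| := by
      intro δ hδ hδε
      obtain ⟨φ', χ', -, -, -, hχ1', hχc', hχs', -, hχ', -⟩ := T δ hδ
      refine le_trans ?_ (energy δ hδ χ' hχ1' hχc' hχs' hχ')
      refine setIntegral_mono_on
        (integrable_mul_of_tsupport_subset hE hSc hχ1 hχc hχs).integrableOn
        (integrable_mul_of_tsupport_subset hE hSc hχ1' hχc' hχs').integrableOn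
        hE.measurableSet fun x hx => ?_
      rw [hχ x hx, hχ' x hx]
      gcongr
      exact thresholdDeriv_anti hδ hδε _
    have hI0 : I ≤ 0 := by
      have hlim : Tendsto (fun δ : ℝ => 6 * δ * ∫ x in E, |p x|) (𝓝[>] 0) (𝓝 0) := by
        have : Continuous fun δ : ℝ => 6 * δ * ∫ x in E, |p x| := by fun_prop
        have h := (this.tendsto 0).mono_left (nhdsWithin_le_nhds (s := Ioi 0))
        simpa using h
      refine ge_of_tendsto hlim ?_
      filter_upwards [Ioc_mem_nhdsGT hε] with δ hδ using hIle δ hδ.1 hδ.2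
    set F : Plane → ℝ := fun x => (∑ i, pd i v x ^ 2) * χ x with hF
    have hFc : Continuous F := continuous_mul_of_tsupport_subset hE hSc hχ1 hχs
    have hF0 : 0 ≤ F := by
      intro x
      by_cases hx : x ∈ E
      · simp only [hF, hχ x hx]
        exact mul_nonneg (Finset.sum_nonneg fun i _ => sq_nonneg _) (thresholdDeriv_nonneg _ _)
      · simp only [hF, image_eq_zero_of_notMem_tsupport fun h => hx (hχs h), mul_zero]
        exact le_rfl
    have hFz : F = 0 := by
      have h1 : ∫ x, F x = 0 := by
        rw [← setIntegral_eq_of_tsupport_subset hχs]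
        exact le_antisymm hI0 (setIntegral_nonneg hE.measurableSet fun x _ => hF0 x)
      rw [integral_eq_zero_iff_of_nonneg hF0
        (integrable_mul_of_tsupport_subset hE hSc hχ1 hχc hχs)] at h1
      exact (hFc.ae_eq_iff_eq volume continuous_zero).1 h1
    have hφ0 : ∀ x, fderiv ℝ φ x = 0 := by
      intro x
      by_cases hx : x ∈ E
      · have hFx : F x = 0 := congrFun hFz x
        have hpd0 : ∀ i, pd i φ x = 0 := by
          intro i
          rw [hpd i x hx]
          rcases mul_eq_zero.1 hFx with h | h
          · have := (Finset.sum_eq_zero_iff_of_nonneg fun i _ => sq_nonneg _).1 h i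
              (Finset.mem_univ i)
            rw [pow_eq_zero_iff two_ne_zero] at this
            rw [this, mul_zero]
          · rw [h, zero_mul]
        refine ContinuousLinearMap.coe_injective
          ((EuclideanSpace.basisFun (Fin 2) ℝ).toBasis.ext fun i => ?_)
        simpa [pd] using hpd0 i
      · exact image_eq_zero_of_notMem_tsupport fun h => hx (hφs (tsupport_fderiv_subset ℝ h))
    -- With zero gradient on the whole plane, `φ` is constant, and its compact support makes the
    -- constant zero. Connectedness of `E` is not needed.
    obtain ⟨y, hy⟩ : ∃ y, y ∉ tsupport φ := by
      by_contra! h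
      exact noncompact_univ Plane (by rw [← eq_univ_of_forall h]; exact hφc)
    intro x hx
    rw [← hφ x hx, is_const_of_fderiv_eq_zero (hφ1.differentiable one_ne_zero) hφ0 x y]
    exact image_eq_zero_of_notMem_tsupport hy
  intro x hx
  by_contra hne
  -- At this level the threshold moves `v x` by at most half of its modulus, so it cannot send a
  -- nonzero value to zero.
  have hpos : 0 < |v x| / 12 := by positivity
  have := abs_threshold_sub_le hpos (v x)
  rw [hvanish _ hpos x hx, zero_sub, abs_neg] at this
  linarith [abs_pos.2 hne]

end Truncation

/-! ### The energy of a harmonic function with Lipschitz boundary values -/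

section Energy

open Metric Filter Topology InnerProductSpace

open scoped NNReal

variable {E : Set Plane}

/-- Mollification of a Lipschitz function. -/
theorem exists_contDiff_lipschitz_approx {G : Plane → ℝ} {L : ℝ≥0} (hG : LipschitzWith L G)
    {ε : ℝ} (hε : 0 < ε) :
    ∃ G' : Plane → ℝ, ContDiff ℝ ∞ G' ∧ LipschitzWith L G' ∧ ∀ x, |G' x - G x| ≤ ε := by
  set δ : ℝ := ε / (L + 1) with hδ
  have hδ0 : 0 < δ := by positivity
  let β : ContDiffBump (0 : Plane) := ⟨δ / 2, δ, half_pos hδ0, half_lt_self hδ0⟩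
  set ρ := β.normed volume with hρ
  have hρi : Integrable ρ := β.integrable_normed
  set G' : Plane → ℝ := convolution ρ G (ContinuousLinearMap.lsmul ℝ ℝ) volume with hG'
  have hGc := hG.continuous
  refine ⟨G', β.hasCompactSupport_normed.contDiff_convolution_left _ β.contDiff_normed
    hGc.locallyIntegrable, ?_, fun x => ?_⟩
  · have hintg : ∀ x, Integrable fun t => ρ t * G (x - t) := fun x =>
      (Continuous.integrable_of_hasCompactSupport (β.continuous_normed.mul (by fun_prop))
        β.hasCompactSupport_normed.mul_right)
    refine LipschitzWith.of_dist_le_mul fun x y => ?_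
    rw [Real.dist_eq]
    have h1 : G' x - G' y = ∫ t, ρ t * (G (x - t) - G (y - t)) := by
      simp only [hG', convolution, ContinuousLinearMap.lsmul_apply, smul_eq_mul]
      rw [← integral_sub (hintg x) (hintg y)]
      simp_rw [mul_sub]
    rw [h1, ← Real.norm_eq_abs]
    calc ‖∫ t, ρ t * (G (x - t) - G (y - t))‖ ≤ ∫ t, ρ t * (L * dist x y) := by
          refine norm_integral_le_of_norm_le (hρi.mul_const _) (Eventually.of_forall fun t => ?_)
          rw [norm_mul, Real.norm_of_nonneg (β.nonneg_normed t), Real.norm_eq_abs,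
            ← Real.dist_eq]
          refine mul_le_mul_of_nonneg_left ?_ (β.nonneg_normed t)
          have := hG.dist_le_mul (x - t) (y - t)
          rwa [dist_sub_right] at this
      _ = L * dist x y := by rw [integral_mul_const, hρ, β.integral_normed, one_mul]
  · rw [← Real.dist_eq]
    refine β.dist_normed_convolution_le hGc.aestronglyMeasurable fun y hy => ?_
    have h1 := hG.dist_le_mul y x
    have h2 : dist y x ≤ δ := (mem_ball.1 hy).le
    have h3 : δ * (L + 1) = ε := div_mul_cancel₀ _ (by positivity)
    have h4 : (L : ℝ) * dist y x ≤ L * δ := by gcongr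
    linarith

theorem sum_pd_sq_le_of_lipschitz {G : Plane → ℝ} {L : ℝ≥0} (hG : LipschitzWith L G) (x : Plane) :
    ∑ i, pd i G x ^ 2 ≤ (L : ℝ) ^ 2 := by
  rw [← norm_gradient_sq]
  have : ‖gradient G x‖ = ‖fderiv ℝ G x‖ := LinearIsometryEquiv.norm_map _ _
  rw [this]
  gcongr
  exact norm_fderiv_le_of_lipschitz ℝ hG

/-- A Dirichlet principle on truncations: test the harmonic `u` with the threshold of `u - G'`,
where `G'` is a mollification of `G` with the same Lipschitz constant. The bound does not depend on
`ε`. -/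
theorem lintegral_energy_threshold_le (hE : IsOpen E) (hb : Bornology.IsBounded E)
    {u G : Plane → ℝ} {L : ℝ≥0} (hu : ContinuousOn u (closure E)) (hh : HarmonicOnNhd u E)
    (hG : LipschitzWith L G) (hf : ∀ x ∈ frontier E, u x = G x) {ε : ℝ} (hε : 0 < ε) :
    ∫⁻ x in {x ∈ E | 4 * ε ≤ |u x - G x|}, ENNReal.ofReal (∑ i, pd i u x ^ 2) ≤
      ENNReal.ofReal (L ^ 2 * volume.real E) := by
  obtain ⟨G', hG'c, hG'L, hG'⟩ := exists_contDiff_lipschitz_approx hG hε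
  have hu2 : ContDiffOn ℝ 2 u E := hh.contDiffOn
  have hu1 : ContDiffOn ℝ 1 u E := hu2.of_le one_le_two
  have hG1 : ContDiff ℝ 1 G' := hG'c.of_le (by norm_cast)
  obtain ⟨φ, χ, hφ1, hφc, hφs, hχ1, hχc, hχs, hφ, hχ, hpd⟩ :=
    truncation hE hb (w := fun x => u x - G' x) (hu.sub hG1.continuous.continuousOn)
      (hu1.sub hG1.contDiffOn) hε
      (fun x hx => by rw [hf x hx, abs_sub_comm]; exact hG' x)
  have hfin : volume E ≠ ⊤ := hb.measure_lt_top.ne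
  have hpdw : ∀ i, ∀ x ∈ E, pd i (fun x => u x - G' x) x = pd i u x - pd i G' x := by
    intro i x hx
    have h1 := (hu1.differentiableOn one_ne_zero).differentiableAt (hE.mem_nhds hx)
    rw [pd, fderiv_fun_sub h1 (hG1.differentiable one_ne_zero x)]
    rfl
  have hS : ContinuousOn (fun x => ∑ i, pd i u x ^ 2) E :=
    continuousOn_finsetSum _ fun i _ => (continuousOn_pd hE hu1 i).pow 2
  have hT : ContinuousOn (fun x => ∑ i, pd i u x * (pd i u x - pd i G' x)) E :=
    continuousOn_finsetSum _ fun i _ => (continuousOn_pd hE hu1 i).mul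
      ((continuousOn_pd hE hu1 i).sub (continuous_pd hG1 i).continuousOn)
  have hSi := (integrable_mul_of_tsupport_subset hE hS hχ1 hχc hχs).integrableOn (s := E)
  have hTi := (integrable_mul_of_tsupport_subset hE hT hχ1 hχc hχs).integrableOn (s := E)
  have hTz : ∫ x in E, (∑ i, pd i u x * (pd i u x - pd i G' x)) * χ x = 0 := by
    have h1 := integral_pd_mul_pd hE hu2 hφ1 hφc hφs
    have h2 : ∫ x in E, Laplacian.laplacian u x * φ x = ∫ x in E, (0 : ℝ) :=
      setIntegral_congr_fun hE.measurableSet fun x hx => by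
        beta_reduce
        rw [(hh x hx).2.eq_of_nhds, Pi.zero_apply, zero_mul]
    rw [h2, integral_zero, neg_zero] at h1
    rw [← h1]
    refine setIntegral_congr_fun hE.measurableSet fun x hx => ?_
    rw [Finset.sum_mul]
    refine Finset.sum_congr rfl fun i _ => ?_
    rw [hpd i x hx, hpdw i x hx]; ring
  have hχ01 : ∀ x ∈ E, 0 ≤ χ x ∧ χ x ≤ 1 := fun x hx => by
    rw [hχ x hx]; exact ⟨thresholdDeriv_nonneg _ _, thresholdDeriv_le_one _ _⟩
  have hle : ∫ x in E, (∑ i, pd i u x ^ 2) * χ x ≤ L ^ 2 * volume.real E := by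
    have hci : IntegrableOn (fun _ : Plane => (L : ℝ) ^ 2) E := integrableOn_const hfin (by simp)
    calc ∫ x in E, (∑ i, pd i u x ^ 2) * χ x
        ≤ ∫ x in E, (2 * ((∑ i, pd i u x * (pd i u x - pd i G' x)) * χ x) + (L : ℝ) ^ 2) := by
          refine setIntegral_mono_on hSi ((hTi.const_mul 2).add hci) hE.measurableSet
            fun x hx => ?_
          obtain ⟨h0, h1⟩ := hχ01 x hx
          have h2 := sum_pd_sq_le_of_lipschitz hG'L x
          -- This is `a² ≤ 2a(a - b) + b²`; the term `a(a - b)`, weighted by `χ`, integrates to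
          -- zero.
          have h3 : ∑ i, pd i u x ^ 2 ≤
              2 * (∑ i, pd i u x * (pd i u x - pd i G' x)) + ∑ i, pd i G' x ^ 2 := by
            rw [Finset.mul_sum, ← Finset.sum_add_distrib]
            refine Finset.sum_le_sum fun i _ => ?_
            nlinarith [sq_nonneg (pd i u x - pd i G' x)]
          have h4 := mul_le_mul_of_nonneg_right h3 h0
          have h5 : (∑ i, pd i G' x ^ 2) * χ x ≤ (L : ℝ) ^ 2 := by
            calc (∑ i, pd i G' x ^ 2) * χ x ≤ (L : ℝ) ^ 2 * 1 := by gcongr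
              _ = _ := mul_one _
          linarith
      _ = L ^ 2 * volume.real E := by
          rw [integral_add (hTi.const_mul 2) hci, integral_const_mul, hTz, setIntegral_const,
            smul_eq_mul]
          ring
  have hmeas : MeasurableSet {x ∈ E | 4 * ε ≤ |u x - G x|} := by
    have h1 : ContinuousOn (fun x => |u x - G x|) E :=
      ((hu.mono subset_closure).sub hG.continuous.continuousOn).abs
    obtain ⟨s, hs, hs'⟩ := continuousOn_iff_isClosed.1 h1 (Ici (4 * ε)) isClosed_Ici
    have : {x ∈ E | 4 * ε ≤ |u x - G x|} = s ∩ E := by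
      rw [← hs']; ext x; simp [and_comm]
    rw [this]
    exact hs.measurableSet.inter hE.measurableSet
  calc ∫⁻ x in {x ∈ E | 4 * ε ≤ |u x - G x|}, ENNReal.ofReal (∑ i, pd i u x ^ 2)
      = ∫⁻ x in {x ∈ E | 4 * ε ≤ |u x - G x|}, ENNReal.ofReal ((∑ i, pd i u x ^ 2) * χ x) := by
        refine setLIntegral_congr_fun hmeas fun x hx => ?_
        -- Mollification changes `G` by at most `ε`, so `4 * ε ≤ |u - G|` implies `3 * ε ≤ |u -
        -- G'|`, where the cut-off equals one.
        rw [hχ x hx.1, thresholdDeriv_eq_one hε, mul_one]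
        have h1 := hG' x
        have h2 := hx.2
        have h3 := abs_sub_abs_le_abs_sub (u x - G x) (G' x - G x)
        rw [sub_sub_sub_cancel_right] at h3
        linarith
    _ ≤ ∫⁻ x in E, ENNReal.ofReal ((∑ i, pd i u x ^ 2) * χ x) :=
        lintegral_mono_set fun x hx => hx.1
    _ = ENNReal.ofReal (∫ x in E, (∑ i, pd i u x ^ 2) * χ x) := by
        rw [ofReal_integral_eq_lintegral_ofReal hSi]
        filter_upwards [ae_restrict_mem hE.measurableSet] with x hx
        exact mul_nonneg (Finset.sum_nonneg fun i _ => sq_nonneg _) (hχ01 x hx).1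
    _ ≤ ENNReal.ofReal (L ^ 2 * volume.real E) := ENNReal.ofReal_le_ofReal hle

/-- Monotone convergence as the threshold tends to zero. The truncation sees nothing of the set
where `u` and `G` coincide, which is treated separately. -/
theorem lintegral_energy_ne_le (hE : IsOpen E) (hb : Bornology.IsBounded E)
    {u G : Plane → ℝ} {L : ℝ≥0} (hu : ContinuousOn u (closure E)) (hh : HarmonicOnNhd u E)
    (hG : LipschitzWith L G) (hf : ∀ x ∈ frontier E, u x = G x) :
    ∫⁻ x in {x ∈ E | u x ≠ G x}, ENNReal.ofReal (∑ i, pd i u x ^ 2) ≤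
      ENNReal.ofReal (L ^ 2 * volume.real E) := by
  have hU : {x ∈ E | u x ≠ G x} = ⋃ n : ℕ, {x ∈ E | 4 * (1 / ((n : ℝ) + 1)) ≤ |u x - G x|} := by
    ext x
    simp only [mem_iUnion, mem_ofPred_eq]
    constructor
    · rintro ⟨hx, hne⟩
      have hpos : 0 < |u x - G x| := abs_pos.2 (sub_ne_zero.2 hne)
      obtain ⟨n, hn⟩ := exists_nat_one_div_lt (show 0 < |u x - G x| / 4 by positivity)
      exact ⟨n, hx, by linarith⟩
    · rintro ⟨n, hx, hn⟩
      refine ⟨hx, fun h => ?_⟩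
      rw [h, sub_self, abs_zero] at hn
      have : (0 : ℝ) < 1 / ((n : ℝ) + 1) := by positivity
      linarith
  have hmono : Monotone fun n : ℕ => {x ∈ E | 4 * (1 / ((n : ℝ) + 1)) ≤ |u x - G x|} := by
    intro m n hmn x hx
    refine ⟨hx.1, le_trans ?_ hx.2⟩
    have : (m : ℝ) ≤ n := by exact_mod_cast hmn
    gcongr
  rw [hU, setLIntegral_iUnion_of_directed _ hmono.directed_le]
  exact iSup_le fun n => lintegral_energy_threshold_le hE hb hu hh hG hf (by positivity)

/-- A harmonic function with Lipschitz boundary values has finite energy. -/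
theorem memLp_gradient_of_lipschitz (hE : IsOpen E) (hb : Bornology.IsBounded E)
    {u G : Plane → ℝ} {L : ℝ≥0} (hu : ContinuousOn u (closure E)) (hh : HarmonicOnNhd u E)
    (hG : LipschitzWith L G) (hf : ∀ x ∈ frontier E, u x = G x) :
    MemLp (gradient u) 2 (volume.restrict E) := by
  have hu1 : ContDiffOn ℝ 1 u E := hh.contDiffOn.of_le one_le_two
  -- The coincidence set is handled by a second extension `G + ψ` of the same boundary values. Since
  -- `ψ` is nonzero at every point of `E`, `u` differs from `G` or from `G + ψ` there, and two
  -- energy estimates cover `E`.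
  obtain ⟨ψ, hψs, hψ, -⟩ := hE.exists_contDiff_support_eq (n := ⊤)
  have hψ1 : ContDiff ℝ 1 ψ := hψ.of_le (by norm_cast)
  have hψc : HasCompactSupport ψ := by
    rw [HasCompactSupport, tsupport, hψs]; exact hb.isCompact_closure
  obtain ⟨L', hL'⟩ := hψ1.lipschitzWith_of_hasCompactSupport hψc one_ne_zero
  have h1 := lintegral_energy_ne_le hE hb hu hh hG hf
  have h2 := lintegral_energy_ne_le hE hb hu hh (hG.add hL') (fun x hx => by
    have : ψ x = 0 := by
      rw [← Function.notMem_support, hψs]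
      rw [hE.frontier_eq] at hx; exact hx.2
    simp [hf x hx, this])
  have hcover : E ⊆ {x ∈ E | u x ≠ G x} ∪ {x ∈ E | u x ≠ (G + ψ) x} := by
    intro x hx
    by_cases h : u x = G x
    · refine Or.inr ⟨hx, fun h' => ?_⟩
      have : x ∈ Function.support ψ := by rw [hψs]; exact hx
      rw [Pi.add_apply, h] at h'
      exact this (by linarith)
    · exact Or.inl ⟨hx, h⟩
  have hfin : ∫⁻ x in E, ENNReal.ofReal (∑ i, pd i u x ^ 2) < ⊤ := by
    refine lt_of_le_of_lt ((lintegral_mono_set hcover).trans (lintegral_union_le _ _ _)) ?_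
    exact ENNReal.add_lt_top.2
      ⟨h1.trans_lt ENNReal.ofReal_lt_top, h2.trans_lt ENNReal.ofReal_lt_top⟩
  refine ⟨(continuousOn_gradient hE hu1).aestronglyMeasurable hE.measurableSet, ?_⟩
  rw [eLpNorm_lt_top_iff_lintegral_rpow_enorm_lt_top two_ne_zero ENNReal.ofNat_ne_top]
  refine lt_of_le_of_lt (lintegral_mono fun x => ?_) hfin
  rw [← norm_gradient_sq, ← ofReal_norm, ENNReal.toReal_ofNat,
    ENNReal.ofReal_rpow_of_nonneg (norm_nonneg _) zero_le_two]
  norm_num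

end Energy

/-! ### Polynomial right-hand sides -/

section PolynomialRHS

theorem pd_monomial_zero (a b : ℕ) (c : ℝ) (x : Plane) :
    pd 0 (fun x : Plane => c * (x 0 ^ a * x 1 ^ b)) x = (c * a) * (x 0 ^ (a - 1) * x 1 ^ b) := by
  have h0 : HasFDerivAt (fun x : Plane => x 0) (EuclideanSpace.proj 0 : Plane →L[ℝ] ℝ) x :=
    (EuclideanSpace.proj 0 : Plane →L[ℝ] ℝ).hasFDerivAt
  have h1 : HasFDerivAt (fun x : Plane => x 1) (EuclideanSpace.proj 1 : Plane →L[ℝ] ℝ) x :=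
    (EuclideanSpace.proj 1 : Plane →L[ℝ] ℝ).hasFDerivAt
  have h : fderiv ℝ (fun x : Plane => c * (x 0 ^ a * x 1 ^ b)) x = _ :=
    (((h0.pow a).mul (h1.pow b)).const_mul c).fderiv
  rw [pd, h]
  simp [EuclideanSpace.basisFun_apply]
  ring

theorem pd_monomial_one (a b : ℕ) (c : ℝ) (x : Plane) :
    pd 1 (fun x : Plane => c * (x 0 ^ a * x 1 ^ b)) x = (c * b) * (x 0 ^ a * x 1 ^ (b - 1)) := by
  have h0 : HasFDerivAt (fun x : Plane => x 0) (EuclideanSpace.proj 0 : Plane →L[ℝ] ℝ) x :=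
    (EuclideanSpace.proj 0 : Plane →L[ℝ] ℝ).hasFDerivAt
  have h1 : HasFDerivAt (fun x : Plane => x 1) (EuclideanSpace.proj 1 : Plane →L[ℝ] ℝ) x :=
    (EuclideanSpace.proj 1 : Plane →L[ℝ] ℝ).hasFDerivAt
  have h : fderiv ℝ (fun x : Plane => c * (x 0 ^ a * x 1 ^ b)) x = _ :=
    (((h0.pow a).mul (h1.pow b)).const_mul c).fderiv
  rw [pd, h]
  simp [EuclideanSpace.basisFun_apply]
  ring

theorem laplacian_monomial (a b : ℕ) (c : ℝ) (x : Plane) :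
    Laplacian.laplacian (fun x : Plane => c * (x 0 ^ a * x 1 ^ b)) x =
      c * a * ((a - 1 : ℕ) : ℝ) * (x 0 ^ (a - 1 - 1) * x 1 ^ b) +
        c * b * ((b - 1 : ℕ) : ℝ) * (x 0 ^ a * x 1 ^ (b - 1 - 1)) := by
  rw [laplacian_eq_pd (by fun_prop), Fin.sum_univ_two, funext (pd_monomial_zero a b c),
    funext (pd_monomial_one a b c), pd_monomial_zero, pd_monomial_one]

/-- Integrate twice in the first variable. The error comes from the second derivative in the other
variable; it is a monomial with `b` lowered by two, or zero if `b < 2`. -/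
theorem exists_laplacian_eq_monomial (b : ℕ) : ∀ (a : ℕ) (c : ℝ), ∃ Q : Plane → ℝ,
    ContDiff ℝ ∞ Q ∧ ∀ x, Laplacian.laplacian Q x = c * (x 0 ^ a * x 1 ^ b) := by
  induction b using Nat.strong_induction_on with
  | _ b ih =>
    intro a c
    set d : ℝ := c / ((a + 2) * (a + 1)) with hd
    have hdc : d * (a + 2) * (a + 1) = c := by
      rw [hd, mul_assoc, div_mul_cancel₀ _ (by positivity)]
    rcases lt_or_ge b 2 with hb | hb
    · refine ⟨fun x => d * (x 0 ^ (a + 2) * x 1 ^ b), by fun_prop, fun x => ?_⟩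
      rw [laplacian_monomial]
      have h0 : (b : ℝ) * ((b - 1 : ℕ) : ℝ) = 0 := by interval_cases b <;> simp
      rw [mul_assoc d (b : ℝ), h0]
      simp only [Nat.add_one_sub_one, Nat.cast_add, Nat.cast_ofNat, Nat.cast_one]
      rw [hdc]; ring
    · obtain ⟨Q, hQ, hQ'⟩ := ih (b - 2) (by omega) (a + 2) (-(d * b * ((b - 1 : ℕ) : ℝ)))
      have hm : ContDiff ℝ ∞ fun x : Plane => d * (x 0 ^ (a + 2) * x 1 ^ b) := by fun_prop
      refine ⟨(fun x => d * (x 0 ^ (a + 2) * x 1 ^ b)) + Q, hm.add hQ, fun x => ?_⟩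
      rw [ContDiffAt.laplacian_add (hm.contDiffAt.of_le (by norm_cast))
        (hQ.contDiffAt.of_le (by norm_cast)), laplacian_monomial, hQ']
      simp only [Nat.add_one_sub_one, Nat.cast_add, Nat.cast_ofNat, Nat.cast_one]
      rw [hdc, show b - 1 - 1 = b - 2 by omega]; ring

/-- The Laplacian is onto on polynomials; only a smooth preimage is recorded. -/
theorem exists_laplacian_eq_polyVal (p : MvPolynomial (Fin 2) ℝ) : ∃ Q : Plane → ℝ,
    ContDiff ℝ ∞ Q ∧ ∀ x, Laplacian.laplacian Q x = polyVal p x := by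
  induction p using MvPolynomial.induction_on' with
  | monomial s c =>
    obtain ⟨Q, hQ, hQ'⟩ := exists_laplacian_eq_monomial (s 1) (s 0) c
    refine ⟨Q, hQ, fun x => ?_⟩
    rw [hQ', polyVal, MvPolynomial.eval_monomial, Finsupp.prod_fintype _ _ (by simp),
      Fin.prod_univ_two]
  | add p q hp hq =>
    obtain ⟨P, hP, hP'⟩ := hp
    obtain ⟨Q, hQ, hQ'⟩ := hq
    refine ⟨P + Q, hP.add hQ, fun x => ?_⟩
    rw [ContDiffAt.laplacian_add (hP.contDiffAt.of_le (by norm_cast))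
        (hQ.contDiffAt.of_le (by norm_cast)), hP', hQ']
    simp [polyVal]

end PolynomialRHS

/-! ### Domains star-shaped with respect to a ball -/

section StarShaped

open Metric Filter Topology InnerProductSpace
open scoped NNReal

variable {E : Set Plane} {c : Plane} {r : ℝ}

/-- Move `x` slightly to a point of `E` and compensate in `y`: the ball leaves room for this, so
star-convexity extends to `x` in the closure while the combination still lands in `E`. -/
theorem combo_mem_of_starConvex (hs : ∀ y ∈ ball c r, StarConvex ℝ y E)
    {x y : Plane} (hx : x ∈ closure E) (hy : y ∈ ball c r) {α β : ℝ} (hα : 0 ≤ α) (hβ : 0 < β)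
    (hαβ : α + β = 1) : α • x + β • y ∈ E := by
  set z := α • x + β • y with hz
  have hcont : Tendsto (fun x' : Plane => β⁻¹ • (z - α • x')) (𝓝[E] x) (𝓝 y) := by
    have h1 : Continuous fun x' : Plane => β⁻¹ • (z - α • x') := by fun_prop
    have h2 : β⁻¹ • (z - α • x) = y := by
      rw [hz, add_sub_cancel_left, smul_smul, inv_mul_cancel₀ hβ.ne', one_smul]
    have h3 := h1.tendsto x
    rw [h2] at h3
    exact h3.mono_left nhdsWithin_le_nhds
  have hne : (𝓝[E] x).NeBot := mem_closure_iff_nhdsWithin_neBot.mp hx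
  obtain ⟨x', hx', hxE⟩ := ((hcont.eventually (isOpen_ball.mem_nhds hy)).and
    self_mem_nhdsWithin).exists
  have h := hs _ hx' hxE hβ.le hα (by linarith)
  rw [smul_smul, mul_inv_cancel₀ hβ.ne', one_smul, sub_add_cancel] at h
  exact h

theorem le_norm_sub_of_mem_frontier (hE : IsOpen E) (hr : ball c r ⊆ E) {z : Plane}
    (hz : z ∈ frontier E) : r ≤ ‖z - c‖ := by
  by_contra! h
  exact (hE.frontier_eq ▸ hz).2 (hr (by rwa [mem_ball, dist_eq_norm]))

/-- Exterior cone condition. -/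
theorem inner_sub_le_of_starConvex (hE : IsOpen E) (hs : ∀ y ∈ ball c r, StarConvex ℝ y E)
    (hr0 : 0 < r) (hr : ball c r ⊆ E) {D : ℝ} (hD : ∀ z ∈ closure E, ‖z - c‖ ≤ D) {x z : Plane}
    (hz : z ∈ frontier E) (hx : x ∈ closure E) :
    ⟪x - z, z - c⟫_ℝ ≤ (1 - r ^ 2 / (2 * D ^ 2)) * (‖x - z‖ * ‖z - c‖) := by
  have hzE : z ∉ E := (hE.frontier_eq ▸ hz).2
  have hrz := le_norm_sub_of_mem_frontier hE hr hz
  have hzD := hD z (frontier_subset_closure hz)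
  have hD0 : 0 < D := by linarith
  by_contra! h
  have hxz : x - z ≠ 0 := by
    intro h0
    simp [h0] at h
  have hn : 0 < ‖x - z‖ := norm_pos_iff.mpr hxz
  -- Prolong the segment from `x` beyond `z` by the length `‖z - c‖`. If the angle were too small,
  -- the end would lie in the ball, and `z`, lying strictly between it and `x`, would belong to `E`.
  set t := ‖z - c‖ / ‖x - z‖ with ht
  have ht0 : 0 < t := div_pos (by linarith) hn
  have htn : t * ‖x - z‖ = ‖z - c‖ := div_mul_cancel₀ _ hn.ne'
  apply hzE
  have hy : z - t • (x - z) ∈ ball c r := by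
    rw [mem_ball, dist_eq_norm, show z - t • (x - z) - c = (z - c) - t • (x - z) by abel]
    refine lt_of_pow_lt_pow_left₀ 2 hr0.le ?_
    rw [norm_sub_sq_real, norm_smul, real_inner_smul_right, Real.norm_of_nonneg ht0.le, htn,
      real_inner_comm]
    have h1 := mul_lt_mul_of_pos_left h ht0
    have h2 : t * ((1 - r ^ 2 / (2 * D ^ 2)) * (‖x - z‖ * ‖z - c‖)) =
        (1 - r ^ 2 / (2 * D ^ 2)) * ‖z - c‖ ^ 2 := by
      rw [← htn]; ring
    have h3 : r ^ 2 / (2 * D ^ 2) * ‖z - c‖ ^ 2 ≤ r ^ 2 / 2 := by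
      have : ‖z - c‖ ^ 2 ≤ D ^ 2 := by gcongr
      calc r ^ 2 / (2 * D ^ 2) * ‖z - c‖ ^ 2 ≤ r ^ 2 / (2 * D ^ 2) * D ^ 2 := by gcongr
        _ = r ^ 2 / 2 := by field_simp
    rw [h2] at h1
    nlinarith
  have h := combo_mem_of_starConvex hs hx hy (α := t / (1 + t)) (β := 1 / (1 + t))
    (by positivity) (by positivity) (by field_simp; ring)
  convert h using 1
  have h1 : (1 + t) ≠ 0 := by positivity
  have : z = (t / (1 + t) + 1 / (1 + t) * (1 + t) - t / (1 + t)) • z := by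
    rw [show t / (1 + t) + 1 / (1 + t) * (1 + t) - t / (1 + t) = 1 by field_simp; ring, one_smul]
  calc z = (t / (1 + t) + 1 / (1 + t) * (1 + t) - t / (1 + t)) • z := this
    _ = _ := by module

/-- The gauge of a set that is star-shaped with respect to `ball c r` is `1 / r`-Lipschitz. -/
theorem sub_le_of_mem_ray (hE : IsOpen E) (hs : ∀ y ∈ ball c r, StarConvex ℝ y E)
    (hr0 : 0 < r) {p q z z' : Plane} (hp : p ∈ frontier E)
    (hq : q ∈ frontier E) {α β : ℝ} (hα : 0 < α) (hβ : 0 < β) (hz : z - c = α • (p - c))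
    (hz' : z' - c = β • (q - c)) : β - α ≤ ‖z' - z‖ / r := by
  by_contra! h
  have hqE : q ∉ E := (hE.frontier_eq ▸ hq).2
  have hβα : 0 < β - α := lt_of_le_of_lt (by positivity) h
  apply hqE
  -- Otherwise `q` is a convex combination of the boundary point `p` and this point of the ball,
  -- with positive weight on the latter, which puts `q` in `E`. It is the subadditivity of the
  -- gauge.
  have hy : c + (β - α)⁻¹ • (z' - z) ∈ ball c r := by
    rw [mem_ball, dist_eq_norm, add_sub_cancel_left, norm_smul, norm_inv,
      Real.norm_of_nonneg hβα.le, inv_mul_lt_iff₀ hβα]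
    rwa [div_lt_iff₀ hr0] at h
  have h := combo_mem_of_starConvex hs (frontier_subset_closure hp) hy (α := α / β)
    (β := (β - α) / β) (by positivity) (by positivity) (by field_simp; ring)
  convert h using 1
  have e1 : z' - z = β • (q - c) - α • (p - c) := by rw [← hz, ← hz']; abel
  rw [e1, smul_add, smul_smul, show (β - α) / β * (β - α)⁻¹ = β⁻¹ by field_simp]
  have e2 : q = (β⁻¹ * β) • q := by rw [inv_mul_cancel₀ hβ.ne', one_smul]
  have e3 : c = (β⁻¹ * β) • c := by rw [inv_mul_cancel₀ hβ.ne', one_smul]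
  calc q = (β⁻¹ * β) • q + (c - (β⁻¹ * β) • c) := by rw [← e3, sub_self, add_zero, ← e2]
    _ = (β⁻¹ * β) • q + ((β⁻¹ * β) • c - (β⁻¹ * β) • c) := by rw [← e3]
    _ = _ := by simp only [div_eq_mul_inv]; module

/-- A connected segment from `c` to a point outside a bounding ball must cross the frontier. -/
theorem exists_frontier_mem_ray (hE : IsOpen E) (hb : Bornology.IsBounded E) (hc : c ∈ E)
    {z : Plane} (hz : z ≠ c) : ∃ p ∈ frontier E, ∃ α : ℝ, 0 < α ∧ z - c = α • (p - c) := by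
  have hzc : 0 < ‖z - c‖ := norm_pos_iff.mpr (sub_ne_zero.mpr hz)
  obtain ⟨R, hR⟩ := hb.subset_ball c
  have hRpos : 0 < R := pos_of_mem_ball (hR hc)
  let f : ℝ → Plane := fun t => c + t • (z - c)
  have hf : Continuous f := by fun_prop
  have hconn : IsPreconnected (f '' Icc 0 (R / ‖z - c‖)) :=
    isPreconnected_Icc.image f hf.continuousOn
  have h0 : f 0 ∈ E := by simpa [f] using hc
  have h1 : f (R / ‖z - c‖) ∉ E := by
    intro h
    have := hR h
    rw [mem_ball, dist_eq_norm] at this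
    simp only [f, add_sub_cancel_left, norm_smul] at this
    rw [Real.norm_of_nonneg (by positivity), div_mul_cancel₀ _ hzc.ne'] at this
    exact lt_irrefl _ this
  have hne : 0 ≤ R / ‖z - c‖ := by positivity
  obtain ⟨p, ⟨t, ht, rfl⟩, hp⟩ : (f '' Icc 0 (R / ‖z - c‖) ∩ frontier E).Nonempty := by
    by_contra hemp
    have hn : ∀ x ∈ f '' Icc 0 (R / ‖z - c‖), x ∉ E → x ∈ (closure E)ᶜ := fun x hx hxE hxc =>
      hemp ⟨x, hx, hE.frontier_eq ▸ ⟨hxc, hxE⟩⟩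
    obtain ⟨x, -, hxE, hxc⟩ := hconn E (closure E)ᶜ hE isClosed_closure.isOpen_compl
      (fun x hx => or_iff_not_imp_left.mpr (hn x hx)) ⟨f 0, ⟨0, ⟨le_rfl, hne⟩, rfl⟩, h0⟩
      ⟨_, ⟨_, ⟨hne, le_rfl⟩, rfl⟩, hn _ ⟨_, ⟨hne, le_rfl⟩, rfl⟩ h1⟩
    exact hxc (subset_closure hxE)
  have ht0 : 0 < t := by
    refine lt_of_le_of_ne ht.1 fun h => ?_
    exact (hE.frontier_eq ▸ hp).2 (h ▸ h0)
  refine ⟨_, hp, t⁻¹, inv_pos.mpr ht0, ?_⟩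
  simp only [f, add_sub_cancel_left, smul_smul, inv_mul_cancel₀ ht0.ne', one_smul]

/-- The radial projection onto the boundary is Lipschitz away from `c`, because it divides by a
gauge that is Lipschitz and at least `r / (2 * D)` there. The case `z = z'` shows that a ray meets
the boundary only once. -/
theorem norm_sub_le_of_mem_ray (hE : IsOpen E) (hs : ∀ y ∈ ball c r, StarConvex ℝ y E)
    (hr0 : 0 < r) (hr : ball c r ⊆ E) {D : ℝ} (hD : ∀ z ∈ closure E, ‖z - c‖ ≤ D)
    {p q z z' : Plane} (hp : p ∈ frontier E)
    (hq : q ∈ frontier E) {α β : ℝ} (hα : 0 < α) (hβ : 0 < β) (hz : z - c = α • (p - c))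
    (hz' : z' - c = β • (q - c)) (hrz : r / 2 ≤ ‖z - c‖) :
    ‖p - q‖ ≤ (1 + D / r) * (2 * D / r) * ‖z - z'‖ := by
  have h1 := sub_le_of_mem_ray hE hs hr0 hp hq hα hβ hz hz'
  have h2 := sub_le_of_mem_ray hE hs hr0 hq hp hβ hα hz' hz
  rw [norm_sub_rev z' z] at h1
  have hpD := hD p (frontier_subset_closure hp)
  have hqD := hD q (frontier_subset_closure hq)
  have hrp := le_norm_sub_of_mem_frontier hE hr hp
  have hD0 : 0 < D := by linarith
  have hβα : |β - α| ≤ ‖z - z'‖ / r := abs_le.mpr ⟨by linarith, h1⟩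
  have hαl : r / (2 * D) ≤ α := by
    rw [hz, norm_smul, Real.norm_of_nonneg hα.le] at hrz
    rw [div_le_iff₀ (by positivity)]
    nlinarith
  have e : α • (p - q) = (z - z') + (β - α) • (q - c) := by
    rw [sub_smul, ← hz', show z - z' + (z' - c - α • (q - c)) = (z - c) - α • (q - c) by abel, hz]
    module
  have h3 : α * ‖p - q‖ ≤ ‖z - z'‖ + ‖z - z'‖ / r * D := by
    rw [← Real.norm_of_nonneg hα.le, ← norm_smul, e]
    refine (norm_add_le _ _).trans ?_
    rw [norm_smul, Real.norm_eq_abs]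
    gcongr
  have h4 : r / (2 * D) * ‖p - q‖ ≤ ‖z - z'‖ + ‖z - z'‖ / r * D :=
    (mul_le_mul_of_nonneg_right hαl (norm_nonneg _)).trans h3
  have h5 := mul_le_mul_of_nonneg_left h4 (show 0 ≤ 2 * D / r by positivity)
  calc ‖p - q‖ = 2 * D / r * (r / (2 * D) * ‖p - q‖) := by field_simp
    _ ≤ _ := h5
    _ = _ := by ring

/-! ### Gluing Lipschitz estimates along the boundary. -/

/-- A function that is Lipschitz on each set of a finite closed cover of an interval is Lipschitz
on the interval. -/
theorem abs_sub_le_of_closed_cover {ι : Type*} [DecidableEq ι] {A : ι → Set ℝ}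
    (hA : ∀ i, IsClosed (A i)) {f : ℝ → ℝ} {L : ℝ}
    (hf : ∀ i, ∀ s ∈ A i, ∀ t ∈ A i, |f s - f t| ≤ L * |s - t|) (S : Finset ι) {x y : ℝ}
    (hxy : x ≤ y) (hS : Icc x y ⊆ ⋃ i ∈ S, A i) : |f x - f y| ≤ L * |x - y| := by
  induction S using Finset.strongInduction generalizing x with
  | H S ih =>
    obtain ⟨i, hi, hxi⟩ : ∃ i ∈ S, x ∈ A i := by simpa using hS (left_mem_Icc.mpr hxy)
    have hcomp : IsCompact (A i ∩ Icc x y) := isCompact_Icc.inter_left (hA i)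
    obtain ⟨x₁, ⟨hx₁i, hx₁⟩, hmax⟩ :=
      hcomp.exists_isGreatest ⟨x, hxi, left_mem_Icc.mpr hxy⟩
    rcases hx₁.2.eq_or_lt with h | h
    · exact hf i x hxi y (h ▸ hx₁i)
    · have hsub : Icc x₁ y ⊆ ⋃ j ∈ S.erase i, A j := by
        rw [← closure_Ioc h.ne]
        refine closure_minimal (fun t ht => ?_) (isClosed_biUnion_finset fun j _ => hA j)
        obtain ⟨j, hj, htj⟩ : ∃ j ∈ S, t ∈ A j := by
          simpa using hS ⟨hx₁.1.trans ht.1.le, ht.2⟩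
        have hji : j ≠ i := by
          rintro rfl
          exact absurd (hmax ⟨htj, hx₁.1.trans ht.1.le, ht.2⟩) (not_le.mpr ht.1)
        simp only [mem_iUnion]
        exact ⟨j, Finset.mem_erase.mpr ⟨hji, hj⟩, htj⟩
      have h1 := ih _ (Finset.erase_ssubset hi) h.le hsub
      have h2 := hf i x hxi x₁ hx₁i
      calc |f x - f y| ≤ |f x - f x₁| + |f x₁ - f y| := abs_sub_le _ _ _
        _ ≤ L * |x - x₁| + L * |x₁ - y| := add_le_add h2 h1
        _ = L * |x - y| := by
          rw [abs_of_nonpos (by linarith [hx₁.1]), abs_of_nonpos (by linarith),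
            abs_of_nonpos (by linarith)]
          ring

/-- On the frontier of a bounded open set that is star-shaped with respect to a ball, a function
that is Lipschitz on each set of a finite closed cover is Lipschitz. -/
theorem exists_lipschitz_of_closed_cover (hE : IsOpen E) (hb : Bornology.IsBounded E)
    (hs : ∀ y ∈ ball c r, StarConvex ℝ y E) (hr0 : 0 < r) (hr : ball c r ⊆ E)
    {ι : Type*} [Fintype ι] {A : ι → Set Plane} (hA : ∀ i, IsClosed (A i))
    (hcov : frontier E ⊆ ⋃ i, A i) {g : Plane → ℝ} {L : ℝ} (hL : 0 ≤ L)
    (hg : ∀ i, ∀ x ∈ A i, ∀ y ∈ A i, |g x - g y| ≤ L * ‖x - y‖) {M : ℝ}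
    (hM : ∀ x ∈ frontier E, |g x| ≤ M) :
    ∃ C : ℝ, 0 ≤ C ∧ ∀ x ∈ frontier E, ∀ y ∈ frontier E, |g x - g y| ≤ C * ‖x - y‖ := by
  classical
  obtain ⟨D, hD⟩ : ∃ D, ∀ z ∈ closure E, ‖z - c‖ ≤ D := by
    obtain ⟨R, hR⟩ := hb.closure.subset_closedBall c
    exact ⟨R, fun z hz => by simpa [dist_eq_norm] using hR hz⟩
  have hcE : c ∈ E := hr (mem_ball_self hr0)
  have hD0 : 0 ≤ D := (norm_nonneg _).trans (hD c (subset_closure hcE))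
  set C₁ := (1 + D / r) * (2 * D / r) with hC₁
  have hC₁0 : 0 ≤ C₁ := by positivity
  refine ⟨max (L * C₁) (2 * M / r), le_max_of_le_left (by positivity), fun x hx y hy => ?_⟩
  rcases le_or_gt r ‖x - y‖ with hxy | hxy
  · have hM0 : 0 ≤ M := (abs_nonneg _).trans (hM x hx)
    calc |g x - g y| ≤ |g x| + |g y| := abs_sub _ _
      _ ≤ 2 * M := by linarith [hM x hx, hM y hy]
      _ = 2 * M / r * r := by field_simp
      _ ≤ 2 * M / r * ‖x - y‖ := by gcongr
      _ ≤ _ := by gcongr; exact le_max_right _ _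
  -- For nearby points, the chord is projected radially to a path `p` in the boundary. The path has
  -- speed at most a multiple of `‖x - y‖` and may pass from one set of the cover to another. The
  -- chord stays `r / 2` away from `c`, since each of its points is within `r / 2` of an endpoint.
  · set z : ℝ → Plane := fun t => AffineMap.lineMap x y t with hz
    have hzz : ∀ s t, ‖z s - z t‖ = |s - t| * ‖x - y‖ := fun s t => by
      rw [← dist_eq_norm, ← dist_eq_norm, hz]
      simp only [dist_lineMap_lineMap, Real.dist_eq]
    have hzr : ∀ t ∈ Icc (0 : ℝ) 1, r / 2 ≤ ‖z t - c‖ := by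
      intro t ht
      have hx' := le_norm_sub_of_mem_frontier hE hr hx
      have hy' := le_norm_sub_of_mem_frontier hE hr hy
      have h0 : ‖z 0 - z t‖ = t * ‖x - y‖ := by rw [hzz, zero_sub, abs_neg, abs_of_nonneg ht.1]
      have h1 : ‖z 1 - z t‖ = (1 - t) * ‖x - y‖ := by
        rw [hzz, abs_of_nonneg (by linarith [ht.2])]
      have h0' : z 0 = x := by simp [hz]
      have h1' : z 1 = y := by simp [hz]
      rw [h0'] at h0
      rw [h1'] at h1
      have e0 : ‖x - c‖ ≤ ‖x - z t‖ + ‖z t - c‖ := norm_sub_le_norm_sub_add_norm_sub _ _ _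
      have e1 : ‖y - c‖ ≤ ‖y - z t‖ + ‖z t - c‖ := norm_sub_le_norm_sub_add_norm_sub _ _ _
      nlinarith [ht.1, ht.2]
    have hex : ∀ t : ℝ, ∃ p ∈ frontier E, t ∈ Icc (0 : ℝ) 1 →
        ∃ α : ℝ, 0 < α ∧ z t - c = α • (p - c) := by
      intro t
      by_cases ht : t ∈ Icc (0 : ℝ) 1
      · have : z t ≠ c := fun h => by
          have := hzr t ht
          rw [h, sub_self, norm_zero] at this
          linarith
        obtain ⟨p, hp, hα⟩ := exists_frontier_mem_ray hE hb hcE this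
        exact ⟨p, hp, fun _ => hα⟩
      · exact ⟨x, hx, fun h => absurd h ht⟩
    choose p hp hpα using hex
    have hpp : ∀ s ∈ Icc (0 : ℝ) 1, ∀ t ∈ Icc (0 : ℝ) 1,
        ‖p s - p t‖ ≤ C₁ * ‖x - y‖ * |s - t| := by
      intro s hs' t ht
      obtain ⟨α, hα, hαe⟩ := hpα s hs'
      obtain ⟨β, hβ, hβe⟩ := hpα t ht
      have := norm_sub_le_of_mem_ray hE hs hr0 hr hD (hp s) (hp t) hα hβ hαe hβe (hzr s hs')
      rw [hzz] at this
      linarith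
    have hend : ∀ t ∈ Icc (0 : ℝ) 1, z t ∈ frontier E → p t = z t := by
      intro t ht hzt
      obtain ⟨α, hα, hαe⟩ := hpα t ht
      have := norm_sub_le_of_mem_ray hE hs hr0 hr hD (hp t) hzt hα one_pos hαe (one_smul _ _).symm
        (hzr t ht)
      simpa [sub_eq_zero] using this
    have hpc : ContinuousOn p (Icc 0 1) := by
      have : LipschitzOnWith (C₁ * ‖x - y‖).toNNReal p (Icc 0 1) := by
        refine LipschitzOnWith.of_dist_le_mul fun s hs' t ht => ?_
        rw [Real.coe_toNNReal _ (by positivity), dist_eq_norm, Real.dist_eq]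
        exact hpp s hs' t ht
      exact this.continuousOn
    have key := abs_sub_le_of_closed_cover (A := fun i => Icc 0 1 ∩ p ⁻¹' A i)
      (fun i => hpc.preimage_isClosed_of_isClosed isClosed_Icc (hA i)) (f := fun t => g (p t))
      (L := L * (C₁ * ‖x - y‖)) (fun i s hs' t ht => by
        refine (hg i _ hs'.2 _ ht.2).trans ?_
        rw [mul_assoc]
        exact mul_le_mul_of_nonneg_left (hpp s hs'.1 t ht.1) hL) Finset.univ (x := 0) (y := 1)
      zero_le_one (fun t ht => by
        obtain ⟨i, hi⟩ := mem_iUnion.mp (hcov (hp t))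
        simp only [mem_iUnion]
        exact ⟨i, Finset.mem_univ _, ht, hi⟩)
    have h0' : p 0 = x := by
      rw [hend 0 (by simp) (by simpa [hz] using hx)]; simp [hz]
    have h1' : p 1 = y := by
      rw [hend 1 (by simp) (by simpa [hz] using hy)]; simp [hz]
    rw [h0', h1'] at key
    calc |g x - g y| ≤ L * C₁ * ‖x - y‖ := by
          refine key.trans_eq ?_
          norm_num
          ring
      _ ≤ _ := by gcongr; exact le_max_left _ _

end StarShaped

/-! ### The Dirichlet problem with Lipschitz data -/

section Dirichlet

open Metric Filter Topology InnerProductSpace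
open scoped NNReal ComplexConjugate

theorem Real.abs_sqrt_sub_sqrt_le_sqrt_abs {x y : ℝ} (hx : 0 ≤ x) (hy : 0 ≤ y) :
    |√x - √y| ≤ √|x - y| := by
  rw [← Real.sqrt_sq_eq_abs (√x - √y)]
  refine Real.sqrt_le_sqrt ?_
  have h1 : |x - y| = |√x - √y| * (√x + √y) := by
    rw [← abs_of_nonneg (show 0 ≤ √x + √y by positivity), ← abs_mul]
    congr 1
    linear_combination -(Real.sq_sqrt hx) + Real.sq_sqrt hy
  rw [h1, ← sq_abs, sq]
  refine mul_le_mul_of_nonneg_left ?_ (abs_nonneg _)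
  exact abs_le.mpr ⟨by linarith [Real.sqrt_nonneg x], by linarith [Real.sqrt_nonneg y]⟩

/-- The real part of the principal square root. -/
def reSqrt (w : ℂ) : ℝ := √((‖w‖ + w.re) / 2)

theorem norm_add_re_nonneg (w : ℂ) : 0 ≤ (‖w‖ + w.re) / 2 := by
  have := (abs_le.mp (Complex.abs_re_le_norm w)).1
  linarith

/-- The formula for `reSqrt` is continuous on the whole plane, also across the branch cut, so the
barriers have one global modulus of continuity. -/
theorem abs_reSqrt_sub_le (w w' : ℂ) : |reSqrt w - reSqrt w'| ≤ √‖w - w'‖ := by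
  refine (Real.abs_sqrt_sub_sqrt_le_sqrt_abs (norm_add_re_nonneg w) (norm_add_re_nonneg w')).trans
    (Real.sqrt_le_sqrt ?_)
  have h1 := abs_norm_sub_norm_le w w'
  have h2 := Complex.abs_re_le_norm (w - w')
  rw [Complex.sub_re] at h2
  rw [abs_le] at *
  constructor <;> linarith [h1.1, h1.2, h2.1, h2.2]

theorem harmonicAt_reSqrt {f : ℂ → ℂ} {x : ℂ} (hf : AnalyticAt ℂ f x)
    (hx : f x ∈ Complex.slitPlane) : HarmonicAt (fun y => reSqrt (f y)) x := by
  have h : AnalyticAt ℂ (fun y => f y ^ (2⁻¹ : ℂ)) x := hf.cpow analyticAt_const hx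
  have h2 := h.harmonicAt_re
  simpa only [reSqrt, Complex.cpow_inv_two_re] using h2

variable {E : Set Plane} {c : Plane} {r : ℝ}

/-- The exterior cone keeps the argument of the square root away from the branch cut by a uniform
angle. The real part of the root is then harmonic in `E` and bounded below by a multiple of `√‖x -
z‖`, which dominates `‖x - z‖` on a bounded set. -/
theorem exists_harmonic_of_lipschitz (hE : IsOpen E) (hb : Bornology.IsBounded E)
    (hs : ∀ y ∈ ball c r, StarConvex ℝ y E) (hr0 : 0 < r) (hr : ball c r ⊆ E)
    {G : Plane → ℝ} {L : ℝ} (hL : 0 ≤ L)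
    (hG : ∀ x ∈ frontier E, ∀ y ∈ frontier E, |G x - G y| ≤ L * ‖x - y‖) :
    ∃ u : Plane → ℝ, ContinuousOn u (closure E) ∧ HarmonicOnNhd u E ∧
      ∀ x ∈ frontier E, u x = G x := by
  obtain ⟨D, hD⟩ : ∃ D, ∀ z ∈ closure E, ‖z - c‖ ≤ D := by
    obtain ⟨R, hR⟩ := hb.closure.subset_closedBall c
    exact ⟨R, fun z hz => by simpa [dist_eq_norm] using hR hz⟩
  have hD0 : 0 ≤ D := (norm_nonneg _).trans (hD c (subset_closure (hr (mem_ball_self hr0))))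
  set U : Set ℂ := toC '' E with hU
  have hUo : IsOpen U := toC.toHomeomorph.isOpenMap _ hE
  have hUc : closure U = toC '' closure E := (toC.toHomeomorph.image_closure E).symm
  have hUf : frontier U = toC '' frontier E := (toC.toHomeomorph.image_frontier E).symm
  have hUb : Bornology.IsBounded U := toC.lipschitz.isBounded_image hb
  set κ := r ^ 2 / (2 * D ^ 2) with hκ
  -- Multiplication by the conjugate of `z - c` rotates the inward direction at `z` to the positive
  -- real axis, so the principal branch serves every boundary point.
  let w : ℂ → ℂ → ℂ := fun z x => conj (z - toC c) * (z - x)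
  have hwre : ∀ z x : Plane, (w (toC z) (toC x)).re = - ⟪x - z, z - c⟫_ℝ := by
    intro z x
    have h1 : (w (toC z) (toC x)).re = ⟪toC z - toC c, toC z - toC x⟫_ℝ := by
      rw [Complex.inner, mul_comm]
    rw [h1, ← map_sub, ← map_sub, toC.inner_map_map, real_inner_comm, ← inner_neg_left, neg_sub]
  have hwn : ∀ z x : Plane, ‖w (toC z) (toC x)‖ = ‖x - z‖ * ‖z - c‖ := by
    intro z x
    simp only [w, norm_mul, RCLike.norm_conj]
    rw [← map_sub, ← map_sub, toC.norm_map, toC.norm_map, norm_sub_rev z x, mul_comm]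
  have hrf : ∀ z ∈ frontier E, r ≤ ‖z - c‖ := fun z hz => le_norm_sub_of_mem_frontier hE hr hz
  have hcone : ∀ z ∈ frontier E, ∀ x ∈ closure E,
      κ * (‖x - z‖ * ‖z - c‖) ≤ ‖w (toC z) (toC x)‖ + (w (toC z) (toC x)).re := by
    intro z hz x hx
    have h := inner_sub_le_of_starConvex hE hs hr0 hr hD hz hx
    rw [hwre, hwn]
    linarith
  have hDpos : (frontier E).Nonempty → 0 < D := by
    rintro ⟨z, hz⟩
    have := hrf z hz
    have := hD z (frontier_subset_closure hz)
    linarith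
  have hdist : ∀ x ∈ frontier E, ∀ z ∈ frontier E, ‖x - z‖ ≤ 2 * D := by
    intro x hx z hz
    have h1 := hD x (frontier_subset_closure hx)
    have h2 := hD z (frontier_subset_closure hz)
    have h3 : ‖x - z‖ ≤ ‖x - c‖ + ‖z - c‖ := by
      rw [show x - z = (x - c) - (z - c) by abel]; exact norm_sub_le _ _
    linarith
  obtain ⟨u, hu, hug⟩ := exists_dirichlet (U := U) (g := fun x => G (toC.symm x))
    (b := fun z x => reSqrt (w z x)) (ρ := fun d => √(D * d))
    (C := L * √(2 * D) * (√(κ * r / 2))⁻¹) hUo hUb (by positivity) (by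
      rcases (frontier E).eq_empty_or_nonempty with he | ⟨z₀, hz₀⟩
      · exact ⟨0, by simp [hUf, he]⟩
      · refine ⟨|G z₀| + L * (2 * D), fun x hx => ?_⟩
        rw [hUf] at hx
        obtain ⟨x, hx, rfl⟩ := hx
        simp only [LinearIsometryEquiv.symm_apply_apply]
        have h1 := hG x hx z₀ hz₀
        have h2 := mul_le_mul_of_nonneg_left (hdist x hx z₀ hz₀) hL
        have h3 := abs_sub_abs_le_abs_sub (G x) (G z₀)
        linarith) (by
      have : Continuous fun d : ℝ => √(D * d) := by fun_prop
      have h := this.tendsto 0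
      simp only [mul_zero, Real.sqrt_zero] at h
      exact h.mono_left nhdsWithin_le_nhds) (by
      intro z hz x y
      rw [hUf] at hz
      obtain ⟨z, hz, rfl⟩ := hz
      refine (abs_reSqrt_sub_le _ _).trans (Real.sqrt_le_sqrt ?_)
      rw [← mul_sub, norm_mul, RCLike.norm_conj, ← map_sub, toC.norm_map, sub_sub_sub_cancel_left,
        dist_comm, dist_eq_norm]
      exact mul_le_mul_of_nonneg_right (hD z (frontier_subset_closure hz)) (norm_nonneg _))
    (fun z _ => by simp [w, reSqrt]) (fun z _ x => Real.sqrt_nonneg _) (by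
      intro z hz x hx
      rw [hUf] at hz
      obtain ⟨z, hz, rfl⟩ := hz
      obtain ⟨x, hx, rfl⟩ := hx
      refine harmonicAt_reSqrt ?_ ?_
      · exact analyticAt_const.mul (analyticAt_const.sub analyticAt_id)
      · have h := hcone z hz x (subset_closure hx)
        have hxz : 0 < ‖x - z‖ := by
          rw [norm_pos_iff, sub_ne_zero]
          rintro rfl
          exact (hE.frontier_eq ▸ hz).2 hx
        have h0 := hrf z hz
        have hD' := hDpos ⟨z, hz⟩
        have h1 : 0 < κ * (‖x - z‖ * ‖z - c‖) := by
          have : 0 < ‖z - c‖ := hr0.trans_le h0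
          positivity
        rw [Complex.mem_slitPlane_iff]
        -- On the branch cut the modulus is minus the real part, which contradicts the positive
        -- lower bound given by the cone condition.
        by_contra! hn
        have h2 : ‖w (toC z) (toC x)‖ = - (w (toC z) (toC x)).re := by
          rw [← abs_of_nonpos hn.1]
          exact (Complex.abs_re_eq_norm.mpr hn.2).symm
        linarith) (by
      intro z hz x hx
      rw [hUf] at hz hx
      obtain ⟨z, hz, rfl⟩ := hz
      obtain ⟨x, hx, rfl⟩ := hx
      simp only [LinearIsometryEquiv.symm_apply_apply]
      have hD' := hDpos ⟨z, hz⟩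
      have h1 : √(κ * r / 2) * √‖x - z‖ ≤ reSqrt (w (toC z) (toC x)) := by
        rw [← Real.sqrt_mul (by positivity)]
        refine Real.sqrt_le_sqrt ?_
        have h2 := hcone z hz x (frontier_subset_closure hx)
        have h3 : κ * (‖x - z‖ * r) ≤ κ * (‖x - z‖ * ‖z - c‖) := by
          gcongr
          exact hrf z hz
        linarith
      have hpos : 0 < √(κ * r / 2) := Real.sqrt_pos.mpr (by positivity)
      calc |G x - G z| ≤ L * ‖x - z‖ := hG x hx z hz
        _ = L * (√‖x - z‖ * √‖x - z‖) := by rw [Real.mul_self_sqrt (norm_nonneg _)]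
        _ ≤ L * (√(2 * D) * √‖x - z‖) := by
          gcongr
          exact hdist x hx z hz
        _ = L * √(2 * D) * (√(κ * r / 2))⁻¹ * (√(κ * r / 2) * √‖x - z‖) := by field_simp
        _ ≤ _ := by gcongr)
  refine ⟨u ∘ toC, ?_, ?_, ?_⟩
  · refine hu.2.comp toC.continuous.continuousOn fun x hx => ?_
    rw [hUc]
    exact mem_image_of_mem _ hx
  · exact fun x hx => harmonicAt_comp_toC (hu.1 _ (mem_image_of_mem _ hx))
  · intro x hx
    have := hug (toC x) (hUf ▸ mem_image_of_mem _ hx)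
    simpa using this

end Dirichlet

/-! ### Boundary data on the edges -/

section Curve

open Filter Topology

/-- A regular injective `C¹` curve is expanding up to a constant. -/
theorem exists_abs_sub_le_of_regular {γ : ℝ → Plane} {a b : ℝ} (hab : a < b)
    (hγ : ContDiffOn ℝ 1 γ (Icc a b)) (hreg : ∀ t ∈ Icc a b, derivWithin γ (Icc a b) t ≠ 0)
    (hinj : InjOn γ (Icc a b)) :
    ∃ C : ℝ, 0 ≤ C ∧ ∀ s ∈ Icc a b, ∀ t ∈ Icc a b, |s - t| ≤ C * ‖γ s - γ t‖ := by
  have hd : ContinuousOn (derivWithin γ (Icc a b)) (Icc a b) :=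
    hγ.continuousOn_derivWithin (uniqueDiffOn_Icc hab) le_rfl
  -- The derivative is extended by its endpoint values to the whole line, and `Γ` is the resulting
  -- `C¹` curve agreeing with `γ` on `[a, b]`.
  set d : ℝ → Plane :=
    IccExtend hab.le ((Icc a b).domRestrict (derivWithin γ (Icc a b))) with hd_def
  have hdc : Continuous d := hd.domRestrict.Icc_extend'
  have hdeq : ∀ t ∈ Icc a b, d t = derivWithin γ (Icc a b) t := fun t ht => by
    rw [hd_def, IccExtend_of_mem _ _ ht]; rfl
  let Γ : ℝ → Plane := fun t => γ a + ∫ τ in a..t, d τ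
  have hΓd : ∀ t, HasDerivAt Γ (d t) t := fun t =>
    (intervalIntegral.integral_hasDerivAt_right (hdc.intervalIntegrable _ _)
      (hdc.stronglyMeasurableAtFilter _ _) hdc.continuousAt).const_add _
  have hΓ : ∀ t ∈ Icc a b, Γ t = γ t := by
    intro t ht
    have h := intervalIntegral.integral_eq_sub_of_hasDeriv_right_of_le (f := γ) (f' := d) ht.1
      (hγ.continuousOn.mono (Icc_subset_Icc_right ht.2)) (fun x hx => by
        have hx' : x ∈ Ioo a b := ⟨hx.1, hx.2.trans_le ht.2⟩
        have h1 := ((hγ.differentiableOn one_ne_zero) x (Ioo_subset_Icc_self hx')).hasDerivWithinAt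
        rw [← hdeq x (Ioo_subset_Icc_self hx')] at h1
        exact (h1.hasDerivAt (Icc_mem_nhds hx'.1 hx'.2)).hasDerivWithinAt)
      (hdc.intervalIntegrable _ _)
    simp only [Γ, h]
    abel
  -- The divided difference of the curve, continuous up to the diagonal. It is nonzero on the
  -- diagonal by regularity and off it by injectivity, so its norm has a positive minimum on the
  -- compact square.
  let Φ : ℝ × ℝ → Plane := fun p => ∫ τ in (0 : ℝ)..1, d (p.1 + τ * (p.2 - p.1))
  have hΦc : Continuous Φ :=
    intervalIntegral.continuous_parametric_intervalIntegral_of_continuous' (by fun_prop) _ _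
  have hΦ : ∀ s t, Γ t - Γ s = (t - s) • Φ (s, t) := by
    intro s t
    have h1 : Γ t - Γ s = ∫ τ in s..t, d τ :=
      (intervalIntegral.integral_eq_sub_of_hasDerivAt (fun x _ => hΓd x)
        (hdc.intervalIntegrable _ _)).symm
    have h2 := intervalIntegral.smul_integral_comp_add_mul (a := 0) (b := 1) d (t - s) s
    simp only [mul_zero, add_zero, mul_one, add_sub_cancel] at h2
    rw [h1, ← h2]
    simp only [Φ, mul_comm]
  have hΦ0 : ∀ p ∈ Icc a b ×ˢ Icc a b, Φ p ≠ 0 := by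
    rintro ⟨s, t⟩ ⟨hs, ht⟩ h0
    by_cases hst : s = t
    · subst hst
      apply hreg s hs
      rw [← hdeq s hs]
      simpa [Φ] using h0
    · have h := hΦ s t
      rw [h0, smul_zero, hΓ s hs, hΓ t ht, sub_eq_zero] at h
      exact hst (hinj hs ht h.symm)
  have hcomp : IsCompact (Icc a b ×ˢ Icc a b) := isCompact_Icc.prod isCompact_Icc
  obtain ⟨p₀, hp₀, hmin⟩ := hcomp.exists_isMinOn
    ⟨(a, a), ⟨left_mem_Icc.mpr hab.le, left_mem_Icc.mpr hab.le⟩⟩ hΦc.norm.continuousOn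
  have hpos : 0 < ‖Φ p₀‖ := norm_pos_iff.mpr (hΦ0 p₀ hp₀)
  refine ⟨‖Φ p₀‖⁻¹, by positivity, fun s hs t ht => ?_⟩
  have h1 : ‖Φ p₀‖ ≤ ‖Φ (t, s)‖ := hmin (show (t, s) ∈ Icc a b ×ˢ Icc a b from ⟨ht, hs⟩)
  rw [← hΓ s hs, ← hΓ t ht, hΦ t s, norm_smul, Real.norm_eq_abs]
  rw [le_inv_mul_iff₀ hpos, mul_comm]
  gcongr

end Curve

namespace CurvedElement

variable {N : ℕ} [NeZero N] {m : ℕ} (K : CurvedElement N m)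

/-- The parametrization of the edge `i` on `[0, 1]`. -/
def edgeMap (i : Fin N) : ℝ → Plane :=
  if i = 0 then fun t => K.γ (onInterval K.a K.b t)
  else fun t => AffineMap.lineMap (K.vertex i) (K.vertex (i + 1)) t

theorem edgeMap_zero_apply (t : ℝ) : K.edgeMap 0 t = K.γ (onInterval K.a K.b t) := by
  simp [edgeMap]

theorem edgeMap_of_ne {i : Fin N} (hi : i ≠ 0) (t : ℝ) :
    K.edgeMap i t = AffineMap.lineMap (K.vertex i) (K.vertex (i + 1)) t := by
  simp [edgeMap, hi]

theorem edgeMap_left (i : Fin N) : K.edgeMap i 0 = K.vertex i := by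
  by_cases hi : i = 0
  · subst hi
    rw [edgeMap_zero_apply, onInterval, zero_mul, add_zero, K.γ_left]
  · rw [K.edgeMap_of_ne hi, AffineMap.lineMap_apply_zero]

theorem edgeMap_right (i : Fin N) : K.edgeMap i 1 = K.vertex (i + 1) := by
  by_cases hi : i = 0
  · subst hi
    rw [edgeMap_zero_apply, onInterval, one_mul, add_sub_cancel, K.γ_right, zero_add]
  · rw [K.edgeMap_of_ne hi, AffineMap.lineMap_apply_one]

theorem onInterval_image {a b : ℝ} (hab : a < b) : onInterval a b '' Icc 0 1 = Icc a b := by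
  have h0 : 0 < b - a := sub_pos.mpr hab
  ext x
  constructor
  · rintro ⟨t, ht, rfl⟩
    simp only [onInterval]
    constructor <;> nlinarith [ht.1, ht.2]
  · intro hx
    refine ⟨(x - a) / (b - a), ⟨div_nonneg (by linarith [hx.1]) h0.le, ?_⟩, ?_⟩
    · rw [div_le_one h0]; linarith [hx.2]
    · simp only [onInterval]; rw [div_mul_cancel₀ _ h0.ne']; ring

theorem edgeMap_image (i : Fin N) : K.edgeMap i '' Icc 0 1 =
    if i = 0 then K.γ '' Icc K.a K.b else segment ℝ (K.vertex i) (K.vertex (i + 1)) := by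
  split_ifs with hi
  · subst hi
    rw [← onInterval_image K.a_lt_b, image_image]
    exact image_congr fun t _ => K.edgeMap_zero_apply t
  · rw [segment_eq_image_lineMap]
    exact image_congr fun t _ => K.edgeMap_of_ne hi t

theorem frontier_eq_iUnion_edgeMap : frontier K.E = ⋃ i, K.edgeMap i '' Icc 0 1 := by
  rw [K.frontier_eq]
  exact iUnion_congr fun i => (K.edgeMap_image i).symm

theorem edgeMap_mem_frontier (i : Fin N) {t : ℝ} (ht : t ∈ Icc (0 : ℝ) 1) :
    K.edgeMap i t ∈ frontier K.E := by
  rw [K.frontier_eq_iUnion_edgeMap]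
  exact mem_iUnion.mpr ⟨i, t, ht, rfl⟩

theorem edgeMap_inter {i j : Fin N} (hij : i ≠ j) {x : Plane} (hi : x ∈ K.edgeMap i '' Icc 0 1)
    (hj : x ∈ K.edgeMap j '' Icc 0 1) :
    x ∈ ({K.vertex i, K.vertex (i + 1)} ∩ {K.vertex j, K.vertex (j + 1)} : Set Plane) := by
  rw [edgeMap_image] at hi hj
  exact K.edge_inter i j hij ⟨hi, hj⟩

theorem continuousOn_edgeMap (i : Fin N) : ContinuousOn (K.edgeMap i) (Icc 0 1) := by
  by_cases hi : i = 0
  · subst hi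
    refine ContinuousOn.congr ?_ fun t _ => K.edgeMap_zero_apply t
    refine K.γ_contDiffOn.continuousOn.comp ?_ fun t ht => ?_
    · unfold onInterval; fun_prop
    · rw [← onInterval_image K.a_lt_b]; exact mem_image_of_mem _ ht
  · refine ContinuousOn.congr ?_ fun t _ => K.edgeMap_of_ne hi t
    exact AffineMap.lineMap_continuous.continuousOn

theorem exists_abs_sub_le_edgeMap (i : Fin N) : ∃ C : ℝ, 0 ≤ C ∧
    ∀ s ∈ Icc (0 : ℝ) 1, ∀ t ∈ Icc (0 : ℝ) 1, |s - t| ≤ C * ‖K.edgeMap i s - K.edgeMap i t‖ := by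
  by_cases hi : i = 0
  · subst hi
    obtain ⟨C, hC, h⟩ := exists_abs_sub_le_of_regular K.a_lt_b
      (K.γ_contDiffOn.of_le (by exact_mod_cast Nat.le_add_left 1 m)) K.γ_regular K.γ_injOn
    have h0 : 0 < K.b - K.a := sub_pos.mpr K.a_lt_b
    refine ⟨C / (K.b - K.a), by positivity, fun s hs t ht => ?_⟩
    have h1 := h (onInterval K.a K.b s) (onInterval_image K.a_lt_b ▸ mem_image_of_mem _ hs)
      (onInterval K.a K.b t) (onInterval_image K.a_lt_b ▸ mem_image_of_mem _ ht)
    rw [edgeMap_zero_apply, edgeMap_zero_apply, div_mul_eq_mul_div, le_div_iff₀ h0]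
    refine le_trans (le_of_eq ?_) h1
    simp only [onInterval]
    rw [add_sub_add_left_eq_sub, ← sub_mul, abs_mul, abs_of_pos h0]
  -- Equality would force `i + 1 = i`, hence `N = 1`, and then the only edge would be the curved
  -- one.
  · have hne : K.vertex i ≠ K.vertex (i + 1) := by
      intro h
      have h1 := K.vertex_injective h
      rw [left_eq_add] at h1
      have hN : Subsingleton (Fin N) := by
        rcases N with _ | _ | n
        · infer_instance
        · exact ⟨fun x y => Fin.ext (by omega)⟩
        · exact absurd h1 (by simp)
      exact hi (Subsingleton.elim _ _)
    have h0 : 0 < dist (K.vertex i) (K.vertex (i + 1)) := dist_pos.mpr hne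
    refine ⟨(dist (K.vertex i) (K.vertex (i + 1)))⁻¹, by positivity, fun s _ t _ => ?_⟩
    rw [K.edgeMap_of_ne hi, K.edgeMap_of_ne hi, ← dist_eq_norm, dist_lineMap_lineMap, Real.dist_eq,
      mul_comm |s - t|, inv_mul_cancel_left₀ h0.ne']

theorem injOn_edgeMap (i : Fin N) : InjOn (K.edgeMap i) (Icc 0 1) := by
  obtain ⟨C, -, h⟩ := K.exists_abs_sub_le_edgeMap i
  intro s hs t ht hst
  have := h s hs t ht
  rw [hst, sub_self, norm_zero, mul_zero] at this
  exact sub_eq_zero.mp (abs_nonpos_iff.mp this)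

/-- On each edge the datum is a polynomial composed with the Lipschitz inverse of the
parametrization. The closed-cover lemma turns these estimates into one on the whole boundary. -/
theorem exists_boundary_function (d : Fin N → ℝ) (q : Fin N → Polynomial ℝ)
    (h0 : ∀ i, (q i).eval 0 = d i) (h1 : ∀ i, (q i).eval 1 = d (i + 1)) :
    ∃ g : Plane → ℝ, (∀ i, ∀ t ∈ Icc (0 : ℝ) 1, g (K.edgeMap i t) = (q i).eval t) ∧
      ∃ C : ℝ, 0 ≤ C ∧ ∀ x ∈ frontier K.E, ∀ y ∈ frontier K.E, |g x - g y| ≤ C * ‖x - y‖ := by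
  classical
  have hend : ∀ i, ∀ t ∈ Icc (0 : ℝ) 1, ∀ l, K.edgeMap i t = K.vertex l →
      K.vertex l ∈ ({K.vertex i, K.vertex (i + 1)} : Set Plane) → (q i).eval t = d l := by
    intro i t ht l hl hmem
    rcases hmem with h | h
    · have hli := K.vertex_injective h
      subst hli
      rw [← K.edgeMap_left] at hl
      rw [K.injOn_edgeMap _ ht (by simp) hl, h0]
    · have hli := K.vertex_injective h
      subst hli
      rw [← K.edgeMap_right] at hl
      rw [K.injOn_edgeMap _ ht (by simp) hl, h1]
  -- The value is independent of the chosen edge and parameter: distinct edges meet only at a common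
  -- vertex `l`, and there both polynomials take the value `d l`.
  have hwd : ∀ i j, ∀ s ∈ Icc (0 : ℝ) 1, ∀ t ∈ Icc (0 : ℝ) 1, K.edgeMap i s = K.edgeMap j t →
      (q i).eval s = (q j).eval t := by
    intro i j s hs t ht hst
    by_cases hij : i = j
    · subst hij
      rw [K.injOn_edgeMap i hs ht hst]
    · have hmem := K.edgeMap_inter hij (mem_image_of_mem _ hs) (hst ▸ mem_image_of_mem _ ht)
      obtain ⟨l, hl⟩ : ∃ l, K.edgeMap i s = K.vertex l := by
        rcases hmem.1 with h | h
        exacts [⟨_, h⟩, ⟨_, h⟩]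
      rw [hl] at hmem
      rw [hend i s hs l hl hmem.1, hend j t ht l (hst ▸ hl) hmem.2]
  let g : Plane → ℝ := fun x =>
    if h : ∃ p : Fin N × ℝ, p.2 ∈ Icc (0 : ℝ) 1 ∧ K.edgeMap p.1 p.2 = x then
      (q h.choose.1).eval h.choose.2 else 0
  have hg : ∀ i, ∀ t ∈ Icc (0 : ℝ) 1, g (K.edgeMap i t) = (q i).eval t := by
    intro i t ht
    have h : ∃ p : Fin N × ℝ, p.2 ∈ Icc (0 : ℝ) 1 ∧ K.edgeMap p.1 p.2 = K.edgeMap i t :=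
      ⟨(i, t), ht, rfl⟩
    simp only [g, dif_pos h]
    exact hwd _ _ _ h.choose_spec.1 _ ht h.choose_spec.2
  refine ⟨g, hg, ?_⟩
  obtain ⟨c, r, hr0, hr, hs⟩ := K.starShaped
  choose C hC0 hC using K.exists_abs_sub_le_edgeMap
  have hlip : ∀ i, ∃ B : ℝ, 0 ≤ B ∧ ∀ s ∈ Icc (0 : ℝ) 1, ∀ t ∈ Icc (0 : ℝ) 1,
      |(q i).eval s - (q i).eval t| ≤ B * |s - t| := by
    intro i
    obtain ⟨B, hB⟩ := isCompact_Icc.exists_bound_of_continuousOn (s := Icc (0 : ℝ) 1)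
      (q i).derivative.continuous.continuousOn
    refine ⟨B, (norm_nonneg _).trans (hB 0 (by simp)), fun s hs t ht => ?_⟩
    exact (convex_Icc (0 : ℝ) 1).norm_image_sub_le_of_norm_hasDerivWithin_le
      (fun x _ => (q i).hasDerivWithinAt x _) hB ht hs
  choose B hB0 hB using hlip
  have hbd : ∀ i, ∃ M : ℝ, 0 ≤ M ∧ ∀ t ∈ Icc (0 : ℝ) 1, |(q i).eval t| ≤ M := by
    intro i
    obtain ⟨M, hM⟩ := isCompact_Icc.exists_bound_of_continuousOn (s := Icc (0 : ℝ) 1)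
      (q i).continuous.continuousOn
    exact ⟨M, (norm_nonneg _).trans (hM 0 (by simp)), hM⟩
  choose M hM0 hM using hbd
  refine exists_lipschitz_of_closed_cover K.isOpen K.isBounded hs hr0 hr
    (A := fun i => K.edgeMap i '' Icc 0 1)
    (fun i => (isCompact_Icc.image_of_continuousOn (K.continuousOn_edgeMap i)).isClosed)
    K.frontier_eq_iUnion_edgeMap.subset (L := ∑ i, B i * C i)
    (Finset.sum_nonneg fun i _ => mul_nonneg (hB0 i) (hC0 i)) ?_ (M := ∑ i, M i) ?_
  · rintro i _ ⟨s, hs, rfl⟩ _ ⟨t, ht, rfl⟩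
    rw [hg i s hs, hg i t ht]
    calc |(q i).eval s - (q i).eval t| ≤ B i * |s - t| := hB i s hs t ht
      _ ≤ B i * (C i * ‖K.edgeMap i s - K.edgeMap i t‖) :=
        mul_le_mul_of_nonneg_left (hC i s hs t ht) (hB0 i)
      _ = B i * C i * ‖K.edgeMap i s - K.edgeMap i t‖ := by ring
      _ ≤ _ := by
        gcongr
        exact Finset.single_le_sum (f := fun i => B i * C i)
          (fun i _ => mul_nonneg (hB0 i) (hC0 i)) (Finset.mem_univ i)
  · intro x hx
    rw [K.frontier_eq_iUnion_edgeMap] at hx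
    obtain ⟨i, t, ht, rfl⟩ := mem_iUnion.mp hx
    rw [hg i t ht]
    exact (hM i t ht).trans (Finset.single_le_sum (fun i _ => hM0 i) (Finset.mem_univ i))

end CurvedElement

/-! ### Existence and uniqueness in the virtual space -/

section Weak

open Metric Filter Topology InnerProductSpace

variable {E : Set Plane}

theorem continuous_polyVal (p : MvPolynomial (Fin 2) ℝ) : Continuous (polyVal p) := by
  unfold polyVal
  exact (MvPolynomial.continuous_eval p).comp (by fun_prop)

theorem memLp_of_continuousOn_closure {F : Type*} [NormedAddCommGroup F] {f : Plane → F}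
    [SecondCountableTopologyEither Plane F]
    (hb : Bornology.IsBounded E) (hE : IsOpen E) (hf : ContinuousOn f (closure E)) :
    MemLp f 2 (volume.restrict E) := by
  obtain ⟨C, hC⟩ := hb.isCompact_closure.exists_bound_of_continuousOn hf
  have : IsFiniteMeasure ((volume : Measure Plane).restrict E) :=
    isFiniteMeasure_restrict.mpr hb.measure_lt_top.ne
  refine MemLp.of_bound ((hf.mono subset_closure).aestronglyMeasurable hE.measurableSet) C ?_
  filter_upwards [ae_restrict_mem hE.measurableSet] with x hx using hC x (subset_closure hx)

theorem MemH1.congr (hE : IsOpen E) {u v : Plane → ℝ} (h : EqOn u v E) (hu : MemH1 E u) :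
    MemH1 E v := by
  obtain ⟨hu2, g, hg, hug⟩ := hu
  refine ⟨hu2.ae_eq ?_, g, hg, fun φ hφ => ?_⟩
  · filter_upwards [ae_restrict_mem hE.measurableSet] with x hx using h hx
  · rw [← hug φ hφ]
    exact setIntegral_congr_fun hE.measurableSet fun x hx => by simp only [h hx]

theorem HasWeakNegLaplacian.congr (hE : IsOpen E) {u v f : Plane → ℝ} (h : EqOn u v E)
    (hu : HasWeakNegLaplacian E u f) : HasWeakNegLaplacian E v f := by
  intro φ hφ
  rw [← hu φ hφ]
  congr 1
  exact setIntegral_congr_fun hE.measurableSet fun x hx => by simp only [h hx]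

theorem integral_mul_laplacian (hE : IsOpen E) {w φ : Plane → ℝ} (hw : ContDiffOn ℝ 2 w E)
    (hφ : IsTest E φ) :
    ∫ x in E, w x * Laplacian.laplacian φ x = ∫ x in E, Laplacian.laplacian w x * φ x := by
  have hw1 : ContDiffOn ℝ 1 w E := hw.of_le one_le_two
  have hφ1 : ContDiff ℝ 1 φ := hφ.smooth.of_le (by norm_cast)
  have hφ2 : ContDiff ℝ 2 φ := hφ.smooth.of_le (by norm_cast)
  have hpd : ∀ i, ContDiff ℝ 1 (pd i φ) := fun i => contDiff_iff_contDiffAt.mpr fun x =>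
    ContDiffAt.pd (n := 1) hφ2.contDiffAt i
  have hs : ∀ i, tsupport (pd i φ) ⊆ E := fun i => (tsupport_pd_subset φ i).trans hφ.supp
  have hG := integral_pd_mul_pd hE hw hφ1 hφ.compact hφ.supp
  have h1 : ∫ x in E, w x * Laplacian.laplacian φ x =
      ∑ i, ∫ x in E, w x * pd i (pd i φ) x := by
    rw [← integral_finsetSum]
    · refine integral_congr_ae (Eventually.of_forall fun x => ?_)
      beta_reduce
      rw [laplacian_eq_pd hφ2.contDiffAt, Finset.mul_sum]
    · exact fun i _ => (integrable_mul_of_tsupport_subset hE hw.continuousOn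
        (continuous_pd (hpd i) i) (hasCompactSupport_pd (hasCompactSupport_pd hφ.compact i) i)
        ((tsupport_pd_subset _ i).trans (hs i))).integrableOn
  have h2 : ∫ x in E, ∑ i, pd i w x * pd i φ x = ∑ i, ∫ x in E, pd i w x * pd i φ x :=
    integral_finsetSum _ fun i _ => (integrable_mul_of_tsupport_subset hE
      (continuousOn_pd hE hw1 i) (hpd i).continuous (hasCompactSupport_pd hφ.compact i)
      (hs i)).integrableOn
  rw [h1, Finset.sum_congr rfl fun i _ =>
    integral_mul_pd hE hw1 (hpd i) (hasCompactSupport_pd hφ.compact i) (hs i) i,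
    Finset.sum_neg_distrib, ← h2, hG, neg_neg]

theorem continuousOn_extendZero (v : C(closure E, ℝ)) :
    ContinuousOn (extendZero E v) (closure E) := by
  rw [continuousOn_iff_continuous_domRestrict]
  convert v.continuous using 1
  ext x
  simp [extendZero]

/-- The Poisson equation in a domain star-shaped with respect to a ball, with polynomial right-hand
side and Lipschitz boundary values. -/
theorem exists_memH1_of_lipschitz {c : Plane} {r : ℝ} (hE : IsOpen E)
    (hb : Bornology.IsBounded E) (hs : ∀ y ∈ ball c r, StarConvex ℝ y E) (hr0 : 0 < r)
    (hr : ball c r ⊆ E) (p : MvPolynomial (Fin 2) ℝ) {g : Plane → ℝ} {L : ℝ} (hL : 0 ≤ L)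
    (hg : ∀ x ∈ frontier E, ∀ y ∈ frontier E, |g x - g y| ≤ L * ‖x - y‖) :
    ∃ w : Plane → ℝ, ContinuousOn w (closure E) ∧ MemH1 E w ∧
      HasWeakNegLaplacian E w (polyVal p) ∧ ∀ x ∈ frontier E, w x = g x := by
  obtain ⟨Q, hQ, hQp⟩ := exists_laplacian_eq_polyVal p
  have hQ1 : ContDiff ℝ 1 Q := hQ.of_le (by norm_cast)
  have hQ2 : ContDiff ℝ 2 Q := hQ.of_le (by norm_cast)
  obtain ⟨R, hR⟩ := hb.closure.subset_closedBall 0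
  obtain ⟨A, hA⟩ := hQ1.contDiffOn.exists_lipschitzOnWith (s := closedBall (0 : Plane) R)
    one_ne_zero (convex_closedBall _ _) (isCompact_closedBall _ _)
  have hLip : ∀ x ∈ frontier E, ∀ y ∈ frontier E,
      |(g x + Q x) - (g y + Q y)| ≤ (L + A) * ‖x - y‖ := by
    intro x hx y hy
    have h1 := hg x hx y hy
    have h2 := hA.dist_le_mul x (hR (frontier_subset_closure hx)) y
      (hR (frontier_subset_closure hy))
    rw [Real.dist_eq, dist_eq_norm] at h2
    rw [show g x + Q x - (g y + Q y) = (g x - g y) + (Q x - Q y) by ring, add_mul]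
    exact (abs_add_le _ _).trans (add_le_add h1 h2)
  -- With `ΔQ = p`, the solution is `u - Q`, where the harmonic `u` has boundary values `g + Q`.
  -- Adding `Q` keeps the data Lipschitz.
  obtain ⟨u, hu, huh, hug⟩ := exists_harmonic_of_lipschitz hE hb hs hr0 hr
    (G := fun x => g x + Q x) (L := L + A) (by positivity) hLip
  have hLon : LipschitzOnWith (L + A).toNNReal (fun x => g x + Q x) (frontier E) :=
    LipschitzOnWith.of_dist_le_mul fun x hx y hy => by
      rw [Real.coe_toNNReal _ (by positivity), Real.dist_eq, dist_eq_norm]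
      exact hLip x hx y hy
  obtain ⟨G, hG, hGg⟩ := hLon.extend_real
  have hu1 : ContDiffOn ℝ 1 u E := huh.contDiffOn.of_le one_le_two
  have hu2 : ContDiffOn ℝ 2 u E := huh.contDiffOn
  have hmu : MemH1 E u := memH1_of_contDiffOn hE hu1 (memLp_of_continuousOn_closure hb hE hu)
    (memLp_gradient_of_lipschitz hE hb hu huh hG fun x hx => (hug x hx).trans (hGg hx))
  have hgQ : Continuous (gradient Q) :=
    (InnerProductSpace.toDual ℝ Plane).symm.continuous.comp (hQ1.continuous_fderiv one_ne_zero)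
  have hmQ : MemH1 E Q := memH1_of_contDiffOn hE hQ1.contDiffOn
    (memLp_of_continuousOn_closure hb hE hQ.continuous.continuousOn)
    (memLp_of_continuousOn_closure hb hE hgQ.continuousOn)
  refine ⟨u - Q, hu.sub hQ.continuous.continuousOn, ?_, fun φ hφ => ?_, fun x hx => ?_⟩
  · rw [sub_eq_add_neg, ← neg_one_smul ℝ Q]
    exact hmu.add (hmQ.smul (-1))
  · rw [integral_mul_laplacian (w := u - Q) hE (hu2.sub hQ2.contDiffOn) hφ, ← integral_neg]
    refine setIntegral_congr_fun hE.measurableSet fun x hx => ?_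
    beta_reduce
    rw [(hu2.contDiffAt (hE.mem_nhds hx)).laplacian_sub hQ2.contDiffAt, hQp,
      (huh x hx).2.eq_of_nhds]
    simp
  · simp [hug x hx]

/-- Adding a smooth `Q` with `ΔQ = p` makes `w` weakly harmonic, so Weyl's lemma gives the interior
regularity that the truncated energy argument requires. -/
theorem eq_zero_of_hasWeakNegLaplacian (hE : IsOpen E) (hb : Bornology.IsBounded E)
    {w : Plane → ℝ} {p : MvPolynomial (Fin 2) ℝ} (hw : ContinuousOn w (closure E))
    (hw0 : ∀ x ∈ frontier E, w x = 0) (hp : HasWeakNegLaplacian E w (polyVal p))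
    (horth : ∫ x in E, polyVal p x * w x = 0) : ∀ x ∈ closure E, w x = 0 := by
  obtain ⟨Q, hQ, hQp⟩ := exists_laplacian_eq_polyVal p
  have hQ2 : ContDiff ℝ 2 Q := hQ.of_le (by norm_cast)
  have hh : HarmonicOnNhd (w + Q) E := by
    refine weyl hE ((hw.mono subset_closure).add hQ.continuous.continuousOn) fun φ hφ => ?_
    have e1 : Integrable (fun x => w x * Laplacian.laplacian φ x) (volume.restrict E) :=
      (memLp_of_continuousOn_closure hb hE hw).integrable_mul hφ.memLp_laplacian
    have e2 : Integrable (fun x => Q x * Laplacian.laplacian φ x) (volume.restrict E) :=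
      (memLp_of_continuousOn_closure hb hE hQ.continuous.continuousOn).integrable_mul
        hφ.memLp_laplacian
    simp only [Pi.add_apply, add_mul]
    rw [integral_add e1 e2, integral_mul_laplacian hE hQ2.contDiffOn hφ]
    simp only [hQp]
    rw [← hp φ hφ]
    ring
  have hwQ : w = (w + Q) - Q := by simp
  have hw2 : ContDiffOn ℝ 2 w E := by
    rw [hwQ]
    exact hh.contDiffOn.sub hQ2.contDiffOn
  have hlap : ∀ x ∈ E, Laplacian.laplacian w x = - polyVal p x := by
    intro x hx
    rw [hwQ, (hh.contDiffOn.contDiffAt (hE.mem_nhds hx)).laplacian_sub hQ2.contDiffAt, hQp,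
      (hh x hx).2.eq_of_nhds]
    simp
  have h := eq_zero_of_laplacian_orthogonal hE hb hw hw2 hw0 (continuous_polyVal p) hlap horth
  intro x hx
  rw [closure_eq_self_union_frontier] at hx
  exact hx.elim (h x) (hw0 x)

theorem polynomial_eq_zero_of_polyVal (hE : IsOpen E) (hne : E.Nonempty)
    {p : MvPolynomial (Fin 2) ℝ} (h : ∀ x ∈ E, polyVal p x = 0) : p = 0 := by
  obtain ⟨c, hc⟩ := hne
  have ho : IsOpen ((WithLp.toLp 2 : (Fin 2 → ℝ) → Plane) ⁻¹' E) :=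
    hE.preimage (PiLp.continuous_toLp 2 _)
  obtain ⟨δ, hδ, hsub⟩ := Metric.isOpen_iff.mp ho (fun i => c i) hc
  refine MvPolynomial.funext_set (fun i => ball (c i) δ) (fun i => ?_) fun x hx => ?_
  · rw [Real.ball_eq_Ioo]
    exact Ioo_infinite (by linarith)
  · rw [← ball_pi _ hδ] at hx
    rw [map_zero]
    exact h _ (hsub hx)

/-- A continuous function whose weak Laplacian is the polynomial `p`, if it vanishes, has
`p = 0`. -/
theorem polynomial_eq_zero_of_hasWeakNegLaplacian (hE : IsOpen E) (hne : E.Nonempty)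
    {w : Plane → ℝ} {p : MvPolynomial (Fin 2) ℝ} (hw : ∀ x ∈ E, w x = 0)
    (hp : HasWeakNegLaplacian E w (polyVal p)) : p = 0 := by
  refine polynomial_eq_zero_of_polyVal hE hne ?_
  have hae : ∀ᵐ x, x ∈ E → polyVal p x = 0 := by
    refine hE.ae_eq_zero_of_integral_contDiff_smul_eq_zero
      ((continuous_polyVal p).locallyIntegrable.locallyIntegrableOn _) fun φ hφ hc hs => ?_
    have hT : IsTest E φ := ⟨hφ, hc, hs⟩
    have h := hp φ hT
    rw [setIntegral_congr_fun (g := fun _ => (0 : ℝ)) hE.measurableSet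
      (fun x hx => by simp [hw x hx])] at h
    rw [integral_zero, neg_zero] at h
    rw [← setIntegral_eq_integral_of_forall_compl_eq_zero (s := E), h]
    · simp [mul_comm]
    · intro x hx
      rw [image_eq_zero_of_notMem_tsupport fun h => hx (hs h), zero_smul]
  have hae' : polyVal p =ᵐ[volume.restrict E] fun _ => 0 := by
    rw [Filter.EventuallyEq, ae_restrict_iff' hE.measurableSet]
    exact hae
  exact Measure.eqOn_open_of_ae_eq hae' hE (continuous_polyVal p).continuousOn continuousOn_const

end Weak

/-! ### Unisolvence -/

theorem polyVal_sum {ι : Type*} (s : Finset ι) (c : ι → ℝ) (p : ι → MvPolynomial (Fin 2) ℝ)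
    (x : Plane) : polyVal (∑ j ∈ s, c j • p j) x = ∑ j ∈ s, c j * polyVal (p j) x := by
  simp [polyVal, MvPolynomial.smul_eval]

namespace CurvedElement

variable {N : ℕ} [NeZero N] {m : ℕ} (K : CurvedElement N m) {k : ℕ}

theorem exists_mem_virtualSpace {p : MvPolynomial (Fin 2) ℝ} (hp : p ∈ polyLE ((k : ℤ) - 2))
    (d : Fin N → ℝ) (q : Fin N → Polynomial ℝ) (hq : ∀ i, (q i).natDegree ≤ k)
    (h0 : ∀ i, (q i).eval 0 = d i) (h1 : ∀ i, (q i).eval 1 = d (i + 1)) :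
    ∃ v : K.virtualSpace k, HasWeakNegLaplacian K.E (extendZero K.E v) (polyVal p) ∧
      ∀ i, ∀ t ∈ Icc (0 : ℝ) 1, extendZero K.E v (K.edgeMap i t) = (q i).eval t := by
  obtain ⟨g, hg, C, hC, hgC⟩ := K.exists_boundary_function d q h0 h1
  obtain ⟨c, r, hr0, hr, hs⟩ := K.starShaped
  obtain ⟨w, hw, hw1, hwp, hwg⟩ :=
    exists_memH1_of_lipschitz K.isOpen K.isBounded hs hr0 hr p hC hgC
  let v : C(closure K.E, ℝ) := ⟨fun x => w x, continuousOn_iff_continuous_domRestrict.mp hw⟩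
  have hvw : EqOn w (extendZero K.E v) (closure K.E) := fun x hx => by
    simp only [extendZero, LinearMap.coe_mk, AddHom.coe_mk, dif_pos hx]
    rfl
  have hvE : EqOn w (extendZero K.E v) K.E := hvw.mono subset_closure
  have hedge : ∀ i, ∀ t ∈ Icc (0 : ℝ) 1, extendZero K.E v (K.edgeMap i t) = (q i).eval t := by
    intro i t ht
    have hf := K.edgeMap_mem_frontier i ht
    rw [← hvw (frontier_subset_closure hf), hwg _ hf, hg i t ht]
  have hlap := hwp.congr K.isOpen hvE
  refine ⟨⟨v, hw1.congr K.isOpen hvE, ⟨p, hp, hlap⟩, ?_, fun i hi => ?_⟩, hlap, hedge⟩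
  -- The curved edge is parametrized on `[a, b]` in the definition of the space and on `[0, 1]`
  -- here; the affine change of variable does not raise the degree.
  · refine ⟨(q 0).comp (Polynomial.C (K.b - K.a)⁻¹ * (Polynomial.X - Polynomial.C K.a)), ?_, ?_⟩
    · refine Polynomial.natDegree_comp_le.trans ((Nat.mul_le_mul (hq 0) ?_).trans_eq (mul_one k))
      exact (Polynomial.natDegree_C_mul_le _ _).trans (Polynomial.natDegree_X_sub_C_le _)
    · intro x hx
      rw [← onInterval_image K.a_lt_b] at hx
      obtain ⟨t, ht, rfl⟩ := hx
      have h := hedge 0 t ht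
      rw [edgeMap_zero_apply] at h
      rw [h]
      have hba : K.b - K.a ≠ 0 := (sub_pos.mpr K.a_lt_b).ne'
      have e : (K.b - K.a)⁻¹ * (onInterval K.a K.b t - K.a) = t := by
        rw [onInterval, add_sub_cancel_left, mul_comm t, inv_mul_cancel_left₀ hba]
      simp [Polynomial.eval_comp, e]
  · refine ⟨q i, hq i, fun t ht => ?_⟩
    rw [← hedge i t ht, K.edgeMap_of_ne hi]

theorem exists_polynomial_edgeMap (v : K.virtualSpace k) (i : Fin N) :
    ∃ q : Polynomial ℝ, q.natDegree ≤ k ∧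
      ∀ t ∈ Icc (0 : ℝ) 1, extendZero K.E v (K.edgeMap i t) = q.eval t := by
  obtain ⟨v, -, -, ⟨q, hq, hqv⟩, hstr⟩ := v
  by_cases hi : i = 0
  · subst hi
    refine ⟨q.comp (Polynomial.C (K.b - K.a) * Polynomial.X + Polynomial.C K.a), ?_, ?_⟩
    · exact Polynomial.natDegree_comp_le.trans
        ((Nat.mul_le_mul hq Polynomial.natDegree_linear_le).trans_eq (mul_one k))
    · intro t ht
      rw [edgeMap_zero_apply, hqv _ (onInterval_image K.a_lt_b ▸ mem_image_of_mem _ ht)]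
      simp [Polynomial.eval_comp, onInterval, mul_comm, add_comm]
  · obtain ⟨q, hq, hqv⟩ := hstr i hi
    exact ⟨q, hq, fun t ht => by rw [K.edgeMap_of_ne hi]; exact hqv t ht⟩

variable (μ : Module.Basis (Fin (k * (k - 1) / 2)) ℝ (polyLE ((k : ℤ) - 2)))

/-- The degrees of freedom with respect to a basis of the polynomials of degree at most `k - 2`. -/
abbrev basisDofs : K.virtualSpace k →ₗ[ℝ] (DofIndex N k → ℝ) :=
  K.dofs k fun j => (μ j : MvPolynomial (Fin 2) ℝ)

theorem nonempty : K.E.Nonempty := by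
  obtain ⟨c, r, hr0, hr, -⟩ := K.starShaped
  exact ⟨c, hr (Metric.mem_ball_self hr0)⟩

theorem volume_real_ne_zero : volume.real K.E ≠ 0 :=
  (ENNReal.toReal_pos (K.isOpen.measure_pos volume K.nonempty).ne'
    K.isBounded.measure_lt_top.ne).ne'

/-- Vertex and internal nodal values together are the values at all `k + 1` nodes of each edge,
which determine a polynomial of degree at most `k`. -/
theorem eq_zero_on_frontier (hk : 1 ≤ k) (v : K.virtualSpace k)
    (hv : K.basisDofs μ v = 0) : ∀ x ∈ frontier K.E, extendZero K.E v x = 0 := by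
  intro x hx
  rw [K.frontier_eq_iUnion_edgeMap] at hx
  obtain ⟨i, t, ht, rfl⟩ := mem_iUnion.mp hx
  have hvert : ∀ i, extendZero K.E v (K.vertex i) = 0 := fun i => congrFun hv (.inl i)
  obtain ⟨q, hq, hqv⟩ := K.exists_polynomial_edgeMap v i
  have h : q = 0 := by
    refine poly_eq_zero_of_lobattoNodes hk hq fun s hs => ?_
    simp only [lobattoNodes, Finset.mem_insert] at hs
    rcases hs with rfl | rfl | hs
    · rw [← hqv 0 (by simp), edgeMap_left, hvert]
    · rw [← hqv 1 (by simp), edgeMap_right, hvert]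
    · obtain ⟨hs0, hs1⟩ := (roots_lobatto k hk).2 s hs
      rw [← hqv s ⟨hs0.le, hs1.le⟩]
      by_cases hi : i = 0
      · subst hi
        rw [edgeMap_zero_apply]
        exact congrFun hv (.inr (.inr (.inl ⟨s, hs⟩)))
      · rw [K.edgeMap_of_ne hi]
        exact congrFun hv (.inr (.inl (⟨i, hi⟩, ⟨s, hs⟩)))
  rw [hqv t ht, h, Polynomial.eval_zero]

/-- The Laplacian of `v` is itself a combination of the polynomials against which the moments
vanish, hence orthogonal to `v`; the energy argument then applies. -/
theorem basisDofs_injective (hk : 1 ≤ k) : Function.Injective (K.basisDofs μ) := by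
  rw [injective_iff_map_eq_zero]
  intro v hv
  obtain ⟨p, hp, hvp⟩ := v.2.2.1
  have hmom : ∀ j,
      ∫ x in K.E, polyVal (μ j : MvPolynomial (Fin 2) ℝ) x * extendZero K.E v x = 0 := by
    intro j
    have h : (volume.real K.E)⁻¹ * ∫ x in K.E, extendZero K.E v x * polyVal (μ j) x = 0 :=
      congrFun hv (.inr (.inr (.inr j)))
    simp_rw [mul_comm (polyVal _ _)]
    exact (mul_eq_zero.mp h).resolve_left (inv_ne_zero K.volume_real_ne_zero)
  have hintg : ∀ j, Integrable
      (fun x => polyVal (μ j : MvPolynomial (Fin 2) ℝ) x * extendZero K.E v x)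
      (volume.restrict K.E) := fun j => (memLp_polyVal K.isBounded _).integrable_mul v.2.1.1
  have hpsum : p = ∑ j, μ.repr ⟨p, hp⟩ j • (μ j : MvPolynomial (Fin 2) ℝ) := by
    conv_lhs => rw [show p = ((⟨p, hp⟩ : polyLE ((k : ℤ) - 2)) : MvPolynomial (Fin 2) ℝ) from rfl,
      ← μ.sum_repr ⟨p, hp⟩]
    push_cast
    rfl
  have horth : ∫ x in K.E, polyVal p x * extendZero K.E v x = 0 := by
    generalize μ.repr ⟨p, hp⟩ = c at hpsum
    rw [hpsum]
    simp_rw [polyVal_sum, Finset.sum_mul, mul_assoc]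
    rw [integral_finsetSum _ fun j _ => (hintg j).const_mul _]
    simp_rw [integral_const_mul, hmom, mul_zero, Finset.sum_const_zero]
  have h := eq_zero_of_hasWeakNegLaplacian K.isOpen K.isBounded (continuousOn_extendZero _)
    (K.eq_zero_on_frontier μ hk v hv) hvp horth
  ext x
  have hx := h x x.2
  simpa [extendZero] using hx

theorem hasWeakNegLaplacian_sum {ι : Type*} (s : Finset ι) (c : ι → ℝ)
    (v : ι → K.virtualSpace k) (p : ι → MvPolynomial (Fin 2) ℝ)
    (h : ∀ j, HasWeakNegLaplacian K.E (extendZero K.E (v j)) (polyVal (p j))) :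
    HasWeakNegLaplacian K.E (extendZero K.E ((∑ j ∈ s, c j • v j : K.virtualSpace k) :
      C(closure K.E, ℝ))) (polyVal (∑ j ∈ s, c j • p j)) := by
  classical
  induction s using Finset.induction_on with
  | empty =>
    have : polyVal 0 = 0 := by ext; simp [polyVal]
    simp only [Finset.sum_empty, Submodule.coe_zero, map_zero, this]
    exact HasWeakNegLaplacian.zero _
  | insert a s ha ih =>
    have e : polyVal (∑ j ∈ insert a s, c j • p j) =
        c a • polyVal (p a) + polyVal (∑ j ∈ s, c j • p j) := by
      ext x
      simp only [polyVal_sum, Finset.sum_insert ha, Pi.add_apply, Pi.smul_apply, smul_eq_mul]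
      rw [← polyVal_sum]
      simp [polyVal, MvPolynomial.smul_eval]
    rw [e, Finset.sum_insert ha, Submodule.coe_add, map_add, Submodule.coe_smul, map_smul]
    exact HasWeakNegLaplacian.add ((v a).2.1.1.const_smul _)
      (∑ j ∈ s, c j • v j : K.virtualSpace k).2.1.1
      ((memLp_polyVal K.isBounded _).const_smul _) (memLp_polyVal K.isBounded _)
      ((h a).smul _) ih

/-- Boundary values and moments are matched in turn, the moments being corrected by functions that
vanish on the boundary. The dimension of the virtual space is never computed. -/
theorem basisDofs_surjective (hk : 1 ≤ k) : Function.Surjective (K.basisDofs μ) := by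
  classical
  intro e
  -- Prescribed nodal values on the edge `i`. The parameter `1` receives the vertex `i + 1`, which
  -- makes neighbouring edges compatible; the final `0`, off the nodes, is never used.
  let vals : Fin N → ℝ → ℝ := fun i t =>
    if t = 0 then e (.inl i) else if t = 1 then e (.inl (i + 1)) else
      if ht : t ∈ lobattoInternal k then
        if hi : i = 0 then e (.inr (.inr (.inl ⟨t, ht⟩)))
        else e (.inr (.inl (⟨i, hi⟩, ⟨t, ht⟩)))
      else 0
  choose q hq hqe using fun i => exists_poly_eval_lobattoNodes hk (vals i)
  obtain ⟨vb, -, hvb⟩ := K.exists_mem_virtualSpace (k := k) (Submodule.zero_mem _)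
    (fun i => e (.inl i)) q hq (fun i => by rw [hqe i 0 (by simp [lobattoNodes])]; simp [vals])
    (fun i => by rw [hqe i 1 (by simp [lobattoNodes])]; simp [vals])
  -- Functions with zero boundary values and `-Δ (w j) = μ j`; they affect only the moments.
  choose w hwp hw using fun j => K.exists_mem_virtualSpace (k := k) (μ j).2 (fun _ => 0)
    (fun _ => 0) (fun _ => by simp) (fun _ => by simp) (fun _ => by simp)
  have hmem : ∀ t : lobattoInternal k, (t : ℝ) ∈ Icc (0 : ℝ) 1 := fun t =>
    ⟨((roots_lobatto k hk).2 t t.2).1.le, ((roots_lobatto k hk).2 t t.2).2.le⟩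
  have hvals : ∀ i, ∀ t : lobattoInternal k, extendZero K.E vb (K.edgeMap i t) =
      if hi : i = 0 then e (.inr (.inr (.inl t))) else e (.inr (.inl (⟨i, hi⟩, t))) := by
    intro i t
    rw [hvb i t (hmem t), hqe i t (by simp [lobattoNodes])]
    simp only [vals, if_neg ((roots_lobatto k hk).2 t t.2).1.ne',
      if_neg ((roots_lobatto k hk).2 t t.2).2.ne, dif_pos t.2]
  have hwv : ∀ j i, K.basisDofs μ (w j) (.inl i) = 0 := fun j i => by
    change extendZero K.E (w j) (K.vertex i) = 0
    rw [← edgeMap_left, hw j i 0 (by simp), Polynomial.eval_zero]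
  have hws : ∀ j i t, K.basisDofs μ (w j) (.inr (.inl (i, t))) = 0 := fun j i t => by
    change extendZero K.E (w j) (AffineMap.lineMap _ _ _) = 0
    rw [← K.edgeMap_of_ne i.2, hw j i t (hmem t), Polynomial.eval_zero]
  have hwc : ∀ j t, K.basisDofs μ (w j) (.inr (.inr (.inl t))) = 0 := fun j t => by
    change extendZero K.E (w j) (K.γ _) = 0
    rw [← K.edgeMap_zero_apply, hw j 0 t (hmem t), Polynomial.eval_zero]
  let Φ : (Fin (k * (k - 1) / 2) → ℝ) →ₗ[ℝ] K.virtualSpace k := Fintype.linearCombination ℝ w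
  have hΦ : ∀ c, Φ c = ∑ j, c j • w j := fun c => rfl
  have hsum : ∀ c x, K.basisDofs μ (Φ c) x = ∑ j, c j * K.basisDofs μ (w j) x := by
    intro c x
    rw [hΦ, map_sum, Finset.sum_apply]
    simp only [map_smul, Pi.smul_apply, smul_eq_mul]
  let T : (Fin (k * (k - 1) / 2) → ℝ) →ₗ[ℝ] (Fin (k * (k - 1) / 2) → ℝ) :=
    LinearMap.funLeft ℝ ℝ (fun j => (.inr (.inr (.inr j)) : DofIndex N k)) ∘ₗ K.basisDofs μ ∘ₗ Φ
  have hT : ∀ c j, T c j = K.basisDofs μ (Φ c) (.inr (.inr (.inr j))) := fun c j => rfl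
  -- A combination with zero moments has all degrees of freedom zero, so it vanishes by uniqueness.
  -- Its Laplacian `∑ c j • μ j`, up to sign, is then zero, and independence of the basis gives `c =
  -- 0`.
  have hTinj : Function.Injective T := by
    rw [injective_iff_map_eq_zero]
    intro c hc
    have h0 : K.basisDofs μ (Φ c) = 0 := by
      funext x
      rcases x with i | ⟨i, t⟩ | t | j
      · simp only [hsum, hwv, mul_zero, Finset.sum_const_zero, Pi.zero_apply]
      · simp only [hsum, hws, mul_zero, Finset.sum_const_zero, Pi.zero_apply]
      · simp only [hsum, hwc, mul_zero, Finset.sum_const_zero, Pi.zero_apply]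
      · rw [← hT, hc, Pi.zero_apply, Pi.zero_apply]
    have h1 : Φ c = 0 := K.basisDofs_injective μ hk (by rw [h0, map_zero])
    have h2 := K.hasWeakNegLaplacian_sum Finset.univ c w _ hwp
    rw [← hΦ, h1] at h2
    have h3 := polynomial_eq_zero_of_hasWeakNegLaplacian K.isOpen K.nonempty (fun x _ => by
      simp) h2
    have h4 : ∑ j, c j • μ j = 0 := by
      apply Subtype.ext
      push_cast
      exact h3
    exact funext (Fintype.linearIndependent_iff.mp μ.linearIndependent c h4)
  obtain ⟨c, hc⟩ := LinearMap.injective_iff_surjective.mp hTinj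
    fun j => e (.inr (.inr (.inr j))) - K.basisDofs μ vb (.inr (.inr (.inr j)))
  refine ⟨vb + Φ c, ?_⟩
  rw [map_add]
  funext x
  rw [Pi.add_apply]
  rcases x with i | ⟨i, t⟩ | t | j
  · simp only [hsum, hwv, mul_zero, Finset.sum_const_zero, add_zero]
    change extendZero K.E vb (K.vertex i) = _
    rw [← edgeMap_left, hvb i 0 (by simp), hqe i 0 (by simp [lobattoNodes])]
    simp [vals]
  · simp only [hsum, hws, mul_zero, Finset.sum_const_zero, add_zero]
    change extendZero K.E vb (AffineMap.lineMap _ _ _) = _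
    rw [← K.edgeMap_of_ne i.2, hvals, dif_neg i.2]
  · simp only [hsum, hwc, mul_zero, Finset.sum_const_zero, add_zero]
    change extendZero K.E vb (K.γ _) = _
    rw [← K.edgeMap_zero_apply, hvals, dif_pos rfl]
  · rw [← hT, hc]
    ring

end CurvedElement

end

/-- The degrees of freedom are unisolvent: there are exactly `k - 1` internal Gauss-Lobatto nodes per
edge, and every family of values of the degrees of freedom is attained by exactly one function of
the virtual space, for every normalized basis `μ` of the polynomials of degree at most `k - 2`. -/
theorem proposition2p1 (N : ℕ) [NeZero N] (k m : ℕ) (hk : 1 ≤ k) (hkm : k ≤ m)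
    (K : CurvedElement N m)
    (μ : Module.Basis (Fin (k * (k - 1) / 2)) ℝ (polyLE ((k : ℤ) - 2)))
    (hμ : ∀ j, MeasureTheory.eLpNorm (polyVal (μ j : MvPolynomial (Fin 2) ℝ)) ⊤
      (MeasureTheory.volume.restrict K.E) = 1) :
    (lobattoInternal k).card = k - 1 ∧
      (∀ t ∈ lobattoInternal k, 0 < t ∧ t < 1) ∧
      Function.Bijective (K.dofs k (fun j => (μ j : MvPolynomial (Fin 2) ℝ))) := by
  exact ⟨(roots_lobatto k hk).1, (roots_lobatto k hk).2, K.basisDofs_injective μ hk,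
    K.basisDofs_surjective μ hk⟩
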